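/- Let $M$ be a smooth manifold (finite-dimensional, Hausdorff, second countable, without boundary). Let $(\mathcal E,d)$ be a differential complex on $M$: for every $i\in\mathbb Z$, $\mathcal E^i$ is the sheaf of smooth sections of a smooth real vector bundle $V^i$ of finite rank (no boundedness in $i$ is assumed), and the $d:\mathcal E^i\to\mathcal E^{i+1}$ are differential operators (sheaf maps given in local coordinates and frames by finite sums $\sum_{|\alpha|\le m}a_\alpha\partial^\alpha$ with smooth coefficients, where the order $m$ may depend on the place and on $i$) with $d\circ d=0$. Let $J(V^i)$ be the bundle of $\infty$-jets of sections of $V^i$: its fibre at $x$ is the space of formal Taylor series at $x$ of sections of $V^i$, and for $U\subseteq M$ open $\Omega^p(U;J(V^i))$ is the space of smooth $p$-forms on $U$ with values in $J(V^i)$, i.e. of those families of $J(V^i)_x$-valued alternating forms on $T_xM$, $x\in U$, which locally and to each finite jet order are finite sums $\sum_l\alpha_l\otimes j^\infty(s_l)$ with smooth $p$-forms $\alpha_l$ and smooth sections $s_l$. Let $\nabla:\Omega^p(U;J(V^i))\to\Omega^{p+1}(U;J(V^i))$ be the canonical flat connection, for which jets of sections are horizontal, $\nabla(\alpha\otimes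 j^\infty(s))=d\alpha\otimes j^\infty(s)$, and let $J(d):\Omega^p(U;J(V^i))\to\Omega^p(U;J(V^{i+1}))$ be the map $\alpha\otimes j^\infty(s)\mapsto\alpha\otimes j^\infty(ds)$. Let $dR(J(\mathcal E,d))$ be the total complex $$dR(J(\mathcal E,d))^n(U)=\bigoplus_{p+i=n}\Omega^p(U;J(V^i)),\qquad D=\nabla+(-1)^pJ(d)\ \text{ on }\ \Omega^p(U;J(V^i)).$$ Then the map $(\mathcal E,d)\to dR(J(\mathcal E,d))$ that sends a section $s$ of $\mathcal E^n$ to its $\infty$-jet $j^\infty(s)\in\Omega^0(\,\cdot\,;J(V^n))$ is a map of complexes and a quasi-isomorphism: for every open set $U\subseteq M$ the induced map of complexes of sections $(\mathcal E(U),d)\to dR(J(\mathcal E,d))(U)$ induces isomorphisms on all cohomology groups. (In particular it is a quasi-isomorphism of complexes of sheaves.) -/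

import Mathlib

open scoped Manifold ContDiff Topology
open Bundle TopologicalSpace Set Filter

set_option linter.unusedSectionVars false

universe u

namespace JetComplex

section Flat

variable {E F G : Type*} [NormedAddCommGroup E] [NormedSpace ℝ E]
  [NormedAddCommGroup F] [NormedSpace ℝ F] [NormedAddCommGroup G] [NormedSpace ℝ G]

/-- `g` vanishes to order `k` at `z`. -/
def Flat (k : ℕ) (g : E → F) (z : E) : Prop := ∀ r ≤ k, iteratedFDeriv ℝ r g z = 0

theorem Flat.congr {k : ℕ} {g g' : E → F} {z : E} (h : Flat k g z) (e : g' =ᶠ[𝓝 z] g) :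
    Flat k g' z := fun r hr => by
  rw [(e.iteratedFDeriv ℝ r).eq_of_nhds, h r hr]

theorem exists_contDiffOn {g : E → F} {z : E} (h : ContDiffAt ℝ ∞ g z) (k : ℕ) :
    ∃ O : Set E, IsOpen O ∧ z ∈ O ∧ ContDiffOn ℝ k g O := by
  have h1 : ContDiffAt ℝ k g z := h.of_le (by exact_mod_cast le_top)
  have h2 := h1.eventually (by simp)
  obtain ⟨O, hO, hOo, hz⟩ := mem_nhds_iff.1 h2
  exact ⟨O, hOo, hz, fun y hy => ContDiffAt.contDiffWithinAt (hO hy)⟩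

theorem Flat.clm_apply {k : ℕ} {A : E → F →L[ℝ] G} {g : E → F} {z : E} (h : Flat k g z)
    (hA : ContDiffAt ℝ ∞ A z) (hg : ContDiffAt ℝ ∞ g z) : Flat k (fun y => A y (g y)) z := by
  intro r hr
  obtain ⟨O, hO, hz, hAO⟩ := exists_contDiffOn hA r
  obtain ⟨O', hO', hz', hgO⟩ := exists_contDiffOn hg r
  have hU := hO.inter hO'
  have := norm_iteratedFDerivWithin_clm_apply (n := r) (N := r) (hAO.mono inter_subset_left)
    (hgO.mono inter_subset_right) hU.uniqueDiffOn ⟨hz, hz'⟩ le_rfl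
  rw [iteratedFDerivWithin_of_isOpen r hU ⟨hz, hz'⟩] at this
  refine norm_le_zero_iff.1 (this.trans (le_of_eq (Finset.sum_eq_zero fun i _ => ?_)))
  rw [iteratedFDerivWithin_of_isOpen _ hU ⟨hz, hz'⟩ (f := g), h _ ((Nat.sub_le _ _).trans hr)]
  simp

theorem Flat.comp {k : ℕ} {g : F → G} {f : E → F} {z : E} (h : Flat k g (f z))
    (hg : ContDiffAt ℝ ∞ g (f z)) (hf : ContDiffAt ℝ ∞ f z) : Flat k (g ∘ f) z := by
  intro r hr
  obtain ⟨O, hO, hz, hgO⟩ := exists_contDiffOn hg r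
  obtain ⟨P, hP, hzP, hfP⟩ := exists_contDiffOn hf r
  have hU : IsOpen (P ∩ f ⁻¹' O) := hfP.continuousOn.isOpen_inter_preimage hP hO
  obtain ⟨D, hD1, hD⟩ : ∃ D : ℝ, 1 ≤ D ∧
      ∀ i ≤ r, ‖iteratedFDerivWithin ℝ i f (P ∩ f ⁻¹' O) z‖ ≤ D := by
    refine ⟨1 + ∑ i ∈ Finset.range (r + 1), ‖iteratedFDerivWithin ℝ i f (P ∩ f ⁻¹' O) z‖,
      by simp [Finset.sum_nonneg], fun i hi => ?_⟩
    have := Finset.single_le_sum (f := fun i => ‖iteratedFDerivWithin ℝ i f (P ∩ f ⁻¹' O) z‖)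
      (fun _ _ => norm_nonneg _) (Finset.mem_range.2 (Nat.lt_succ_of_le hi))
    linarith
  have := norm_iteratedFDerivWithin_comp_le (n := r) (N := r) hgO (hfP.mono inter_subset_left)
    le_rfl hO.uniqueDiffOn hU.uniqueDiffOn (fun y hy => hy.2) ⟨hzP, hz⟩ (C := 0) (D := D)
    (fun i hi => by
      rw [iteratedFDerivWithin_of_isOpen _ hO hz, h i (hi.trans hr)]; simp)
    (fun i h1 hi => (hD i hi).trans (le_self_pow₀ hD1 (by omega)))
  rw [iteratedFDerivWithin_of_isOpen r hU ⟨hzP, hz⟩] at this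
  exact norm_le_zero_iff.1 (by simpa using this)

/-- Taking `j` derivatives lowers the order of vanishing by `j`. -/
theorem Flat.iteratedFDeriv {k j m : ℕ} {g : E → F} {z : E} (h : Flat m g z) (hm : k + j ≤ m) :
    Flat k (iteratedFDeriv ℝ j g) z := by
  intro r hr
  have key : ∀ r j : ℕ, ‖_root_.iteratedFDeriv ℝ r (_root_.iteratedFDeriv ℝ j g) z‖
      = ‖_root_.iteratedFDeriv ℝ (r + j) g z‖ := by
    intro r
    induction r with
    | zero => intro j; rw [Nat.zero_add, norm_iteratedFDeriv_zero]
    | succ r ih =>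
      intro j
      rw [← norm_iteratedFDeriv_fderiv, fderiv_iteratedFDeriv]
      rw [LinearIsometryEquiv.norm_iteratedFDeriv_comp_left, ih]
      rw [show r + (j + 1) = r + 1 + j by omega]
  exact norm_eq_zero.1 (by rw [key, h _ (by omega), norm_zero])

end Flat

section Sections

variable (E : Type u) [NormedAddCommGroup E] [NormedSpace ℝ E]
  {M : Type u} [TopologicalSpace M] [ChartedSpace E M]
  (F : Type u) [NormedAddCommGroup F] [NormedSpace ℝ F]
  (V : M → Type u) [TopologicalSpace (TotalSpace F V)]
  [∀ x, AddCommGroup (V x)] [∀ x, Module ℝ (V x)] [∀ x, TopologicalSpace (V x)]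
  [FiberBundle F V]

/-- The section `s` written in the preferred chart and the preferred trivialization at `x₀`. -/
noncomputable def coordRep (s : (x : M) → V x) (x₀ : M) (z : E) : F :=
  (trivializationAt F V x₀ ⟨(extChartAt 𝓘(ℝ, E) x₀).symm z,
    s ((extChartAt 𝓘(ℝ, E) x₀).symm z)⟩).2

/-- The `∞`-jet of the section `s` at `x`: all the derivatives at `x` (the Taylor series) of `s`
in the preferred coordinates and the preferred trivialization at `x`. -/
noncomputable def jetAt (s : (x : M) → V x) (x : M) (r : ℕ) : E [×r]→L[ℝ] F :=
  iteratedFDeriv ℝ r (coordRep E F V s x) (extChartAt 𝓘(ℝ, E) x x)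

/-- Points at which the preferred chart and trivialization at `x₀` may be used. -/
def coordDomain (x₀ : M) : Set M :=
  (extChartAt 𝓘(ℝ, E) x₀).source ∩ (trivializationAt F V x₀).baseSet

theorem isOpen_coordDomain (x₀ : M) : IsOpen (coordDomain E F V x₀) :=
  (isOpen_extChartAt_source x₀).inter (trivializationAt F V x₀).open_baseSet

theorem mem_coordDomain (x₀ : M) : x₀ ∈ coordDomain E F V x₀ :=
  ⟨mem_extChartAt_source x₀, mem_baseSet_trivializationAt F V x₀⟩

variable [VectorBundle ℝ F V]

/-- The space of smooth sections over the open set `U` of the vector bundle `V`; a section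
over `U` is stored as its extension by zero to `M`. -/
def SmoothSections (U : Opens M) : Submodule ℝ ((x : M) → V x) where
  carrier := {s | ContMDiffOn 𝓘(ℝ, E) (𝓘(ℝ, E).prod 𝓘(ℝ, F)) ∞
    (fun x => TotalSpace.mk' F x (s x)) U ∧ ∀ x ∉ U, s x = 0}
  add_mem' hs ht := ⟨hs.1.add_section ht.1, fun x hx => by
    rw [Pi.add_apply, hs.2 x hx, ht.2 x hx, add_zero]⟩
  zero_mem' := ⟨contMDiffOn_zeroSection ℝ V, fun _ _ => rfl⟩
  smul_mem' c s hs := ⟨hs.1.const_smul_section, fun x hx => by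
    rw [Pi.smul_apply, hs.2 x hx, smul_zero]⟩

open Classical in
/-- Restriction of sections from `U` to a smaller open set `W`. -/
noncomputable def res {U W : Opens M} (h : W ≤ U) :
    SmoothSections E F V U →ₗ[ℝ] SmoothSections E F V W where
  toFun s := ⟨fun x => if x ∈ W then s.1 x else 0, by
    refine ⟨(s.2.1.mono h).congr fun x hx => ?_, fun x hx => if_neg hx⟩
    simp only [if_pos (show x ∈ W from hx)]⟩
  map_add' s t := by
    ext x
    by_cases hx : x ∈ W <;> simp [hx]
  map_smul' c s := by
    ext x
    by_cases hx : x ∈ W <;> simp [hx]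

variable {E F V}

theorem res_apply {U W : Opens M} (h : W ≤ U) (s : SmoothSections E F V U) {x : M} (hx : x ∈ W) :
    (res E F V h s).1 x = s.1 x := if_pos hx

theorem contMDiffAt_sec {U : Opens M} (s : SmoothSections E F V U) {x : M}
    (hx : x ∈ U) : ContMDiffAt 𝓘(ℝ, E) (𝓘(ℝ, E).prod 𝓘(ℝ, F)) ∞
      (fun x => TotalSpace.mk' F x (s.1 x)) x :=
  s.2.1.contMDiffAt (U.isOpen.mem_nhds hx)

theorem tendsto_chart_symm {x₀ y : M} (hy : y ∈ (extChartAt 𝓘(ℝ, E) x₀).source) :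
    Tendsto (extChartAt 𝓘(ℝ, E) x₀).symm (𝓝 (extChartAt 𝓘(ℝ, E) x₀ y)) (𝓝 y) := by
  have := continuousAt_extChartAt_symm' (I := 𝓘(ℝ, E)) hy
  rwa [ContinuousAt, (extChartAt 𝓘(ℝ, E) x₀).left_inv hy] at this

theorem eventually_target {x₀ y : M} (hy : y ∈ (extChartAt 𝓘(ℝ, E) x₀).source) :
    ∀ᶠ z in 𝓝 (extChartAt 𝓘(ℝ, E) x₀ y), z ∈ (extChartAt 𝓘(ℝ, E) x₀).target :=
  extChartAt_target_mem_nhds' (by exact (extChartAt 𝓘(ℝ, E) x₀).map_source hy)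

/-- Sections that agree near `y` have the same coordinate expressions near `y`. -/
theorem coordRep_congr {s t : (x : M) → V x} {x₀ y : M} (h : ∀ᶠ x in 𝓝 y, s x = t x)
    (hy : y ∈ (extChartAt 𝓘(ℝ, E) x₀).source) :
    coordRep E F V s x₀ =ᶠ[𝓝 (extChartAt 𝓘(ℝ, E) x₀ y)] coordRep E F V t x₀ := by
  filter_upwards [(tendsto_chart_symm hy).eventually h] with z hz
  simp only [coordRep, hz]

theorem jetAt_congr {s t : (x : M) → V x} {x : M} (h : ∀ᶠ y in 𝓝 x, s y = t y) (r : ℕ) :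
    jetAt E F V s x r = jetAt E F V t x r :=
  ((coordRep_congr h (mem_extChartAt_source x)).iteratedFDeriv ℝ r).eq_of_nhds

theorem jetAt_res {U W : Opens M} (h : W ≤ U) (s : SmoothSections E F V U) {x : M} (hx : x ∈ W)
    (r : ℕ) : jetAt E F V (res E F V h s).1 x r = jetAt E F V s.1 x r :=
  jetAt_congr (by filter_upwards [W.isOpen.mem_nhds hx] with y hy using res_apply h s hy) r

variable [IsManifold 𝓘(ℝ, E) ∞ M] [ContMDiffVectorBundle ∞ F V 𝓘(ℝ, E)]

theorem contDiffAt_transition {x₁ x₂ y : M} (h1 : y ∈ (extChartAt 𝓘(ℝ, E) x₁).source)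
    (h2 : y ∈ (extChartAt 𝓘(ℝ, E) x₂).source) :
    ContDiffAt ℝ ∞ (extChartAt 𝓘(ℝ, E) x₁ ∘ (extChartAt 𝓘(ℝ, E) x₂).symm)
      (extChartAt 𝓘(ℝ, E) x₂ y) := by
  have := contDiffWithinAt_ext_coord_change (I := 𝓘(ℝ, E)) (n := ∞) x₁ x₂
    (y := extChartAt 𝓘(ℝ, E) x₂ y) (by
      rw [PartialEquiv.trans_source]
      refine ⟨(extChartAt 𝓘(ℝ, E) x₂).map_source h2, ?_⟩
      rw [mem_preimage, PartialEquiv.left_inv _ h2]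
      exact h1)
  simpa [contDiffWithinAt_univ] using this

theorem contDiffAt_of_contMDiffAt {G : Type*} [NormedAddCommGroup G] [NormedSpace ℝ G]
    {f : M → G} {x₀ y : M} (hy : y ∈ (extChartAt 𝓘(ℝ, E) x₀).source)
    (hf : ContMDiffAt 𝓘(ℝ, E) 𝓘(ℝ, G) ∞ f y) :
    ContDiffAt ℝ ∞ (fun z => f ((extChartAt 𝓘(ℝ, E) x₀).symm z)) (extChartAt 𝓘(ℝ, E) x₀ y) := by
  rw [contMDiffAt_iff_source_of_mem_source (x := x₀) (by simpa using hy)] at hf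
  rw [← contMDiffAt_iff_contDiffAt]
  simpa [Function.comp_def, contMDiffWithinAt_univ] using hf

theorem contDiffAt_coordRep {s : (x : M) → V x} {x₀ y : M} (hy : y ∈ coordDomain E F V x₀)
    (hs : ContMDiffAt 𝓘(ℝ, E) (𝓘(ℝ, E).prod 𝓘(ℝ, F)) ∞ (fun x => TotalSpace.mk' F x (s x)) y) :
    ContDiffAt ℝ ∞ (coordRep E F V s x₀) (extChartAt 𝓘(ℝ, E) x₀ y) :=
  contDiffAt_of_contMDiffAt hy.1
    (((trivializationAt F V x₀).contMDiffAt_section_iff hy.2).1 hs)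

/-- The order of vanishing does not depend on the coordinates. -/
theorem Flat.change {s : (x : M) → V x} {x₁ x₂ y : M} (h1 : y ∈ coordDomain E F V x₁)
    (h2 : y ∈ coordDomain E F V x₂) {k : ℕ}
    (hs : ContMDiffAt 𝓘(ℝ, E) (𝓘(ℝ, E).prod 𝓘(ℝ, F)) ∞ (fun x => TotalSpace.mk' F x (s x)) y)
    (h : Flat k (coordRep E F V s x₁) (extChartAt 𝓘(ℝ, E) x₁ y)) :
    Flat k (coordRep E F V s x₂) (extChartAt 𝓘(ℝ, E) x₂ y) := by
  set φ₁ := extChartAt 𝓘(ℝ, E) x₁ with hφ₁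
  set φ₂ := extChartAt 𝓘(ℝ, E) x₂ with hφ₂
  have hσ := contDiffAt_transition (E := E) h1.1 h2.1
  have hy : (φ₁ ∘ φ₂.symm) (φ₂ y) = φ₁ y := by
    simp only [Function.comp_apply, φ₂.left_inv h2.1]
  have hrep := contDiffAt_coordRep (F := F) h1 hs
  have hA := contDiffAt_of_contMDiffAt (x₀ := x₂) h2.1
    (contMDiffAt_coordChangeL (IB := 𝓘(ℝ, E)) (n := ∞) (e := trivializationAt F V x₁)
      (e' := trivializationAt F V x₂) h1.2 h2.2)
  have key : Flat k (fun z => ((trivializationAt F V x₁).coordChangeL ℝ (trivializationAt F V x₂)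
      (φ₂.symm z) : F →L[ℝ] F) ((coordRep E F V s x₁ ∘ (φ₁ ∘ φ₂.symm)) z)) (φ₂ y) := by
    refine Flat.clm_apply (Flat.comp ?_ ?_ hσ) hA (ContDiffAt.comp _ ?_ hσ)
    · rw [hy]; exact h
    · rw [hy]; exact hrep
    · rw [hy]; exact hrep
  refine key.congr ?_
  filter_upwards [(tendsto_chart_symm h2.1).eventually ((isOpen_coordDomain E F V x₁).mem_nhds h1),
    (tendsto_chart_symm h2.1).eventually ((isOpen_coordDomain E F V x₂).mem_nhds h2)] with z hz1 hz2
  simp only [coordRep, Function.comp_apply]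
  rw [φ₁.left_inv hz1.1]
  rw [ContinuousLinearEquiv.coe_coe, Trivialization.coordChangeL_apply' _ _ ⟨hz1.2, hz2.2⟩]
  congr 2
  set p : TotalSpace F V := ⟨φ₂.symm z, s (φ₂.symm z)⟩
  have hp : p ∈ (trivializationAt F V x₁).source :=
    (trivializationAt F V x₁).mem_source.2 hz1.2
  have h3 : ((φ₂.symm z), ((trivializationAt F V x₁) p).2) = (trivializationAt F V x₁) p :=
    Prod.ext ((trivializationAt F V x₁).coe_fst hp).symm rfl
  rw [h3]
  exact ((trivializationAt F V x₁).symm_apply_apply hp).symm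

theorem coordRep_add {s t : (x : M) → V x} {x₀ y : M} (hy : y ∈ coordDomain E F V x₀) :
    coordRep E F V (s + t) x₀ =ᶠ[𝓝 (extChartAt 𝓘(ℝ, E) x₀ y)]
      coordRep E F V s x₀ + coordRep E F V t x₀ := by
  filter_upwards [(tendsto_chart_symm hy.1).eventually
    ((isOpen_coordDomain E F V x₀).mem_nhds hy)] with z hz
  exact ((trivializationAt F V x₀).linear ℝ hz.2).map_add _ _

theorem coordRep_smul (c : ℝ) {s : (x : M) → V x} {x₀ y : M} (hy : y ∈ coordDomain E F V x₀) :
    coordRep E F V (c • s) x₀ =ᶠ[𝓝 (extChartAt 𝓘(ℝ, E) x₀ y)] c • coordRep E F V s x₀ := by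
  filter_upwards [(tendsto_chart_symm hy.1).eventually
    ((isOpen_coordDomain E F V x₀).mem_nhds hy)] with z hz
  exact ((trivializationAt F V x₀).linear ℝ hz.2).map_smul _ _

end Sections

section Forms

variable (E : Type u) [NormedAddCommGroup E] [NormedSpace ℝ E]
  (M : Type u) [TopologicalSpace M] [ChartedSpace E M]

/-- Differential `p`-forms on `M`, with no regularity required. The tangent space at `x` is
identified with `E` by the preferred chart at `x`. -/
abbrev Form (p : ℕ) : Type u := M → E [⋀^Fin p]→L[ℝ] ℝ

variable {E M} [IsManifold 𝓘(ℝ, E) ∞ M]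

/-- The form `α` written in the preferred chart at `x₀`, that is, its pullback under the inverse
of that chart. As the tangent space at `y` is identified with `E` by the preferred chart at `y`,
the derivative of the inverse of the chart is a tangent coordinate change. -/
noncomputable def formRep {p : ℕ} (α : Form E M p) (x₀ : M) (z : E) : E [⋀^Fin p]→L[ℝ] ℝ :=
  (α ((extChartAt 𝓘(ℝ, E) x₀).symm z)).compContinuousLinearMap
    (tangentCoordChange 𝓘(ℝ, E) x₀ ((extChartAt 𝓘(ℝ, E) x₀).symm z)
      ((extChartAt 𝓘(ℝ, E) x₀).symm z))

/-- The form `α` is smooth on the open set `W`. -/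
def IsSmoothForm {p : ℕ} (α : Form E M p) (W : Opens M) : Prop :=
  ∀ x ∈ W, ContDiffAt ℝ ∞ (formRep α x) (extChartAt 𝓘(ℝ, E) x x)

/-- The exterior derivative of a form, computed at each point in the preferred chart there. -/
noncomputable def extD {p : ℕ} (α : Form E M p) : Form E M (p + 1) := fun x =>
  extDeriv (formRep α x) (extChartAt 𝓘(ℝ, E) x x)

theorem two_le_infty : (2 : ℕ∞ω) ≤ ∞ := ENat.LEInfty.out

theorem formRep_change {p : ℕ} (α : Form E M p) {x₁ x₂ y : M}
    (h1 : y ∈ (extChartAt 𝓘(ℝ, E) x₁).source) (h2 : y ∈ (extChartAt 𝓘(ℝ, E) x₂).source) :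
    formRep α x₂ =ᶠ[𝓝 (extChartAt 𝓘(ℝ, E) x₂ y)] fun z =>
      (formRep α x₁ ((extChartAt 𝓘(ℝ, E) x₁ ∘ (extChartAt 𝓘(ℝ, E) x₂).symm) z)).compContinuousLinearMap
        (fderiv ℝ (extChartAt 𝓘(ℝ, E) x₁ ∘ (extChartAt 𝓘(ℝ, E) x₂).symm) z) := by
  filter_upwards [(tendsto_chart_symm h2).eventually ((isOpen_extChartAt_source x₁).mem_nhds h1),
    eventually_target h2] with z hz ht
  have hz2 : (extChartAt 𝓘(ℝ, E) x₂).symm z ∈ (extChartAt 𝓘(ℝ, E) x₂).source :=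
    (extChartAt 𝓘(ℝ, E) x₂).map_target ht
  have e1 : (extChartAt 𝓘(ℝ, E) x₁).symm
      ((extChartAt 𝓘(ℝ, E) x₁ ∘ (extChartAt 𝓘(ℝ, E) x₂).symm) z)
      = (extChartAt 𝓘(ℝ, E) x₂).symm z := (extChartAt 𝓘(ℝ, E) x₁).left_inv hz
  have e2 : fderiv ℝ (extChartAt 𝓘(ℝ, E) x₁ ∘ (extChartAt 𝓘(ℝ, E) x₂).symm) z
      = tangentCoordChange 𝓘(ℝ, E) x₂ x₁ ((extChartAt 𝓘(ℝ, E) x₂).symm z) := by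
    rw [tangentCoordChange_def, (extChartAt 𝓘(ℝ, E) x₂).right_inv ht]
    simp [fderivWithin_univ]
  simp only [formRep]
  rw [e1, e2]
  ext v
  simp only [ContinuousAlternatingMap.compContinuousLinearMap_apply]
  refine congrArg _ (funext fun i => ?_)
  exact (tangentCoordChange_comp ⟨⟨hz2, hz⟩, mem_extChartAt_source _⟩).symm

/-- The exterior derivative may be computed in any preferred chart. -/
theorem formRep_extD {p : ℕ} {α : Form E M p} {W : Opens M} (hα : IsSmoothForm α W)
    {x₀ y : M} (hy : y ∈ W) (h : y ∈ (extChartAt 𝓘(ℝ, E) x₀).source) :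
    formRep (extD α) x₀ =ᶠ[𝓝 (extChartAt 𝓘(ℝ, E) x₀ y)] extDeriv (formRep α x₀) := by
  filter_upwards [(tendsto_chart_symm h).eventually (W.isOpen.mem_nhds hy),
    eventually_target h] with z hz ht
  set y' := (extChartAt 𝓘(ℝ, E) x₀).symm z with hy'
  have hs : y' ∈ (extChartAt 𝓘(ℝ, E) x₀).source := (extChartAt 𝓘(ℝ, E) x₀).map_target ht
  have hzy : extChartAt 𝓘(ℝ, E) x₀ y' = z := (extChartAt 𝓘(ℝ, E) x₀).right_inv ht
  have hσ := contDiffAt_transition (E := E) (mem_extChartAt_source y') hs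
  have hch := formRep_change α (mem_extChartAt_source y') hs
  rw [hzy] at hσ hch
  have hv : (extChartAt 𝓘(ℝ, E) y' ∘ (extChartAt 𝓘(ℝ, E) x₀).symm) z
    = extChartAt 𝓘(ℝ, E) y' y' := rfl
  rw [hch.extDeriv_eq, extDeriv_pullback (r := ∞) _ hσ (by simpa using two_le_infty)]
  · rw [hv]
    have e2 : fderiv ℝ (extChartAt 𝓘(ℝ, E) y' ∘ (extChartAt 𝓘(ℝ, E) x₀).symm) z
        = tangentCoordChange 𝓘(ℝ, E) x₀ y' y' := by
      rw [tangentCoordChange_def, hzy]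
      simp [fderivWithin_univ]
    rw [e2]
    rfl
  · rw [hv]
    exact (hα y' hz).differentiableAt (by simp)

theorem IsSmoothForm.extD {p : ℕ} {α : Form E M p} {W : Opens M} (hα : IsSmoothForm α W) :
    IsSmoothForm (extD α) W := by
  intro x hx
  refine ContDiffAt.congr_of_eventuallyEq ?_ (formRep_extD hα hx (mem_extChartAt_source x))
  exact (ContinuousAlternatingMap.alternatizeUncurryFinCLM ℝ E ℝ).contDiff.contDiffAt.comp _
    ((hα x hx).fderiv_right (m := ∞) le_rfl)

theorem extD_extD {p : ℕ} {α : Form E M p} {W : Opens M} (hα : IsSmoothForm α W) {x : M}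
    (hx : x ∈ W) : JetComplex.extD (JetComplex.extD α) x = 0 := by
  rw [JetComplex.extD, (formRep_extD hα hx (mem_extChartAt_source x)).extDeriv_eq]
  exact extDeriv_extDeriv_apply (r := ∞) (hα x hx) (by simpa using two_le_infty)

theorem IsSmoothForm.mono {p : ℕ} {α : Form E M p} {W W' : Opens M} (hα : IsSmoothForm α W)
    (h : W' ≤ W) : IsSmoothForm α W' := fun x hx => hα x (h hx)

variable (E M) in
/-- The constant function `1` as a form of degree `0`. -/
noncomputable def oneForm : Form E M 0 := fun _ =>
  ContinuousAlternatingMap.constOfIsEmpty ℝ E (Fin 0) 1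

theorem isSmoothForm_oneForm (W : Opens M) : IsSmoothForm (oneForm E M) W := fun _ _ =>
  (contDiffAt_const (c := ContinuousAlternatingMap.constOfIsEmpty ℝ E (Fin 0) (1 : ℝ)))

theorem extD_oneForm : extD (oneForm E M) = 0 := by
  funext x
  have : formRep (oneForm E M) x =
    fun _ => ContinuousAlternatingMap.constOfIsEmpty ℝ E (Fin 0) (1 : ℝ) := rfl
  rw [extD, this, extDeriv, fderiv_fun_const]
  exact (ContinuousAlternatingMap.alternatizeUncurryFinCLM ℝ E ℝ).map_zero

end Forms

section Jets

variable (E : Type u) [NormedAddCommGroup E] [NormedSpace ℝ E]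
  {M : Type u} [TopologicalSpace M] [ChartedSpace E M] [IsManifold 𝓘(ℝ, E) ∞ M]
  (F : Type u) [NormedAddCommGroup F] [NormedSpace ℝ F]
  (V : M → Type u) [TopologicalSpace (TotalSpace F V)]
  [∀ x, AddCommGroup (V x)] [∀ x, Module ℝ (V x)] [∀ x, TopologicalSpace (V x)]
  [FiberBundle F V] [VectorBundle ℝ F V] [ContMDiffVectorBundle ∞ F V 𝓘(ℝ, E)]

variable (M) in
/-- Families, indexed by the points `x` of `M`, of alternating `p`-forms on the tangent space at
`x` with values in formal Taylor series at `x`; the index `r` is the order of the Taylor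
coefficient. -/
abbrev JetField (p : ℕ) : Type u := M → (r : ℕ) → E [⋀^Fin p]→L[ℝ] (E [×r]→L[ℝ] F)

variable {E F}

/-- An expression over the open set `W`, valid up to order `k`, of a family `η` as a finite sum
`∑ i, α i ⊗ j(s i)` of smooth forms tensored with jets of smooth sections. -/
structure LocalExpr {p : ℕ} (η : JetField E M F p) (k : ℕ) (W : Opens M) where
  ι : Type
  fin : Fintype ι
  form : ι → Form E M p
  sec : ι → SmoothSections E F V W
  smooth : ∀ i, IsSmoothForm (form i) W
  eq : ∀ x ∈ W, ∀ r ≤ k, η x r = ∑ i, (form i x).smulRight (jetAt E F V (sec i).1 x r)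

attribute [instance] LocalExpr.fin

variable (E F)

theorem jetAt_add {W : Opens M} (s t : SmoothSections E F V W) {x : M} (hx : x ∈ W) (r : ℕ) :
    jetAt E F V (s + t).1 x r = jetAt E F V s.1 x r + jetAt E F V t.1 x r := by
  have h := mem_coordDomain E F V x
  unfold jetAt
  rw [Submodule.coe_add, ((coordRep_add h).iteratedFDeriv ℝ r).eq_of_nhds]
  exact iteratedFDeriv_add_apply ((contDiffAt_coordRep h (contMDiffAt_sec s hx)).of_le (by exact_mod_cast le_top))
    ((contDiffAt_coordRep h (contMDiffAt_sec t hx)).of_le (by exact_mod_cast le_top))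

theorem jetAt_smul {W : Opens M} (c : ℝ) (s : SmoothSections E F V W) {x : M} (hx : x ∈ W)
    (r : ℕ) : jetAt E F V (c • s).1 x r = c • jetAt E F V s.1 x r := by
  have h := mem_coordDomain E F V x
  unfold jetAt
  rw [Submodule.coe_smul, ((coordRep_smul c h).iteratedFDeriv ℝ r).eq_of_nhds]
  exact iteratedFDeriv_const_smul_apply
    ((contDiffAt_coordRep h (contMDiffAt_sec s hx)).of_le (by exact_mod_cast le_top))

/-- Linear combinations of sections are compatible with jets. -/
theorem jetAt_sum {W : Opens M} {ι : Type} (t : Finset ι) (c : ι → ℝ)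
    (s : ι → SmoothSections E F V W) {x : M} (hx : x ∈ W) (r : ℕ) :
    jetAt E F V (∑ i ∈ t, c i • s i).1 x r = ∑ i ∈ t, c i • jetAt E F V (s i).1 x r := by
  classical
  induction t using Finset.induction_on with
  | empty =>
    have := jetAt_smul E F V 0 (0 : SmoothSections E F V W) hx r
    simpa using this
  | insert a t ha ih =>
    rw [Finset.sum_insert ha, Finset.sum_insert ha, jetAt_add E F V _ _ hx, ih,
      jetAt_smul E F V _ _ hx]

variable {E F V}

namespace LocalExpr

variable {p k k' : ℕ} {η η' : JetField E M F p} {W W' : Opens M}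

noncomputable def mono (e : LocalExpr V η k W) (hk : k' ≤ k) (h : W' ≤ W) :
    LocalExpr V η k' W' where
  ι := e.ι
  fin := e.fin
  form := e.form
  sec i := res E F V h (e.sec i)
  smooth i := (e.smooth i).mono h
  eq x hx r hr := by
    rw [e.eq x (h hx) r (hr.trans hk)]
    exact Finset.sum_congr rfl fun i _ => by rw [jetAt_res h _ hx]

def add (e : LocalExpr V η k W) (e' : LocalExpr V η' k W) : LocalExpr V (η + η') k W where
  ι := e.ι ⊕ e'.ι
  fin := inferInstance
  form := Sum.elim e.form e'.form
  sec := Sum.elim e.sec e'.sec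
  smooth := by rintro (i | i); exacts [e.smooth i, e'.smooth i]
  eq x hx r hr := by
    rw [Fintype.sum_sum_type, Pi.add_apply, Pi.add_apply, e.eq x hx r hr, e'.eq x hx r hr]
    rfl

def smul (c : ℝ) (e : LocalExpr V η k W) : LocalExpr V (c • η) k W where
  ι := e.ι
  fin := e.fin
  form := e.form
  sec i := c • e.sec i
  smooth := e.smooth
  eq x hx r hr := by
    rw [Pi.smul_apply, Pi.smul_apply, e.eq x hx r hr, Finset.smul_sum]
    refine Finset.sum_congr rfl fun i _ => ?_
    rw [jetAt_smul E F V c _ hx]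
    ext v w
    simp [smul_smul, mul_comm]

def zero (k : ℕ) (W : Opens M) : LocalExpr V (0 : JetField E M F p) k W where
  ι := Empty
  fin := inferInstance
  form := Empty.elim
  sec := Empty.elim
  smooth i := i.elim
  eq x _ r _ := by simp

/-- The value at `x` of `∑ i, d(α i) ⊗ j(s i)`. -/
noncomputable def dval (e : LocalExpr V η k W) (x : M) (r : ℕ) :
    E [⋀^Fin (p + 1)]→L[ℝ] (E [×r]→L[ℝ] F) :=
  ∑ i, (extD (e.form i) x).smulRight (jetAt E F V (e.sec i).1 x r)

theorem dval_mono (e : LocalExpr V η k W) (hk : k' ≤ k) (h : W' ≤ W) {x : M} (hx : x ∈ W')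
    (r : ℕ) : (e.mono hk h).dval x r = e.dval x r :=
  Finset.sum_congr rfl fun i _ => by
    change (extD (e.form i) x).smulRight (jetAt E F V (res E F V h (e.sec i)).1 x r) = _
    rw [jetAt_res h _ hx]

theorem dval_add (e : LocalExpr V η k W) (e' : LocalExpr V η' k W) (x : M) (r : ℕ) :
    (e.add e').dval x r = e.dval x r + e'.dval x r :=
  Fintype.sum_sum_type _

theorem dval_smul (c : ℝ) (e : LocalExpr V η k W) {x : M} (hx : x ∈ W) (r : ℕ) :
    (e.smul c).dval x r = c • e.dval x r := by
  unfold dval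
  rw [Finset.smul_sum]
  refine Finset.sum_congr rfl fun i _ => ?_
  change (extD (e.form i) x).smulRight (jetAt E F V (c • e.sec i).1 x r) = _
  rw [jetAt_smul E F V c _ hx]
  ext v w
  simp [smul_smul, mul_comm]

/-- An expression of zero up to order `k + 1` differentiates to an expression of zero up to
order `k`. -/
theorem dval_eq_zero (e : LocalExpr V (0 : JetField E M F p) k W) {x : M} (hx : x ∈ W) {r : ℕ}
    (hr : r + 1 ≤ k) : e.dval x r = 0 := by
  set φ := extChartAt 𝓘(ℝ, E) x with hφ
  set z₀ := φ x with hz₀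
  have hx0 := mem_coordDomain E F V x
  -- in the coordinates at `x`, the expression vanishes near `x`
  have key : ∀ u : Fin p → E, ∀ᶠ z in 𝓝 z₀, ∀ q ≤ k,
      ∑ i, formRep (e.form i) x z u • iteratedFDeriv ℝ q (coordRep E F V (e.sec i).1 x) z = 0 := by
    intro u
    filter_upwards [(tendsto_chart_symm hx0.1).eventually (W.isOpen.mem_nhds hx),
      (tendsto_chart_symm hx0.1).eventually ((isOpen_coordDomain E F V x).mem_nhds hx0),
      eventually_target hx0.1] with z hzW hzd hzt q hq
    set y := φ.symm z with hy
    have hzy : φ y = z := φ.right_inv hzt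
    set c : e.ι → ℝ := fun i => formRep (e.form i) x z u with hc
    set S : SmoothSections E F V W := ∑ i, c i • e.sec i with hS
    have hSs := contMDiffAt_sec S hzW
    have hflat : Flat k (coordRep E F V S.1 y) (extChartAt 𝓘(ℝ, E) y y) := by
      intro q hq
      have h1 := e.eq y hzW q hq
      have h2 := DFunLike.congr_fun h1 fun j => tangentCoordChange 𝓘(ℝ, E) x y y (u j)
      rw [← jetAt, hS, jetAt_sum E F V _ _ _ hzW]
      rw [ContinuousAlternatingMap.sum_apply] at h2
      exact h2.symm
    have h3 := Flat.change (mem_coordDomain E F V y) hzd hSs hflat q hq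
    rw [← hφ, hzy] at h3
    have h4 : ∀ (t : Finset e.ι), iteratedFDeriv ℝ q (coordRep E F V (∑ i ∈ t, c i • e.sec i).1 x) z
        = ∑ i ∈ t, c i • iteratedFDeriv ℝ q (coordRep E F V (e.sec i).1 x) z := by
      classical
      have hcd : ∀ s : SmoothSections E F V W, ContDiffAt ℝ q (coordRep E F V s.1 x) z := fun s => by
        have := contDiffAt_coordRep hzd (contMDiffAt_sec s hzW)
        rw [← hφ, hzy] at this
        exact this.of_le (by exact_mod_cast le_top)
      have hsm : ∀ (c : ℝ) (s : SmoothSections E F V W),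
          iteratedFDeriv ℝ q (coordRep E F V (c • s).1 x) z
            = c • iteratedFDeriv ℝ q (coordRep E F V s.1 x) z := fun c s => by
        have := ((coordRep_smul c (s := s.1) hzd).iteratedFDeriv ℝ q)
        rw [← hφ, hzy] at this
        rw [Submodule.coe_smul, this.eq_of_nhds]
        exact iteratedFDeriv_const_smul_apply (hcd s)
      intro t
      induction t using Finset.induction_on with
      | empty => simpa using hsm 0 0
      | insert a t ha ih =>
        have := ((coordRep_add (s := (c a • e.sec a).1) (t := (∑ i ∈ t, c i • e.sec i).1)
          hzd).iteratedFDeriv ℝ q)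
        rw [← hφ, hzy] at this
        rw [Finset.sum_insert ha, Finset.sum_insert ha, Submodule.coe_add, this.eq_of_nhds,
          iteratedFDeriv_add_apply (hcd _) (hcd _), ih, hsm]
    rw [← h4, ← hS]
    exact h3
  have hα : ∀ i, DifferentiableAt ℝ (formRep (e.form i) x) z₀ := fun i =>
    (e.smooth i x hx).differentiableAt (by simp)
  have hσ : ∀ i, DifferentiableAt ℝ (iteratedFDeriv ℝ r (coordRep E F V (e.sec i).1 x)) z₀ :=
    fun i => ((contDiffAt_coordRep hx0 (contMDiffAt_sec (e.sec i) hx)).iteratedFDeriv_right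
      (m := 1) (i := r) (by exact_mod_cast le_top)).differentiableAt (by simp)
  have hαu : ∀ i (u : Fin p → E), DifferentiableAt ℝ (fun z => formRep (e.form i) x z u) z₀ :=
    fun i u => (hα i).continuousAlternatingMap_apply_const u
  have step : ∀ (u : Fin p → E) (w : E), ∑ i,
      (fderiv ℝ (fun z => formRep (e.form i) x z u) z₀ w) •
        iteratedFDeriv ℝ r (coordRep E F V (e.sec i).1 x) z₀ = 0 := by
    intro u w
    have h0 : (fun z => ∑ i, formRep (e.form i) x z u •
        iteratedFDeriv ℝ r (coordRep E F V (e.sec i).1 x) z) =ᶠ[𝓝 z₀] fun _ => 0 :=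
      (key u).mono fun z hz => hz r (by omega)
    have h1 := (hasFDerivAt_const (𝕜 := ℝ) (0 : E [×r]→L[ℝ] F) z₀).congr_of_eventuallyEq h0
    have h1' := HasFDerivAt.fun_sum (u := Finset.univ) fun i _ =>
      (hαu i u).hasFDerivAt.smul (hσ i).hasFDerivAt
    have h2 := DFunLike.congr_fun (h1'.unique h1) w
    rw [_root_.sum_apply] at h2
    simp only [_root_.add_apply, _root_.smul_apply,
      ContinuousLinearMap.smulRight_apply, Finset.sum_add_distrib] at h2
    have h3 : ∑ i, formRep (e.form i) x z₀ u •
        (fderiv ℝ (iteratedFDeriv ℝ r (coordRep E F V (e.sec i).1 x)) z₀ w) = 0 := by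
      have h4 := ((key u).self_of_nhds) (r + 1) hr
      ext m
      have h5 := DFunLike.congr_fun h4 (Fin.cons w m)
      simpa [_root_.sum_apply, iteratedFDeriv_succ_apply_left] using h5
    rw [h3] at h2
    simpa using h2
  ext1 v
  unfold dval
  rw [ContinuousAlternatingMap.sum_apply]
  change ∑ i, extDeriv (formRep (e.form i) x) z₀ v •
    iteratedFDeriv ℝ r (coordRep E F V (e.sec i).1 x) z₀ = 0
  simp only [extDeriv_apply (hα _), Finset.sum_smul]
  rw [Finset.sum_comm]
  refine Finset.sum_eq_zero fun j _ => ?_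
  have := step (j.removeNth v) (v j)
  simp only [smul_assoc]
  rw [← Finset.smul_sum, this, smul_zero]

end LocalExpr

variable (E F V)

/-- The space `Ω^p(U; J(V))` of smooth `p`-forms over `U` with values in the bundle of `∞`-jets of
sections of `V`: to each finite order such a form is locally a finite sum of smooth forms tensored
with jets of smooth sections. Again it is stored as its extension by zero. -/
def JetForms (p : ℕ) (U : Opens M) : Submodule ℝ (JetField E M F p) where
  carrier := {η | (∀ x ∈ U, ∀ k : ℕ, ∃ W ≤ U, x ∈ W ∧ Nonempty (LocalExpr V η k W)) ∧
    ∀ x ∉ U, η x = 0}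
  add_mem' {η η'} h h' := by
    refine ⟨fun x hx k => ?_, fun x hx => by rw [Pi.add_apply, h.2 x hx, h'.2 x hx, add_zero]⟩
    obtain ⟨W, hW, hxW, ⟨e⟩⟩ := h.1 x hx k
    obtain ⟨W', hW', hxW', ⟨e'⟩⟩ := h'.1 x hx k
    exact ⟨W ⊓ W', inf_le_left.trans hW, ⟨hxW, hxW'⟩,
      ⟨(e.mono le_rfl inf_le_left).add (e'.mono le_rfl inf_le_right)⟩⟩
  zero_mem' := ⟨fun x hx k => ⟨U, le_rfl, hx, ⟨LocalExpr.zero k U⟩⟩, fun _ _ => rfl⟩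
  smul_mem' c η h := by
    refine ⟨fun x hx k => ?_, fun x hx => by
      rw [Pi.smul_apply, h.2 x hx]; exact funext fun r => smul_zero (A := E [⋀^Fin p]→L[ℝ] (E [×r]→L[ℝ] F)) c⟩
    obtain ⟨W, hW, hxW, ⟨e⟩⟩ := h.1 x hx k
    exact ⟨W, hW, hxW, ⟨e.smul c⟩⟩

variable {E F V} {p : ℕ} {U : Opens M}

theorem LocalExpr.dval_unique {η : JetField E M F p} {k k' : ℕ} {W W' : Opens M}
    (e : LocalExpr V η k W) (e' : LocalExpr V η k' W') {x : M} (hx : x ∈ W) (hx' : x ∈ W') {r : ℕ}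
    (hr : r + 1 ≤ k) (hr' : r + 1 ≤ k') : e.dval x r = e'.dval x r := by
  have h0 : η + (-1 : ℝ) • η = 0 := by
    funext x r
    change η x r + (-1 : ℝ) • η x r = 0
    ext v w
    simp
  have hx2 : x ∈ W ⊓ W' := ⟨hx, hx'⟩
  have key : ∀ {ζ : JetField E M F p} (e : LocalExpr V ζ (r + 1) (W ⊓ W')), ζ = 0 →
      e.dval x r = 0 := by
    rintro _ e rfl
    exact e.dval_eq_zero hx2 le_rfl
  have key2 := key ((e.mono hr inf_le_left).add ((e'.mono hr' inf_le_right).smul (-1))) h0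
  rw [LocalExpr.dval_add, LocalExpr.dval_smul _ _ hx2, LocalExpr.dval_mono _ _ _ hx2,
    LocalExpr.dval_mono _ _ _ hx2] at key2
  ext v w
  have := DFunLike.congr_fun (DFunLike.congr_fun key2 v) w
  simpa [add_neg_eq_zero] using this

open Classical in
/-- The value at `x` of the covariant derivative of a form with values in jets: if
`η = ∑ i, α i ⊗ j(s i)` near `x` up to order `r + 1`, then `∇η = ∑ i, d(α i) ⊗ j(s i)` at `x` up to
order `r`. -/
noncomputable def nablaVal (η : JetForms E F V p U) : JetField E M F (p + 1) := fun x r =>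
  if hx : x ∈ U then (η.2.1 x hx (r + 1)).choose_spec.2.2.some.dval x r else 0

theorem nablaVal_eq (η : JetForms E F V p U) {W : Opens M} (hW : W ≤ U) {k : ℕ}
    (e : LocalExpr V η.1 k W) {x : M} (hx : x ∈ W) {r : ℕ} (hr : r + 1 ≤ k) :
    nablaVal η x r = e.dval x r := by
  rw [nablaVal, dif_pos (hW hx)]
  exact LocalExpr.dval_unique _ e (η.2.1 x (hW hx) (r + 1)).choose_spec.2.1 hx le_rfl hr

/-- The expression of the covariant derivative of a form with values in jets. -/
noncomputable def LocalExpr.nabla {η : JetForms E F V p U} {k : ℕ} {W : Opens M} (hW : W ≤ U)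
    (e : LocalExpr V η.1 (k + 1) W) : LocalExpr V (nablaVal η) k W where
  ι := e.ι
  fin := e.fin
  form i := extD (e.form i)
  sec := e.sec
  smooth i := (e.smooth i).extD
  eq x hx r hr := nablaVal_eq η hW e hx (by omega)

theorem nablaVal_mem (η : JetForms E F V p U) : nablaVal η ∈ JetForms E F V (p + 1) U := by
  refine ⟨fun x hx k => ?_, fun x hx => funext fun r => by rw [nablaVal, dif_neg hx]; rfl⟩
  obtain ⟨W, hW, hxW, ⟨e⟩⟩ := η.2.1 x hx (k + 1)
  exact ⟨W, hW, hxW, ⟨e.nabla hW⟩⟩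

variable (E F V p U) in
/-- The de Rham differential `Ω^p(U; J(V)) → Ω^(p+1)(U; J(V))` of the canonical flat connection on
jets, for which the jets of sections are horizontal: `∇(α ⊗ j(s)) = dα ⊗ j(s)`. -/
noncomputable def nabla : JetForms E F V p U →ₗ[ℝ] JetForms E F V (p + 1) U where
  toFun η := ⟨nablaVal η, nablaVal_mem η⟩
  map_add' η η' := by
    ext1
    funext x r
    by_cases hx : x ∈ U
    · obtain ⟨W, hW, hxW, ⟨e⟩⟩ := η.2.1 x hx (r + 1)
      obtain ⟨W', hW', hxW', ⟨e'⟩⟩ := η'.2.1 x hx (r + 1)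
      have hx' : x ∈ W ⊓ W' := ⟨hxW, hxW'⟩
      have := nablaVal_eq (η + η') (inf_le_left.trans hW)
        ((e.mono le_rfl (inf_le_left : W ⊓ W' ≤ W)).add
          (e'.mono le_rfl (inf_le_right : W ⊓ W' ≤ W'))) hx' le_rfl
      rw [LocalExpr.dval_add, LocalExpr.dval_mono _ _ _ hx', LocalExpr.dval_mono _ _ _ hx',
        ← nablaVal_eq η hW e hxW le_rfl, ← nablaVal_eq η' hW' e' hxW' le_rfl] at this
      exact this
    · simp [nablaVal, hx]
  map_smul' c η := by
    ext1
    funext x r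
    by_cases hx : x ∈ U
    · obtain ⟨W, hW, hxW, ⟨e⟩⟩ := η.2.1 x hx (r + 1)
      have := nablaVal_eq (c • η) hW (e.smul c) hxW le_rfl
      rw [LocalExpr.dval_smul _ _ hxW, ← nablaVal_eq η hW e hxW le_rfl] at this
      exact this
    · change nablaVal (c • η) x r = c • nablaVal η x r
      rw [nablaVal, nablaVal, dif_neg hx, dif_neg hx]
      ext v w
      simp

theorem nabla_nabla (η : JetForms E F V p U) : nabla E F V (p + 1) U (nabla E F V p U η) = 0 := by
  ext1
  funext x r
  by_cases hx : x ∈ U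
  · obtain ⟨W, hW, hxW, ⟨e⟩⟩ := η.2.1 x hx (r + 1 + 1)
    have := nablaVal_eq (nabla E F V p U η) hW (e.nabla hW) hxW le_rfl
    refine this.trans (Finset.sum_eq_zero fun i _ => ?_)
    change (extD (extD (e.form i)) x).smulRight _ = _
    rw [extD_extD (e.smooth i) hxW]
    ext; simp
  · exact dif_neg hx

open Classical in
/-- The value of the jet of a section, as a form of degree `0`. -/
noncomputable def jetVal (s : SmoothSections E F V U) : JetField E M F 0 := fun x r =>
  if x ∈ U then (oneForm E M x).smulRight (jetAt E F V s.1 x r) else 0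

noncomputable def jetExpr (s : SmoothSections E F V U) (k : ℕ) : LocalExpr V (jetVal s) k U where
  ι := Unit
  fin := inferInstance
  form _ := oneForm E M
  sec _ := s
  smooth _ := isSmoothForm_oneForm U
  eq x hx r _ := by simp [jetVal, hx]

variable (E F V U) in
/-- The map `ℰ(U) → Ω^0(U; J(V))` sending a section to its `∞`-jet at every point. -/
noncomputable def jet : SmoothSections E F V U →ₗ[ℝ] JetForms E F V 0 U where
  toFun s := ⟨jetVal s, fun x hx k => ⟨U, le_rfl, hx, ⟨jetExpr s k⟩⟩,
    fun x hx => funext fun r => if_neg hx⟩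
  map_add' s t := by
    ext1
    funext x r
    by_cases hx : x ∈ U
    · change jetVal (s + t) x r = jetVal s x r + jetVal t x r
      rw [jetVal, jetVal, jetVal, if_pos hx, if_pos hx, if_pos hx, jetAt_add E F V s t hx]
      ext v
      simp [smul_add]
    · simp [jetVal, hx]
  map_smul' c s := by
    ext1
    funext x r
    change jetVal (c • s) x r = c • jetVal s x r
    by_cases hx : x ∈ U
    · rw [jetVal, jetVal, if_pos hx, if_pos hx, jetAt_smul E F V c s hx]
      ext v
      simp [smul_smul, mul_comm]
    · rw [jetVal, jetVal, if_neg hx, if_neg hx]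
      ext v w
      simp

theorem nabla_jet (s : SmoothSections E F V U) : nabla E F V 0 U (jet E F V U s) = 0 := by
  ext1
  funext x r
  by_cases hx : x ∈ U
  · have := nablaVal_eq (jet E F V U s) le_rfl (jetExpr s (r + 1)) hx le_rfl
    refine this.trans (Finset.sum_eq_zero fun i _ => ?_)
    change (extD (oneForm E M) x).smulRight _ = _
    rw [extD_oneForm]
    ext; simp
  · exact dif_neg hx

end Jets

section DiffOps

theorem Flat.sum {E F : Type*} [NormedAddCommGroup E] [NormedSpace ℝ E] [NormedAddCommGroup F]
    [NormedSpace ℝ F] {ι : Type*} {k : ℕ} {z : E} (t : Finset ι) (g : ι → E → F)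
    (hg : ∀ i, ContDiffAt ℝ ∞ (g i) z) (h : ∀ i, Flat k (g i) z) :
    Flat k (fun y => ∑ i ∈ t, g i y) z := by
  classical
  induction t using Finset.induction_on with
  | empty =>
    intro r _
    simp only [Finset.sum_empty]
    exact congrFun iteratedFDeriv_fun_zero z
  | insert a t ha ih =>
    intro r hr
    simp only [Finset.sum_insert ha]
    rw [show (fun y => g a y + ∑ i ∈ t, g i y) = g a + fun y => ∑ i ∈ t, g i y from rfl,
      iteratedFDeriv_add_apply ((hg a).of_le (by exact_mod_cast le_top))
        ((ContDiffAt.sum fun i _ => hg i).of_le (by exact_mod_cast le_top)), h a r hr, ih r hr,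
      add_zero]

variable (E : Type u) [NormedAddCommGroup E] [NormedSpace ℝ E]
  {M : Type u} [TopologicalSpace M] [ChartedSpace E M] [IsManifold 𝓘(ℝ, E) ∞ M]
  (F : Type u) [NormedAddCommGroup F] [NormedSpace ℝ F]
  (V : M → Type u) [TopologicalSpace (TotalSpace F V)]
  [∀ x, AddCommGroup (V x)] [∀ x, Module ℝ (V x)] [∀ x, TopologicalSpace (V x)]
  [FiberBundle F V] [VectorBundle ℝ F V] [ContMDiffVectorBundle ∞ F V 𝓘(ℝ, E)]
  (F' : Type u) [NormedAddCommGroup F'] [NormedSpace ℝ F']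
  (V' : M → Type u) [TopologicalSpace (TotalSpace F' V')]
  [∀ x, AddCommGroup (V' x)] [∀ x, Module ℝ (V' x)] [∀ x, TopologicalSpace (V' x)]
  [FiberBundle F' V'] [VectorBundle ℝ F' V'] [ContMDiffVectorBundle ∞ F' V' 𝓘(ℝ, E)]

/-- Differential operators from the sections of `V` to the sections of `V'`: maps of sheaves that
near every point `x₀` are given, in coordinates, by a finite sum `∑ j ≤ m, a j (D^j s)` with smooth
coefficients `a j`. -/
structure DiffOp where
  app (U : Opens M) : SmoothSections E F V U →ₗ[ℝ] SmoothSections E F' V' U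
  naturality {U W : Opens M} (h : W ≤ U) (s : SmoothSections E F V U) :
    app W (res E F V h s) = res E F' V' h (app U s)
  local_formula (x₀ : M) : ∃ (W : Opens M) (m : ℕ) (a : (j : ℕ) → E → (E [×j]→L[ℝ] F) →L[ℝ] F'),
    x₀ ∈ W ∧ (∀ j, ∀ x ∈ W, ContDiffAt ℝ ∞ (a j) (extChartAt 𝓘(ℝ, E) x₀ x)) ∧
    ∀ (U : Opens M) (s : SmoothSections E F V U), ∀ x ∈ W, x ∈ U →
      coordRep E F' V' (app U s).1 x₀ (extChartAt 𝓘(ℝ, E) x₀ x) =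
        ∑ j ∈ Finset.range (m + 1), a j (extChartAt 𝓘(ℝ, E) x₀ x)
          (iteratedFDeriv ℝ j (coordRep E F V s.1 x₀) (extChartAt 𝓘(ℝ, E) x₀ x))

variable {F' V' E F V}

/-- Near `x` the operator `A` has order at most `m`: the `k`-jet of `A s` at `x` vanishes as soon as
the `(k + m)`-jet of `s` at `x` vanishes. -/
def DiffOp.IsOrderAt (A : DiffOp E F V F' V') (m : ℕ) (x : M) : Prop :=
  ∀ (W : Opens M) (s : SmoothSections E F V W) (k : ℕ), x ∈ W →
    (∀ r ≤ k + m, jetAt E F V s.1 x r = 0) → ∀ r ≤ k, jetAt E F' V' (A.app W s).1 x r = 0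

theorem DiffOp.exists_order (A : DiffOp E F V F' V') (x₀ : M) :
    ∃ (W : Opens M) (m : ℕ), x₀ ∈ W ∧ ∀ x ∈ W, A.IsOrderAt m x := by
  obtain ⟨W, m, a, hxW, ha, hA⟩ := A.local_formula x₀
  refine ⟨W ⊓ ⟨_, isOpen_coordDomain E F V x₀⟩ ⊓ ⟨_, isOpen_coordDomain E F' V' x₀⟩, m,
    ⟨⟨hxW, mem_coordDomain E F V x₀⟩, mem_coordDomain E F' V' x₀⟩, ?_⟩
  rintro x ⟨⟨hxW, hx⟩, hx'⟩ U s k hxU hs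
  have h1 : Flat (k + m) (coordRep E F V s.1 x₀) (extChartAt 𝓘(ℝ, E) x₀ x) :=
    Flat.change (mem_coordDomain E F V x) hx (contMDiffAt_sec s hxU) hs
  have hsm := contDiffAt_coordRep hx (contMDiffAt_sec s hxU)
  have hsj : ∀ j : ℕ, ContDiffAt ℝ ∞ (iteratedFDeriv ℝ j (coordRep E F V s.1 x₀))
      (extChartAt 𝓘(ℝ, E) x₀ x) := fun j => hsm.iteratedFDeriv_right (m := ∞) (by exact_mod_cast le_top)
  have h2 : Flat k (coordRep E F' V' (A.app U s).1 x₀) (extChartAt 𝓘(ℝ, E) x₀ x) := by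
    refine (Flat.sum (Finset.range (m + 1)) (fun j z => a (min j m) z
      (iteratedFDeriv ℝ (min j m) (coordRep E F V s.1 x₀) z))
      (fun j => (ha _ x hxW).clm_apply (hsj _))
      (fun j => (h1.iteratedFDeriv (by omega)).clm_apply (ha _ x hxW) (hsj _))).congr ?_
    filter_upwards [(tendsto_chart_symm hx.1).eventually (W.isOpen.mem_nhds hxW),
      (tendsto_chart_symm hx.1).eventually (U.isOpen.mem_nhds hxU),
      eventually_target hx.1] with z hz1 hz2 hz3
    have := hA U s _ hz1 hz2
    rw [(extChartAt 𝓘(ℝ, E) x₀).right_inv hz3] at this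
    rw [this]
    refine Finset.sum_congr rfl fun j hj => ?_
    rw [min_eq_left (by have := Finset.mem_range.1 hj; omega)]
  exact Flat.change hx' (mem_coordDomain E F' V' x) (contMDiffAt_sec _ hxU) h2

theorem DiffOp.exists_order_at (A : DiffOp E F V F' V') (x : M) : ∃ m, A.IsOrderAt m x := by
  obtain ⟨W, m, hx, h⟩ := A.exists_order x
  exact ⟨m, h x hx⟩

variable {p k k' : ℕ} {η η' : JetField E M F p} {W W' : Opens M}

namespace LocalExpr

/-- The value at `x` of `∑ i, α i ⊗ j(A (s i))`. -/
noncomputable def opval (A : DiffOp E F V F' V') (e : LocalExpr V η k W) (x : M) (r : ℕ) :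
    E [⋀^Fin p]→L[ℝ] (E [×r]→L[ℝ] F') :=
  ∑ i, (e.form i x).smulRight (jetAt E F' V' (A.app W (e.sec i)).1 x r)

variable (A : DiffOp E F V F' V')

theorem opval_mono (e : LocalExpr V η k W) (hk : k' ≤ k) (h : W' ≤ W) {x : M} (hx : x ∈ W')
    (r : ℕ) : (e.mono hk h).opval A x r = e.opval A x r :=
  Finset.sum_congr rfl fun i _ => by
    change (e.form i x).smulRight (jetAt E F' V' (A.app W' (res E F V h (e.sec i))).1 x r) = _
    rw [A.naturality, jetAt_res h _ hx]

theorem opval_add (e : LocalExpr V η k W) (e' : LocalExpr V η' k W) (x : M) (r : ℕ) :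
    (e.add e').opval A x r = e.opval A x r + e'.opval A x r :=
  Fintype.sum_sum_type _

theorem opval_smul (c : ℝ) (e : LocalExpr V η k W) {x : M} (hx : x ∈ W) (r : ℕ) :
    (e.smul c).opval A x r = c • e.opval A x r := by
  unfold opval
  rw [Finset.smul_sum]
  refine Finset.sum_congr rfl fun i _ => ?_
  change (e.form i x).smulRight (jetAt E F' V' (A.app W (c • e.sec i)).1 x r) = _
  rw [map_smul, jetAt_smul E F' V' c _ hx]
  ext v w
  simp [smul_smul, mul_comm]

theorem opval_eq_zero (e : LocalExpr V (0 : JetField E M F p) k W) {x : M} (hx : x ∈ W) {m r : ℕ}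
    (hA : A.IsOrderAt m x) (hr : r + m ≤ k) : e.opval A x r = 0 := by
  ext1 v
  unfold opval
  rw [ContinuousAlternatingMap.sum_apply]
  change ∑ i, e.form i x v • jetAt E F' V' (A.app W (e.sec i)).1 x r = 0
  rw [← jetAt_sum E F' V' Finset.univ (fun i => e.form i x v) _ hx]
  have : ∑ i, e.form i x v • A.app W (e.sec i) = A.app W (∑ i, e.form i x v • e.sec i) := by
    rw [map_sum]
    exact Finset.sum_congr rfl fun i _ => (map_smul _ _ _).symm
  rw [this]
  refine hA W _ r hx (fun q hq => ?_) r le_rfl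
  rw [jetAt_sum E F V _ _ _ hx]
  have := DFunLike.congr_fun (e.eq x hx q (hq.trans hr)) v
  rw [ContinuousAlternatingMap.sum_apply] at this
  exact this.symm

theorem opval_unique (e : LocalExpr V η k W) (e' : LocalExpr V η k' W') {x : M} (hx : x ∈ W)
    (hx' : x ∈ W') {m m' r : ℕ} (hm : A.IsOrderAt m x) (hm' : A.IsOrderAt m' x) (hr : r + m ≤ k)
    (hr' : r + m' ≤ k') : e.opval A x r = e'.opval A x r := by
  have hmin : A.IsOrderAt (min m m') x := by
    rcases min_choice m m' with h | h <;> rw [h] <;> assumption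
  have h0 : η + (-1 : ℝ) • η = 0 := by
    funext x r
    change η x r + (-1 : ℝ) • η x r = 0
    ext v w
    simp
  have hx2 : x ∈ W ⊓ W' := ⟨hx, hx'⟩
  have key : ∀ {ζ : JetField E M F p} (e : LocalExpr V ζ (r + min m m') (W ⊓ W')), ζ = 0 →
      e.opval A x r = 0 := by
    rintro _ e rfl
    exact e.opval_eq_zero A hx2 hmin le_rfl
  have key2 := key ((e.mono (by omega) inf_le_left).add
    ((e'.mono (by omega) inf_le_right).smul (-1))) h0
  rw [LocalExpr.opval_add, LocalExpr.opval_smul _ _ _ hx2, LocalExpr.opval_mono _ _ _ _ hx2,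
    LocalExpr.opval_mono _ _ _ _ hx2] at key2
  ext v w
  have := DFunLike.congr_fun (DFunLike.congr_fun key2 v) w
  simpa [add_neg_eq_zero] using this

end LocalExpr

variable {U : Opens M} (A : DiffOp E F V F' V')

open Classical in
/-- The value at `x` of the operator induced by `A` on a form with values in jets: if
`η = ∑ i, α i ⊗ j(s i)` near `x` up to order `r + m`, where `m` is an order of `A`, then the value
is that of `∑ i, α i ⊗ j(A (s i))`. -/
noncomputable def jetOpVal (η : JetForms E F V p U) : JetField E M F' p := fun x r =>
  if hx : x ∈ U then
    (η.2.1 x hx (r + (A.exists_order_at x).choose)).choose_spec.2.2.some.opval A x r else 0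

theorem jetOpVal_eq (η : JetForms E F V p U) (hW : W ≤ U) (e : LocalExpr V η.1 k W) {x : M}
    (hx : x ∈ W) {m r : ℕ} (hA : A.IsOrderAt m x) (hr : r + m ≤ k) :
    jetOpVal A η x r = e.opval A x r := by
  rw [jetOpVal, dif_pos (hW hx)]
  exact LocalExpr.opval_unique A _ e
    (η.2.1 x (hW hx) (r + (A.exists_order_at x).choose)).choose_spec.2.1 hx
    (A.exists_order_at x).choose_spec hA le_rfl hr

noncomputable def LocalExpr.op {η : JetForms E F V p U} (hW : W ≤ U) {m : ℕ}
    (hA : ∀ x ∈ W, A.IsOrderAt m x) (e : LocalExpr V η.1 (k + m) W) :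
    LocalExpr V' (jetOpVal A η) k W where
  ι := e.ι
  fin := e.fin
  form := e.form
  sec i := A.app W (e.sec i)
  smooth := e.smooth
  eq x hx r hr := jetOpVal_eq A η hW e hx (hA x hx) (by omega)

/-- Every form has local expressions on open sets on which `A` has a uniform order. -/
theorem exists_localExpr_op (η : JetForms E F V p U) {x : M} (hx : x ∈ U) (k : ℕ) :
    ∃ W ≤ U, ∃ m, x ∈ W ∧ (∀ y ∈ W, A.IsOrderAt m y) ∧ Nonempty (LocalExpr V η.1 (k + m) W) := by
  obtain ⟨W₀, m, hx₀, hm⟩ := A.exists_order x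
  obtain ⟨W, hW, hxW, ⟨e⟩⟩ := η.2.1 x hx (k + m)
  exact ⟨W ⊓ W₀, inf_le_left.trans hW, m, ⟨hxW, hx₀⟩, fun y hy => hm y hy.2,
    ⟨e.mono le_rfl inf_le_left⟩⟩

theorem jetOpVal_mem (η : JetForms E F V p U) : jetOpVal A η ∈ JetForms E F' V' p U := by
  refine ⟨fun x hx k => ?_, fun x hx => funext fun r => by rw [jetOpVal, dif_neg hx]; rfl⟩
  obtain ⟨W, hW, m, hxW, hm, ⟨e⟩⟩ := exists_localExpr_op A η hx k
  exact ⟨W, hW, hxW, ⟨e.op A hW hm⟩⟩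

variable (p U) in
/-- The map `Ω^p(U; J(V)) → Ω^p(U; J(V'))` induced by a differential operator `A`:
`α ⊗ j(s) ↦ α ⊗ j(A s)`. -/
noncomputable def jetOp : JetForms E F V p U →ₗ[ℝ] JetForms E F' V' p U where
  toFun η := ⟨jetOpVal A η, jetOpVal_mem A η⟩
  map_add' η η' := by
    ext1
    funext x r
    change jetOpVal A (η + η') x r = jetOpVal A η x r + jetOpVal A η' x r
    by_cases hx : x ∈ U
    · obtain ⟨m, hm⟩ := A.exists_order_at x
      obtain ⟨W, hW, hxW, ⟨e⟩⟩ := η.2.1 x hx (r + m)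
      obtain ⟨W', hW', hxW', ⟨e'⟩⟩ := η'.2.1 x hx (r + m)
      have hx' : x ∈ W ⊓ W' := ⟨hxW, hxW'⟩
      rw [jetOpVal_eq A (η + η') (inf_le_left.trans hW)
        ((e.mono le_rfl (inf_le_left : W ⊓ W' ≤ W)).add
          (e'.mono le_rfl (inf_le_right : W ⊓ W' ≤ W'))) hx' hm le_rfl,
        LocalExpr.opval_add, LocalExpr.opval_mono _ _ _ _ hx', LocalExpr.opval_mono _ _ _ _ hx',
        ← jetOpVal_eq A η hW e hxW hm le_rfl, ← jetOpVal_eq A η' hW' e' hxW' hm le_rfl]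
    · simp [jetOpVal, hx]
  map_smul' c η := by
    ext1
    funext x r
    change jetOpVal A (c • η) x r = c • jetOpVal A η x r
    by_cases hx : x ∈ U
    · obtain ⟨m, hm⟩ := A.exists_order_at x
      obtain ⟨W, hW, hxW, ⟨e⟩⟩ := η.2.1 x hx (r + m)
      rw [jetOpVal_eq A (c • η) hW (e.smul c) hxW hm le_rfl,
        LocalExpr.opval_smul _ _ _ hxW, ← jetOpVal_eq A η hW e hxW hm le_rfl]
    · rw [jetOpVal, jetOpVal, dif_neg hx, dif_neg hx]
      ext v w
      simp

theorem nabla_jetOp (η : JetForms E F V p U) :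
    nabla E F' V' p U (jetOp p U A η) = jetOp (p + 1) U A (nabla E F V p U η) := by
  ext1
  funext x r
  by_cases hx : x ∈ U
  · obtain ⟨W, hW, m, hxW, hm, ⟨e⟩⟩ := exists_localExpr_op A η hx (r + 1)
    have h1 := nablaVal_eq (jetOp p U A η) hW (e.op A hW hm) hxW le_rfl
    have h2 := jetOpVal_eq A (nabla E F V p U η) hW (LocalExpr.nabla (k := r + m) hW
      (e.mono (by omega) le_rfl)) hxW (hm x hxW) (r := r) le_rfl
    refine h1.trans (Eq.trans ?_ h2.symm)
    refine Finset.sum_congr rfl fun i _ => ?_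
    change (extD (e.form i) x).smulRight (jetAt E F' V' (A.app W (e.sec i)).1 x r) =
      (extD (e.form i) x).smulRight (jetAt E F' V' (A.app W (res E F V le_rfl (e.sec i))).1 x r)
    rw [A.naturality, jetAt_res _ _ hxW]
  · have h1 : nablaVal (jetOp p U A η) x r = 0 := dif_neg hx
    have h2 : jetOpVal A (nabla E F V p U η) x r = 0 := dif_neg hx
    exact h1.trans h2.symm

theorem jetOp_jet (s : SmoothSections E F V U) :
    jetOp 0 U A (jet E F V U s) = jet E F' V' U (A.app U s) := by
  ext1
  funext x r
  by_cases hx : x ∈ U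
  · obtain ⟨m, hm⟩ := A.exists_order_at x
    refine (jetOpVal_eq A (jet E F V U s) le_rfl (jetExpr s (r + m)) hx hm le_rfl).trans ?_
    refine Eq.trans ?_ (if_pos hx).symm
    change ∑ i : Unit, _ = _
    rw [Fintype.sum_unique]
    rfl
  · exact (dif_neg hx).trans (if_neg hx).symm

variable {F'' : Type u} [NormedAddCommGroup F''] [NormedSpace ℝ F'']
  {V'' : M → Type u} [TopologicalSpace (TotalSpace F'' V'')]
  [∀ x, AddCommGroup (V'' x)] [∀ x, Module ℝ (V'' x)] [∀ x, TopologicalSpace (V'' x)]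
  [FiberBundle F'' V''] [VectorBundle ℝ F'' V''] [ContMDiffVectorBundle ∞ F'' V'' 𝓘(ℝ, E)]

theorem jetOp_jetOp (B : DiffOp E F' V' F'' V'')
    (hBA : ∀ (W : Opens M) (s : SmoothSections E F V W), B.app W (A.app W s) = 0)
    (η : JetForms E F V p U) : jetOp p U B (jetOp p U A η) = 0 := by
  ext1
  funext x r
  by_cases hx : x ∈ U
  · obtain ⟨m', hm'⟩ := B.exists_order_at x
    obtain ⟨W, hW, m, hxW, hm, ⟨e⟩⟩ := exists_localExpr_op A η hx (r + m')
    refine (jetOpVal_eq B (jetOp p U A η) hW (e.op A hW hm) hxW hm' le_rfl).trans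
      (Finset.sum_eq_zero fun i _ => ?_)
    change (e.form i x).smulRight (jetAt E F'' V'' (B.app W (A.app W (e.sec i))).1 x r) = 0
    have h0 := jetAt_smul E F'' V'' 0 (0 : SmoothSections E F'' V'' W) hxW r
    rw [zero_smul, zero_smul] at h0
    rw [hBA]
    have h1 : jetAt E F'' V'' (0 : SmoothSections E F'' V'' W).1 x r = 0 := by simpa using h0
    rw [h1]
    ext v w
    simp
  · exact dif_neg hx

end DiffOps

section Complexes

open CategoryTheory

variable (E : Type u) [NormedAddCommGroup E] [NormedSpace ℝ E]
  {M : Type u} [TopologicalSpace M] [ChartedSpace E M] [IsManifold 𝓘(ℝ, E) ∞ M]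
  (F : ℤ → Type u) [∀ i, NormedAddCommGroup (F i)] [∀ i, NormedSpace ℝ (F i)]
  (V : ℤ → M → Type u) [∀ i, TopologicalSpace (TotalSpace (F i) (V i))]
  [∀ i x, AddCommGroup (V i x)] [∀ i x, Module ℝ (V i x)] [∀ i x, TopologicalSpace (V i x)]
  [∀ i, FiberBundle (F i) (V i)] [∀ i, VectorBundle ℝ (F i) (V i)]
  [∀ i, ContMDiffVectorBundle ∞ (F i) (V i) 𝓘(ℝ, E)]

/-- A differential complex whose term of degree `i` is the sheaf of smooth sections of `V i`: the
differentials are differential operators of degree one with square zero. -/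
structure DifferentialComplex where
  d (i j : ℤ) (h : i + 1 = j) : DiffOp E (F i) (V i) (F j) (V j)
  d_comp_d (i j k : ℤ) (hij : i + 1 = j) (hjk : j + 1 = k) (U : Opens M)
    (s : SmoothSections E (F i) (V i) U) : (d j k hjk).app U ((d i j hij).app U s) = 0

variable {E F V} (C : DifferentialComplex E F V) (U : Opens M)

namespace DifferentialComplex

/-- The complex of sections over `U` of a differential complex. -/
noncomputable def sections : CochainComplex (ModuleCat.{u} ℝ) ℤ :=
  CochainComplex.of (fun n => ModuleCat.of ℝ (SmoothSections E (F n) (V n) U))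
    (fun n => ModuleCat.ofHom ((C.d n (n + 1) rfl).app U))
    (fun n => by
      ext s : 2
      exact C.d_comp_d _ _ _ _ _ U s)

variable (E F V) in
/-- The space `Ω^p(U; J(V i))`. -/
def JetTerm (p : ℕ) (i : ℤ) : Type u := JetForms E (F i) (V i) p U

noncomputable instance (p : ℕ) (i : ℤ) : AddCommGroup (JetTerm E F V U p i) :=
  inferInstanceAs (AddCommGroup (JetForms E (F i) (V i) p U))

noncomputable instance (p : ℕ) (i : ℤ) : Module ℝ (JetTerm E F V U p i) :=
  inferInstanceAs (Module ℝ (JetForms E (F i) (V i) p U))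

variable (E F V) in
/-- The differential `∇` of the canonical flat connection on the jets of `V i`. -/
noncomputable def nablaTerm (p : ℕ) (i : ℤ) :
    JetTerm E F V U p i →ₗ[ℝ] JetTerm E F V U (p + 1) i :=
  nabla E (F i) (V i) p U

/-- The map `J(d)` on forms with values in jets. -/
noncomputable def jetD (p : ℕ) (i j : ℤ) (h : i + 1 = j) :
    JetTerm E F V U p i →ₗ[ℝ] JetTerm E F V U p j :=
  jetOp p U (C.d i j h)

variable (E F V) in
/-- The map sending a section of `V i` to its `∞`-jet. -/
noncomputable def jetTerm (i : ℤ) :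
    SmoothSections E (F i) (V i) U →ₗ[ℝ] JetTerm E F V U 0 i :=
  jet E (F i) (V i) U

theorem nablaTerm_nablaTerm (p : ℕ) (i : ℤ) (η : JetTerm E F V U p i) :
    nablaTerm E F V U (p + 1) i (nablaTerm E F V U p i η) = 0 :=
  nabla_nabla (V := V i) (p := p) (U := U) η

theorem jetD_jetD (p : ℕ) (i j k : ℤ) (hij : i + 1 = j) (hjk : j + 1 = k)
    (η : JetTerm E F V U p i) : C.jetD U p j k hjk (C.jetD U p i j hij η) = 0 :=
  jetOp_jetOp (C.d i j hij) (C.d j k hjk) (fun W s => C.d_comp_d i j k hij hjk W s) η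

theorem nablaTerm_jetD (p : ℕ) (i j : ℤ) (h : i + 1 = j) (η : JetTerm E F V U p i) :
    nablaTerm E F V U p j (C.jetD U p i j h η) =
      C.jetD U (p + 1) i j h (nablaTerm E F V U p i η) :=
  nabla_jetOp (C.d i j h) η

theorem nablaTerm_jetTerm (i : ℤ) (s : SmoothSections E (F i) (V i) U) :
    nablaTerm E F V U 0 i (jetTerm E F V U i s) = 0 :=
  nabla_jet s

theorem jetD_jetTerm (i j : ℤ) (h : i + 1 = j) (s : SmoothSections E (F i) (V i) U) :
    C.jetD U 0 i j h (jetTerm E F V U i s) = jetTerm E F V U j ((C.d i j h).app U s) :=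
  jetOp_jet (C.d i j h) s

variable (E F V) in
/-- The term of degree `n` of the de Rham complex: the sum of the spaces `Ω^p(U; J(V i))` over all
`p` and `i` with `p + i = n`. (Only finitely many of them are nonzero, because `p` is at most the
dimension of the manifold; so the sum is the product.) -/
def TotJetForms (n : ℤ) : Type u :=
  ∀ q : {q : ℕ × ℤ // (q.1 : ℤ) + q.2 = n}, JetTerm E F V U q.1.1 q.1.2

noncomputable instance (n : ℤ) : AddCommGroup (TotJetForms E F V U n) :=
  inferInstanceAs (AddCommGroup
    (∀ q : {q : ℕ × ℤ // (q.1 : ℤ) + q.2 = n}, JetTerm E F V U q.1.1 q.1.2))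

noncomputable instance (n : ℤ) : Module ℝ (TotJetForms E F V U n) :=
  inferInstanceAs (Module ℝ
    (∀ q : {q : ℕ × ℤ // (q.1 : ℤ) + q.2 = n}, JetTerm E F V U q.1.1 q.1.2))

variable (E F V) in
/-- The component in `Ω^p(U; J(V i))`. -/
noncomputable def comp {n : ℤ} (p : ℕ) (i : ℤ) (h : (p : ℤ) + i = n) :
    TotJetForms E F V U n →ₗ[ℝ] JetTerm E F V U p i :=
  LinearMap.proj (φ := fun q : {q : ℕ × ℤ // (q.1 : ℤ) + q.2 = n} => JetTerm E F V U q.1.1 q.1.2)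
    ⟨(p, i), h⟩

/-- The component in `Ω^p(U; J(V i))` of the differential of the de Rham complex, which is
`∇ + (-1)^q J(d)` on `Ω^q(U; J(V j))`. -/
noncomputable def totDComp (n : ℤ) : (p : ℕ) → (i : ℤ) → (p : ℤ) + i = n + 1 →
    (TotJetForms E F V U n →ₗ[ℝ] JetTerm E F V U p i)
  | 0, i, h => C.jetD U 0 (i - 1) i (by omega) ∘ₗ comp E F V U 0 (i - 1) (by omega)
  | p + 1, i, h =>
      nablaTerm E F V U p i ∘ₗ comp E F V U p i (by omega) +
      (-1 : ℝ) ^ (p + 1) • (C.jetD U (p + 1) (i - 1) i (by omega) ∘ₗ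
        comp E F V U (p + 1) (i - 1) (by omega))

/-- The differential of the de Rham complex. -/
noncomputable def totD (n : ℤ) : TotJetForms E F V U n →ₗ[ℝ] TotJetForms E F V U (n + 1) :=
  LinearMap.pi (φ := fun q : {q : ℕ × ℤ // (q.1 : ℤ) + q.2 = n + 1} =>
    JetTerm E F V U q.1.1 q.1.2) fun q => C.totDComp U n q.1.1 q.1.2 q.2

theorem totD_zero (n : ℤ) (x : TotJetForms E F V U n) (i : ℤ)
    (h : ((0 : ℕ) : ℤ) + i = n + 1) : comp E F V U 0 i h (C.totD U n x) =
      C.jetD U 0 (i - 1) i (by omega) (comp E F V U 0 (i - 1) (by omega) x) := rfl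

theorem totD_succ (n : ℤ) (x : TotJetForms E F V U n) (p : ℕ) (i : ℤ)
    (h : ((p + 1 : ℕ) : ℤ) + i = n + 1) : comp E F V U (p + 1) i h (C.totD U n x) =
      nablaTerm E F V U p i (comp E F V U p i (by omega) x) +
      (-1 : ℝ) ^ (p + 1) • C.jetD U (p + 1) (i - 1) i (by omega)
        (comp E F V U (p + 1) (i - 1) (by omega) x) := rfl

theorem tot_ext {n : ℤ} {x y : TotJetForms E F V U n}
    (h : ∀ p i h, comp E F V U p i h x = comp E F V U p i h y) : x = y :=
  funext fun q => h q.1.1 q.1.2 q.2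

theorem totD_totD (n : ℤ) (x : TotJetForms E F V U n) : C.totD U (n + 1) (C.totD U n x) = 0 := by
  refine tot_ext U fun p i h => ?_
  rw [map_zero]
  rcases p with _ | _ | p
  · rw [totD_zero, totD_zero, jetD_jetD]
  · rw [totD_succ, totD_zero, totD_succ, map_add, map_smul, jetD_jetD, nablaTerm_jetD]
    simp
  · rw [totD_succ, totD_succ, totD_succ, map_add, map_add, map_smul, map_smul, jetD_jetD, nablaTerm_jetD,
      nablaTerm_nablaTerm]
    simp [pow_succ]

/-- The de Rham complex `dR(J(ℰ, d))` over `U` of the jets of a differential complex. -/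
noncomputable def deRhamJet : CochainComplex (ModuleCat.{u} ℝ) ℤ :=
  CochainComplex.of (fun n => ModuleCat.of ℝ (TotJetForms E F V U n))
    (fun n => ModuleCat.ofHom (C.totD U n))
    (fun n => by
      ext s : 2
      exact C.totD_totD U n s)

variable (E F V) in
/-- The map sending a section of `V n` to its `∞`-jet, in the summand with `p = 0`, `i = n`. -/
noncomputable def jetTot (n : ℤ) :
    SmoothSections E (F n) (V n) U →ₗ[ℝ] TotJetForms E F V U n :=
  LinearMap.single ℝ (fun q : {q : ℕ × ℤ // (q.1 : ℤ) + q.2 = n} => JetTerm E F V U q.1.1 q.1.2)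
    ⟨(0, n), by simp⟩ ∘ₗ jetTerm E F V U n

theorem jetTot_same {n : ℤ} (h : ((0 : ℕ) : ℤ) + n = n) (s : SmoothSections E (F n) (V n) U) :
    comp E F V U 0 n h (jetTot E F V U n s) = jetTerm E F V U n s :=
  Pi.single_eq_same (M := fun q : {q : ℕ × ℤ // (q.1 : ℤ) + q.2 = n} =>
    JetTerm E F V U q.1.1 q.1.2) _ _

theorem jetTot_succ {n : ℤ} (s : SmoothSections E (F n) (V n) U) (p : ℕ) (i : ℤ)
    (h : ((p + 1 : ℕ) : ℤ) + i = n) : comp E F V U (p + 1) i h (jetTot E F V U n s) = 0 :=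
  Pi.single_eq_of_ne (M := fun q : {q : ℕ × ℤ // (q.1 : ℤ) + q.2 = n} =>
    JetTerm E F V U q.1.1 q.1.2) (i := ⟨(0, n), by simp⟩) (i' := ⟨(p + 1, i), h⟩)
    (fun e => Nat.succ_ne_zero p (congrArg (fun q => q.1.1) e)) (jetTerm E F V U n s)

theorem totD_jetTot (n : ℤ) (s : SmoothSections E (F n) (V n) U) :
    C.totD U n (jetTot E F V U n s) =
      jetTot E F V U (n + 1) ((C.d n (n + 1) rfl).app U s) := by
  refine tot_ext U fun p i h => ?_
  rcases p with _ | _ | p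
  · have key : ∀ (j i : ℤ) (hji : j + 1 = i) (hj : ((0 : ℕ) : ℤ) + j = n)
        (hi : ((0 : ℕ) : ℤ) + i = n + 1),
        C.jetD U 0 j i hji (comp E F V U 0 j hj (jetTot E F V U n s)) =
          comp E F V U 0 i hi (jetTot E F V U (n + 1) ((C.d n (n + 1) rfl).app U s)) := by
      intro j i hji hj hi
      obtain rfl : j = n := by simpa using hj
      obtain rfl : i = j + 1 := hji.symm
      rw [jetTot_same, jetTot_same, jetD_jetTerm]
    exact key _ _ _ _ _
  · have key : ∀ (i : ℤ) (hi : ((0 : ℕ) : ℤ) + i = n),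
        nablaTerm E F V U 0 i (comp E F V U 0 i hi (jetTot E F V U n s)) = 0 := by
      intro i hi
      obtain rfl : i = n := by simpa using hi
      rw [jetTot_same, nablaTerm_jetTerm]
    rw [totD_succ, jetTot_succ, jetTot_succ, key, map_zero, smul_zero, add_zero]
  · rw [totD_succ, jetTot_succ, jetTot_succ, jetTot_succ, map_zero, map_zero, smul_zero, add_zero]

/-- The map of complexes sending a section over `U` to its `∞`-jet. -/
noncomputable def jetMap : C.sections U ⟶ C.deRhamJet U :=
  CochainComplex.ofHom (fun n => ModuleCat.ofHom (jetTot E F V U n))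
    (fun n => by
      dsimp only [sections, deRhamJet]
      rw [CochainComplex.of_d, CochainComplex.of_d]
      ext s : 2
      exact C.totD_jetTot U n s)

end DifferentialComplex

end Complexes

end JetComplex

/-! For fixed `i` the augmented complex `0 → ℰ^i(U) → Ω^0(U; J(V^i)) → Ω^1(U; J(V^i)) → ⋯` with
differential `∇` is exact over every open `U`. No contractibility of `U` enters, because the
equation `∇ξ = η` is solved order by order in the Taylor series.

In a chart a form with values in jets is, to finite order, a sum `∑ a_i(z) f_i(w)`, with `z` the
base point and `w` the Taylor variable; `∇` is the exterior derivative in `z` with `w` fixed, and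
the order of vanishing is the order in `w - z`. Let `K = ∑ (w_k - z_k) ι_{∂_k}` be the Koszul
contraction. If `η` has degree `p + 1`, is closed and vanishes below order `q`, then `Kη` vanishes
below order `q + 1`, and `∇Kη = -(p + 1 + q) η` modulo terms that vanish below order `q + 1`
(`flatBelow_koszul_homotopy`): Cartan's formula gives the contribution `p + 1` of the form degree,
Euler's identity the contribution `q` of the Taylor degree. So `-(p + 1 + q)⁻¹ Kη` is a local
primitive to leading order (`exists_local_primitive`).

Local primitives glue: in `∇(fζ) = df ∧ ζ + f ∇ζ` the first term vanishes in the orders concerned,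
because `ζ` does (`exists_primitive_to_order`). Subtracting `∇` of the glued primitive raises the
order of vanishing of `η` by one. Iterating yields a series of primitives of which only finitely
many terms contribute at each order, so it has a formal sum (`exists_primitive`). In degree `0` the
coefficient of order zero of a horizontal `η` is a smooth section `s`, and `η - j(s)` vanishes by
induction on the order (`vanish_succ_of_horizontal`, `exists_section`).

The total complex is then treated by a staircase: `p` is bounded by the dimension, so the components
of positive `p` can be removed from the top downwards by coboundaries (`exists_sub_concentrated`),
uniformly in `i`. What remains in `p = 0` is horizontal, hence the jet of a section, and injectivity
of the jet map transports the equations back to sections. -/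

namespace JetComplex

/-! ### Order of vanishing of Taylor series in a vector space. -/

section FlatBelow

variable {E F G : Type u} [NormedAddCommGroup E] [NormedSpace ℝ E]
  [NormedAddCommGroup F] [NormedSpace ℝ F] [NormedAddCommGroup G] [NormedSpace ℝ G]

/-- All derivatives of `g` at `z` of order less than `q` vanish. -/
def FlatBelow (q : ℕ) (g : E → F) (z : E) : Prop := ∀ r < q, iteratedFDeriv ℝ r g z = 0

/-- The strict bound makes `q = 0` the void condition, from which the inductions on `q` start; `Flat
k` has no such case. -/
theorem flatBelow_succ {k : ℕ} {g : E → F} {z : E} : FlatBelow (k + 1) g z ↔ Flat k g z :=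
  forall_congr' fun _ => by rw [Nat.lt_succ_iff]

theorem flatBelow_zero (g : E → F) (z : E) : FlatBelow 0 g z := fun r hr => by omega

/-- This is the recursion behind the inductions on `q`. It replaces the target `F` by `E →L[ℝ] F`,
which is why those inductions quantify over the target space. -/
theorem flatBelow_succ_iff {q : ℕ} {g : E → F} {z : E} :
    FlatBelow (q + 1) g z ↔ g z = 0 ∧ FlatBelow q (fderiv ℝ g) z := by
  constructor
  · intro h
    refine ⟨?_, fun r hr => ?_⟩
    · have := h 0 (by omega)
      rwa [← norm_eq_zero, norm_iteratedFDeriv_zero, norm_eq_zero] at this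
    · rw [← norm_eq_zero, norm_iteratedFDeriv_fderiv, h _ (by omega), norm_zero]
  · rintro ⟨h0, h⟩ r hr
    rcases r with _ | r
    · rw [← norm_eq_zero, norm_iteratedFDeriv_zero, h0, norm_zero]
    · rw [← norm_eq_zero, ← norm_iteratedFDeriv_fderiv, h _ (by omega), norm_zero]

theorem FlatBelow.congr {q : ℕ} {g g' : E → F} {z : E} (h : FlatBelow q g z)
    (e : g' =ᶠ[𝓝 z] g) : FlatBelow q g' z := fun r hr => by
  rw [(e.iteratedFDeriv ℝ r).eq_of_nhds, h r hr]

theorem FlatBelow.add {q : ℕ} {g g' : E → F} {z : E} (h : FlatBelow q g z)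
    (h' : FlatBelow q g' z) (hg : ContDiffAt ℝ ∞ g z) (hg' : ContDiffAt ℝ ∞ g' z) :
    FlatBelow q (fun w => g w + g' w) z := fun r hr => by
  rw [show (fun w => g w + g' w) = g + g' from rfl,
    iteratedFDeriv_add_apply (hg.of_le (by exact_mod_cast le_top))
      (hg'.of_le (by exact_mod_cast le_top)), h r hr, h' r hr, add_zero]

theorem FlatBelow.const_smul {q : ℕ} {g : E → F} {z : E} (h : FlatBelow q g z) (c : ℝ)
    (hg : ContDiffAt ℝ ∞ g z) : FlatBelow q (fun w => c • g w) z := fun r hr => by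
  rw [show (fun w => c • g w) = c • g from rfl,
    iteratedFDeriv_const_smul_apply (hg.of_le (by exact_mod_cast le_top)), h r hr, smul_zero]

theorem FlatBelow.clm {q : ℕ} {g : E → F} {z : E} (h : FlatBelow q g z) (L : F →L[ℝ] G)
    (hg : ContDiffAt ℝ ∞ g z) : FlatBelow q (fun w => L (g w)) z := fun r hr => by
  have := L.iteratedFDeriv_comp_left (i := r) (hg.of_le (m := r) (by exact_mod_cast le_top)) le_rfl
  rw [show (fun w => L (g w)) = L ∘ g from rfl, this, h r hr]
  ext m
  simp

theorem FlatBelow.sum {ι : Type*} {q : ℕ} {z : E} (t : Finset ι) (g : ι → E → F)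
    (hg : ∀ i, ContDiffAt ℝ ∞ (g i) z) (h : ∀ i, FlatBelow q (g i) z) :
    FlatBelow q (fun y => ∑ i ∈ t, g i y) z := by
  rcases q with _ | q
  · exact flatBelow_zero _ _
  · exact flatBelow_succ.2 (Flat.sum t g hg fun i => flatBelow_succ.1 (h i))

theorem contDiffAt_fderiv {g : E → F} {z : E} (hg : ContDiffAt ℝ ∞ g z) :
    ContDiffAt ℝ ∞ (fderiv ℝ g) z := hg.fderiv_right (m := ∞) le_rfl

theorem contDiffAt_clm_comp {g : E → F} {z : E} (L : F →L[ℝ] G) (hg : ContDiffAt ℝ ∞ g z) :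
    ContDiffAt ℝ ∞ (fun w => L (g w)) z := L.contDiff.contDiffAt.comp z hg

theorem eventually_contDiffAt {g : E → F} {z : E} (hg : ContDiffAt ℝ ∞ g z) (n : ℕ) :
    ∀ᶠ w in 𝓝 z, ContDiffAt ℝ n g w :=
  (hg.of_le (by exact_mod_cast le_top : (n : ℕ∞ω) ≤ ∞)).eventually (by simp)

set_option synthInstance.maxHeartbeats 200000 in
/-- A factor that vanishes at `z` raises the order of vanishing by one. -/
theorem FlatBelow.apply_sub {q : ℕ} : ∀ {F : Type u} [NormedAddCommGroup F] [NormedSpace ℝ F]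
    {H : E → E →L[ℝ] F} {z : E}, FlatBelow q H z → ContDiffAt ℝ ∞ H z →
    FlatBelow (q + 1) (fun w => H w (w - z)) z := by
  induction q with
  | zero =>
    intro F _ _ H z _ _
    exact flatBelow_succ_iff.2 ⟨by simp, flatBelow_zero _ _⟩
  | succ q ih =>
    intro F _ _ H z h hH
    refine flatBelow_succ_iff.2 ⟨by simp, ?_⟩
    -- The derivative of `w ↦ H w (w - z)` is `H w` plus `v ↦ DH(w) v (w - z)`. Exchanging the
    -- arguments of `DH` gives the second term the shape required by the induction hypothesis, with
    -- target `E →L[ℝ] F`.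
    obtain ⟨L, hL⟩ : ∃ L : (E →L[ℝ] E →L[ℝ] F) →L[ℝ] (E →L[ℝ] E →L[ℝ] F),
        ∀ B v w, L B v w = B w v :=
      ⟨ContinuousLinearMap.flipₗᵢ ℝ E E F, fun _ _ _ => rfl⟩
    have hfl : ContDiffAt ℝ ∞ (fun w => L (fderiv ℝ H w)) z :=
      contDiffAt_clm_comp (F := E →L[ℝ] E →L[ℝ] F) (G := E →L[ℝ] E →L[ℝ] F) L
        (contDiffAt_fderiv hH)
    have h1 : FlatBelow q (fun w => L (fderiv ℝ H w)) z :=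
      FlatBelow.clm (F := E →L[ℝ] E →L[ℝ] F) (G := E →L[ℝ] E →L[ℝ] F)
        (flatBelow_succ_iff.1 h).2 L (contDiffAt_fderiv hH)
    have h2 := ih h1 hfl
    refine (h2.add h ?_ hH).congr ?_
    · exact hfl.clm_apply (contDiffAt_id.sub contDiffAt_const)
    · filter_upwards [eventually_contDiffAt hH 1] with w hw
      have hd := (hw.differentiableAt (by simp)).hasFDerivAt.clm_apply
        ((hasFDerivAt_id w).sub_const z)
      rw [HasFDerivAt.fderiv (f := fun w => H w (w - z)) hd]
      ext v
      simp [hL, add_comm]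

/-- Euler's identity for the leading part of the Taylor series. -/
theorem FlatBelow.euler {q : ℕ} : ∀ {F : Type u} [NormedAddCommGroup F] [NormedSpace ℝ F]
    {g : E → F} {z : E}, FlatBelow q g z → ContDiffAt ℝ ∞ g z →
    FlatBelow (q + 1) (fun w => fderiv ℝ g w (w - z) - (q : ℝ) • g w) z := by
  induction q with
  | zero =>
    intro F _ _ g z _ _
    exact flatBelow_succ_iff.2 ⟨by simp, flatBelow_zero _ _⟩
  | succ q ih =>
    intro F _ _ g z h hg
    obtain ⟨h0, h1⟩ := flatBelow_succ_iff.1 h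
    refine flatBelow_succ_iff.2 ⟨by simp [h0], ?_⟩
    -- By symmetry of the second derivative, differentiating `Dg(w)(w - z) - (q + 1) g(w)` gives
    -- `D(Dg)(w)(w - z) - q Dg(w)`, the Euler expression of `Dg` at order `q`.
    refine (ih h1 (contDiffAt_fderiv hg)).congr ?_
    filter_upwards [eventually_contDiffAt hg 2] with w hw
    have hs := hw.isSymmSndFDerivAt (by simp)
    have hw' : HasFDerivAt (fderiv ℝ g) (fderiv ℝ (fderiv ℝ g) w) w :=
      ((hw.fderiv_right (m := 1) le_rfl).differentiableAt (by simp)).hasFDerivAt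
    have hd := (hw'.clm_apply ((hasFDerivAt_id w).sub_const z)).sub
      (((hw.differentiableAt (by simp)).hasFDerivAt).const_smul ((q + 1 : ℕ) : ℝ))
    rw [HasFDerivAt.fderiv (f := fun w => fderiv ℝ g w (w - z) - ((q + 1 : ℕ) : ℝ) • g w) hd]
    ext v
    simp only [Nat.cast_add, Nat.cast_one, _root_.sub_apply, _root_.add_apply,
      ContinuousLinearMap.comp_apply, ContinuousLinearMap.flip_apply, _root_.smul_apply,
      ContinuousLinearMap.id_apply, id]
    rw [hs v (w - z)]
    module

/-- Differentiating, in the variable point, a relation between Taylor series. -/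
theorem FlatBelow.deriv_point {ι : Type*} [Fintype ι] {a : ι → E → ℝ} {z : E}
    (ha : ∀ i, DifferentiableAt ℝ (a i) z) (e : E) {q : ℕ} :
    ∀ {F : Type u} [NormedAddCommGroup F] [NormedSpace ℝ F] {f : ι → E → F},
    (∀ i, ContDiffAt ℝ ∞ (f i) z) →
    (∀ᶠ y in 𝓝 z, FlatBelow q (fun w => ∑ i, a i y • f i w) y) →
    FlatBelow q (fun w => ∑ i, (fderiv ℝ (a i) z e • f i w + a i z • fderiv ℝ (f i) w e)) z := by
  induction q with
  | zero => exact fun _ _ => flatBelow_zero _ _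
  | succ q ih =>
    intro F _ _ f hf h
    refine flatBelow_succ_iff.2 ⟨?_, ?_⟩
    -- Order zero of the relation holds on the diagonal `w = y` for all `y` near `z`, so the product
    -- rule applies to it.
    · have h0 : (fun y => ∑ i, a i y • f i y) =ᶠ[𝓝 z] fun _ => 0 := by
        filter_upwards [h] with y hy using (flatBelow_succ_iff.1 hy).1
      have h1 := (hasFDerivAt_const (𝕜 := ℝ) (0 : F) z).congr_of_eventuallyEq h0
      have h1' := HasFDerivAt.fun_sum (u := Finset.univ) fun i _ =>
        (ha i).hasFDerivAt.smul ((hf i).differentiableAt (by simp)).hasFDerivAt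
      have h2 := DFunLike.congr_fun (h1'.unique h1) e
      simpa [_root_.sum_apply, add_comm] using h2
    · have hd : ∀ᶠ w in 𝓝 z, ∀ i, ContDiffAt ℝ 2 (f i) w :=
        eventually_all.2 fun i => eventually_contDiffAt (hf i) 2
      -- With the coefficients frozen at `y`, differentiation in `w` gives the same kind of relation
      -- for the derivatives of the `f i`, one order lower. Symmetry of second derivatives then
      -- interchanges the direction `e` and the new argument.
      have h' : ∀ᶠ y in 𝓝 z, FlatBelow q (fun w => ∑ i, a i y • fderiv ℝ (f i) w) y := by
        filter_upwards [h, hd.eventually_nhds] with y hy hd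
        refine (flatBelow_succ_iff.1 hy).2.congr ?_
        filter_upwards [hd] with w hw
        rw [fderiv_fun_sum fun i _ => ((hw i).differentiableAt (by simp)).fun_const_smul _]
        refine Finset.sum_congr rfl fun i _ => ?_
        rw [fderiv_fun_const_smul ((hw i).differentiableAt (by simp))]
      refine (ih (fun i => contDiffAt_fderiv (hf i)) h').congr ?_
      filter_upwards [hd] with w hw
      have hw1 : ∀ i, HasFDerivAt (f i) (fderiv ℝ (f i) w) w := fun i =>
        ((hw i).differentiableAt (by simp)).hasFDerivAt
      have hw2 : ∀ i, HasFDerivAt (fderiv ℝ (f i)) (fderiv ℝ (fderiv ℝ (f i)) w) w := fun i =>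
        (((hw i).fderiv_right (m := 1) le_rfl).differentiableAt (by simp)).hasFDerivAt
      have := HasFDerivAt.fun_sum (u := Finset.univ) fun i _ =>
        ((hw1 i).const_smul (fderiv ℝ (a i) z e)).add
          (((hw2 i).clm_apply (hasFDerivAt_const e w)).const_smul (a i z))
      refine (HasFDerivAt.fderiv this).trans (Finset.sum_congr rfl fun i _ => ?_)
      ext v
      simp only [_root_.add_apply, _root_.smul_apply, ContinuousLinearMap.comp_apply,
        ContinuousLinearMap.flip_apply, _root_.zero_apply, map_zero, zero_add]
      rw [((hw i).isSymmSndFDerivAt (by simp)) v e]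

end FlatBelow


/-! ### The Koszul contraction and its homotopy formula in a vector space. -/

section Koszul

variable {E F : Type u} [NormedAddCommGroup E] [NormedSpace ℝ E]
  [NormedAddCommGroup F] [NormedSpace ℝ F]

/-- The contraction of a form on `E` with a constant vector field. -/
noncomputable def contract {p : ℕ} (e : E) (a : E → E [⋀^Fin (p + 1)]→L[ℝ] ℝ) (y : E) :
    E [⋀^Fin p]→L[ℝ] ℝ := (a y).curryLeft e

/-- `ContinuousAlternatingMap.curryLeft` followed by evaluation, as a continuous linear map. -/
noncomputable def contractCLM {p : ℕ} (e : E) :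
    (E [⋀^Fin (p + 1)]→L[ℝ] ℝ) →L[ℝ] E [⋀^Fin p]→L[ℝ] ℝ :=
  (ContinuousLinearMap.apply ℝ (E [⋀^Fin p]→L[ℝ] ℝ) e).comp
    ContinuousAlternatingMap.curryLeftLI.toContinuousLinearMap

theorem contDiffAt_contract {p : ℕ} (e : E) {a : E → E [⋀^Fin (p + 1)]→L[ℝ] ℝ} {z : E}
    (ha : ContDiffAt ℝ ∞ a z) : ContDiffAt ℝ ∞ (contract e a) z :=
  (contractCLM e).contDiff.contDiffAt.comp z ha

/-- Cartan's formula: for a constant vector field the Lie derivative is the directional derivative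
of the coefficients. It is the first term of the sum for `extDeriv a` on `(e, u)`; the other terms
are those of `extDeriv (contract e a)` with opposite sign. -/
theorem extDeriv_contract {p : ℕ} (e : E) {a : E → E [⋀^Fin (p + 1)]→L[ℝ] ℝ} {z : E}
    (ha : ContDiffAt ℝ ∞ a z) (u : Fin (p + 1) → E) :
    extDeriv (contract e a) z u = fderiv ℝ a z e u - extDeriv a z (Matrix.vecCons e u) := by
  have hd := ha.differentiableAt (by simp)
  rw [extDeriv_apply hd, extDeriv_apply ((contDiffAt_contract e ha).differentiableAt (by simp)),
    Fin.sum_univ_succ (n := p + 1)]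
  have h0 : (fun y => a y ((0 : Fin (p + 2)).removeNth (Matrix.vecCons e u))) = fun y => a y u := by
    funext y; congr 1
  have h1 : fderiv ℝ (fun y => a y u) z e = fderiv ℝ a z e u := by
    rw [fderiv_continuousAlternatingMap_apply_const_apply hd]
  have h2 : ∀ (j : Fin (p + 1)) y, contract e a y (j.removeNth u) =
      a y (j.succ.removeNth (Matrix.vecCons e u)) := by
    intro j y
    rw [contract, ContinuousAlternatingMap.curryLeft_apply_apply]
    congr 1
    funext i
    refine Fin.cases ?_ (fun i => ?_) i <;> simp [Fin.removeNth, Matrix.vecCons]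
  have h3 : ((-1) ^ (0 : Fin (p + 2)).val : ℤ) •
      fderiv ℝ (fun y => a y ((0 : Fin (p + 2)).removeNth (Matrix.vecCons e u))) z
        (Matrix.vecCons e u 0) = fderiv ℝ a z e u := by
    rw [h0, Matrix.cons_val_zero, h1]
    simp
  rw [h3, sub_add_eq_sub_sub, sub_self, zero_sub, ← Finset.sum_neg_distrib]
  refine Finset.sum_congr rfl fun j _ => ?_
  simp only [h2, Fin.val_succ, pow_succ, mul_neg, mul_one, neg_smul, neg_neg, Matrix.cons_val_succ]

theorem extDeriv_fun_smul_form {p : ℕ} {l : E → ℝ} {β : E → E [⋀^Fin p]→L[ℝ] ℝ} {z : E}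
    (hl : DifferentiableAt ℝ l z) (hβ : DifferentiableAt ℝ β z) :
    extDeriv (fun y => l y • β y) z = l z • extDeriv β z +
      ContinuousAlternatingMap.alternatizeUncurryFin ((fderiv ℝ l z).smulRight (β z)) := by
  rw [extDeriv, fderiv_fun_smul hl hβ, ContinuousAlternatingMap.alternatizeUncurryFin_add,
    ContinuousAlternatingMap.alternatizeUncurryFin_smul]
  rfl

variable {κ : Type*} [Fintype κ] [FiniteDimensional ℝ E] (b : Module.Basis κ ℝ E)

/-- The coordinates of a basis, as continuous linear maps. -/
noncomputable def coordCLM (k : κ) : E →L[ℝ] ℝ := (b.coord k).toContinuousLinearMap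

theorem sum_coordCLM_smul (v : E) : ∑ k, coordCLM b k v • b k = v := b.sum_repr v

/-- The identity `∑ dx_k ∧ ι_k a = (deg a) a`: the sum of the `dx_k ⊗ ι_k a` is `a` with its first
argument split off, and alternating that gives `p + 1` equal terms. This is the form degree in the
constant of the homotopy formula. -/
theorem sum_alternatize_contract {p : ℕ} (a : E → E [⋀^Fin (p + 1)]→L[ℝ] ℝ) (z : E) :
    ∑ k, ContinuousAlternatingMap.alternatizeUncurryFin
      ((coordCLM b k).smulRight (contract (b k) a z)) = ((p : ℝ) + 1) • a z := by
  have h : (a z).curryLeft = ∑ k, (coordCLM b k).smulRight (contract (b k) a z) := by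
    ext1 v
    rw [_root_.sum_apply]
    conv_lhs => rw [← sum_coordCLM_smul b v, map_sum]
    simp [contract]
  have h2 := ContinuousAlternatingMap.alternatizeUncurryFin_curryLeft (a z)
  rw [h, ← ContinuousAlternatingMap.alternatizeUncurryFinCLM_apply, map_sum] at h2
  rw [show ((p : ℝ) + 1) • a z = (p + 1) • a z by
    rw [← Nat.cast_smul_eq_nsmul ℝ]; push_cast; rfl, ← h2]
  rfl

/-- The sum is the linear map `∑ x_k ⊗ S k w` applied to `w - z`, so `FlatBelow.apply_sub` gains one
order. -/
theorem FlatBelow.sum_coord_sub {q : ℕ} {z : E} {S : κ → E → F}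
    (h : ∀ k, FlatBelow q (S k) z) (hS : ∀ k, ContDiffAt ℝ ∞ (S k) z) :
    FlatBelow (q + 1) (fun w => ∑ k, coordCLM b k (w - z) • S k w) z := by
  have hL : ∀ k, ContDiffAt ℝ ∞
      (fun w => (ContinuousLinearMap.smulRightL ℝ E F (coordCLM b k)) (S k w)) z := fun k =>
    contDiffAt_clm_comp _ (hS k)
  have h1 : FlatBelow q (fun w => ∑ k, (ContinuousLinearMap.smulRightL ℝ E F (coordCLM b k))
      (S k w)) z :=
    FlatBelow.sum _ _ hL fun k => (h k).clm _ (hS k)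
  refine (h1.apply_sub (ContDiffAt.sum fun k _ => hL k)).congr (Eventually.of_forall fun w => ?_)
  simp [_root_.sum_apply]

variable {ι : Type*} [Fintype ι] {p q : ℕ} {a : ι → E → E [⋀^Fin (p + 1)]→L[ℝ] ℝ} {f : ι → E → F}
  {z : E}

theorem contDiffAt_sum_const_smul (c : ι → ℝ) (hf : ∀ i, ContDiffAt ℝ ∞ (f i) z) :
    ContDiffAt ℝ ∞ (fun w => ∑ i, c i • f i w) z :=
  ContDiffAt.sum fun i _ => (hf i).const_smul (c i)

/-- The Koszul contraction of a form with values in jets that vanish below order `q` vanishes below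
order `q + 1`. -/
theorem flatBelow_koszul (hf : ∀ i, ContDiffAt ℝ ∞ (f i) z)
    (h : ∀ u, FlatBelow q (fun w => ∑ i, a i z u • f i w) z) (u : Fin p → E) :
    FlatBelow (q + 1) (fun w => ∑ i, ∑ k, (contract (b k) (a i) z u • coordCLM b k w • f i w -
      (coordCLM b k z • contract (b k) (a i) z u) • f i w)) z := by
  refine (FlatBelow.sum_coord_sub b (S := fun k w => ∑ i, contract (b k) (a i) z u • f i w)
    (fun k => h (Matrix.vecCons (b k) u)) fun k => contDiffAt_sum_const_smul _ hf).congr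
    (Eventually.of_forall fun w => ?_)
  simp only [Finset.smul_sum]
  rw [Finset.sum_comm]
  refine Finset.sum_congr rfl fun k _ => Finset.sum_congr rfl fun i _ => ?_
  rw [map_sub, smul_eq_mul]
  module

/-- The homotopy formula for the Koszul contraction: on closed forms with values in jets that vanish
below order `q`, the covariant derivative of the contraction is `-(p + 1 + q)` at leading order. -/
theorem flatBelow_koszul_homotopy (ha : ∀ i, ContDiffAt ℝ ∞ (a i) z)
    (hf : ∀ i, ContDiffAt ℝ ∞ (f i) z)
    (h : ∀ᶠ y in 𝓝 z, ∀ u, FlatBelow q (fun w => ∑ i, a i y u • f i w) y)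
    (hd : ∀ u, FlatBelow q (fun w => ∑ i, extDeriv (a i) z u • f i w) z) (u : Fin (p + 1) → E) :
    FlatBelow (q + 1) (fun w => (∑ i, ∑ k,
      (extDeriv (contract (b k) (a i)) z u • coordCLM b k w • f i w -
        extDeriv (fun y => coordCLM b k y • contract (b k) (a i) y) z u • f i w)) +
      ((p : ℝ) + 1 + q) • ∑ i, a i z u • f i w) z := by
  set G : E → F := fun w => ∑ i, a i z u • f i w with hG
  have hGs : ContDiffAt ℝ ∞ G z := contDiffAt_sum_const_smul _ hf
  have hGq : FlatBelow q G z := h.self_of_nhds u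
  have hdiff : ∀ i, DifferentiableAt ℝ (a i) z := fun i => (ha i).differentiableAt (by simp)
  have hX : ∀ k, FlatBelow q (fun w => ∑ i, (fderiv ℝ (a i) z (b k) u • f i w +
      a i z u • fderiv ℝ (f i) w (b k))) z := by
    intro k
    have := FlatBelow.deriv_point (a := fun i y => a i y u) (z := z) (q := q) (f := f)
      (fun i => (hdiff i).continuousAlternatingMap_apply_const u) (b k) hf
      (h.mono fun y hy => hy u)
    refine this.congr (Eventually.of_forall fun w => ?_)
    refine Finset.sum_congr rfl fun i _ => ?_
    rw [fderiv_continuousAlternatingMap_apply_const_apply (hdiff i)]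
  have hXs : ∀ k, ContDiffAt ℝ ∞ (fun w => ∑ i, (fderiv ℝ (a i) z (b k) u • f i w +
      a i z u • fderiv ℝ (f i) w (b k))) z := fun k =>
    ContDiffAt.sum fun i _ => ((hf i).const_smul _).add
      (((contDiffAt_fderiv (hf i)).clm_apply contDiffAt_const).const_smul _)
  -- Modulo functions that vanish below order `q + 1`: the Lie derivative term of Cartan's formula
  -- is minus the radial derivative of `G` (`h1`), the contraction of the exterior derivative drops
  -- out (`h2`), and the radial derivative is `q • G` by Euler (`h3`). The claim is the combination
  -- `h1 - (h2 + h3)`.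
  have h1 := FlatBelow.sum_coord_sub b hX hXs
  have h2 := FlatBelow.sum_coord_sub b (S := fun k w =>
    ∑ i, extDeriv (a i) z (Matrix.vecCons (b k) u) • f i w) (fun k => hd _)
    fun k => contDiffAt_sum_const_smul _ hf
  have h3 := hGq.euler hGs
  have s0 : ∀ k, ContDiffAt ℝ ∞ (fun w => coordCLM b k (w - z)) z := fun k =>
    (coordCLM b k).contDiff.contDiffAt.comp z (contDiffAt_id.sub contDiffAt_const)
  have s1 := ContDiffAt.sum (s := Finset.univ) fun k _ => (s0 k).smul (hXs k)
  have s2 := ContDiffAt.sum (s := Finset.univ) fun k _ => (s0 k).smul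
    (contDiffAt_sum_const_smul (fun i => extDeriv (a i) z (Matrix.vecCons (b k) u)) hf)
  have s3 : ContDiffAt ℝ ∞ (fun w => fderiv ℝ G w (w - z) - (q : ℝ) • G w) z :=
    ((contDiffAt_fderiv hGs).clm_apply (contDiffAt_id.sub contDiffAt_const)).sub
      (hGs.const_smul _)
  refine (h1.add ((h2.add h3 s2 s3).const_smul (-1) (s2.add s3)) s1
    ((s2.add s3).const_smul _)).congr ?_
  have hev : ∀ᶠ w in 𝓝 z, ∀ i, ContDiffAt ℝ 1 (f i) w :=
    eventually_all.2 fun i => eventually_contDiffAt (hf i) 1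
  filter_upwards [hev] with w hw
  have hDG : fderiv ℝ G w (w - z) =
      ∑ k, coordCLM b k (w - z) • ∑ i, a i z u • fderiv ℝ (f i) w (b k) := by
    have hdw : ∀ i, DifferentiableAt ℝ (f i) w := fun i => (hw i).differentiableAt (by simp)
    have : ∀ v, fderiv ℝ G w v = ∑ i, a i z u • fderiv ℝ (f i) w v := fun v => by
      rw [hG, fderiv_fun_sum fun i _ => (hdw i).fun_const_smul _, _root_.sum_apply]
      refine Finset.sum_congr rfl fun i _ => ?_
      rw [fderiv_fun_const_smul (hdw i)]
      rfl
    conv_lhs => rw [← sum_coordCLM_smul b (w - z), map_sum]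
    refine Finset.sum_congr rfl fun k _ => ?_
    rw [map_smul, this]
  have hsum : ∑ i, ∑ k, ContinuousAlternatingMap.alternatizeUncurryFin
      ((coordCLM b k).smulRight (contract (b k) (a i) z)) u • f i w = ((p : ℝ) + 1) • G w := by
    rw [hG, Finset.smul_sum]
    refine Finset.sum_congr rfl fun i _ => ?_
    rw [← Finset.sum_smul, ← ContinuousAlternatingMap.sum_apply, sum_alternatize_contract,
      smul_smul]
    rfl
  -- The Leibniz rule produces `x_k(z) d(ι_k a)`, which joins `x_k(w) d(ι_k a)` to give the factor
  -- `x_k(w - z)`, and the term `dx_k ∧ ι_k a`; Cartan's formula then rewrites `d(ι_k a)`.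
  have hterm : ∀ i k, extDeriv (contract (b k) (a i)) z u • coordCLM b k w • f i w -
        extDeriv (fun y => coordCLM b k y • contract (b k) (a i) y) z u • f i w =
      coordCLM b k (w - z) • (fderiv ℝ (a i) z (b k) u • f i w) -
      coordCLM b k (w - z) • (extDeriv (a i) z (Matrix.vecCons (b k) u) • f i w) -
      ContinuousAlternatingMap.alternatizeUncurryFin
        ((coordCLM b k).smulRight (contract (b k) (a i) z)) u • f i w := by
    intro i k
    rw [extDeriv_fun_smul_form (coordCLM b k).differentiableAt
      ((contDiffAt_contract (b k) (ha i)).differentiableAt (by simp)),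
      ContinuousLinearMap.fderiv, ContinuousAlternatingMap.add_apply,
      ContinuousAlternatingMap.smul_apply,
      extDeriv_contract _ (ha i), map_sub, smul_eq_mul]
    module
  simp only [hterm, Finset.sum_sub_distrib, hsum, hDG]
  rw [Finset.sum_comm, Finset.sum_comm (f := fun i k => coordCLM b k (w - z) •
    (extDeriv (a i) z (Matrix.vecCons (b k) u) • f i w))]
  simp only [Finset.sum_add_distrib, smul_add, ← Finset.smul_sum]
  module

theorem FlatBelow.of_apply_basis {A : E → E →L[ℝ] F} (hA : ContDiffAt ℝ ∞ A z)
    (h : ∀ k, FlatBelow q (fun w => A w (b k)) z) : FlatBelow q A z := by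
  have hs : ∀ k, ContDiffAt ℝ ∞ (fun w => A w (b k)) z := fun k => hA.clm_apply contDiffAt_const
  refine (FlatBelow.sum Finset.univ (fun k w => (ContinuousLinearMap.smulRightL ℝ E F (coordCLM b k))
    (A w (b k))) (fun k => contDiffAt_clm_comp _ (hs k)) fun k => (h k).clm _ (hs k)).congr
    (Eventually.of_forall fun w => ?_)
  ext v
  conv_lhs => rw [← sum_coordCLM_smul b v, map_sum]
  simp [_root_.sum_apply]

/-- The case of degree `0`: the leading part of a horizontal jet of positive order vanishes. -/
theorem flatBelow_of_horizontal {a : ι → E → ℝ} (ha : ∀ i, DifferentiableAt ℝ (a i) z)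
    (hf : ∀ i, ContDiffAt ℝ ∞ (f i) z)
    (h : ∀ᶠ y in 𝓝 z, FlatBelow (q + 1) (fun w => ∑ i, a i y • f i w) y)
    (hd : ∀ e, FlatBelow (q + 1) (fun w => ∑ i, fderiv ℝ (a i) z e • f i w) z) :
    FlatBelow (q + 2) (fun w => ∑ i, a i z • f i w) z := by
  refine flatBelow_succ_iff.2 ⟨(flatBelow_succ_iff.1 h.self_of_nhds).1, ?_⟩
  have hs : ∀ e, ContDiffAt ℝ ∞ (fun w => ∑ i, (fderiv ℝ (a i) z e • f i w +
      a i z • fderiv ℝ (f i) w e)) z := fun e =>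
    ContDiffAt.sum fun i _ => ((hf i).const_smul _).add
      (((contDiffAt_fderiv (hf i)).clm_apply contDiffAt_const).const_smul _)
  refine FlatBelow.of_apply_basis (Module.finBasis ℝ E)
    (contDiffAt_fderiv (contDiffAt_sum_const_smul _ hf)) fun k => ?_
  have hc := contDiffAt_sum_const_smul (fun i => fderiv ℝ (a i) z (Module.finBasis ℝ E k)) hf
  -- The differentiated relation minus horizontality leaves the partial derivative, in `w`, of the
  -- sum with coefficients frozen at `z`.
  refine ((FlatBelow.deriv_point ha (Module.finBasis ℝ E k) hf h).add
    ((hd (Module.finBasis ℝ E k)).const_smul (-1) hc) (hs _) (hc.const_smul _)).congr ?_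
  have hev : ∀ᶠ w in 𝓝 z, ∀ i, ContDiffAt ℝ 1 (f i) w :=
    eventually_all.2 fun i => eventually_contDiffAt (hf i) 1
  filter_upwards [hev] with w hw
  have hdw : ∀ i, DifferentiableAt ℝ (f i) w := fun i => (hw i).differentiableAt (by simp)
  rw [fderiv_fun_sum fun i _ => (hdw i).fun_const_smul _, _root_.sum_apply, Finset.sum_add_distrib]
  rw [neg_smul, one_smul, add_neg_cancel_comm]
  refine Finset.sum_congr rfl fun i _ => ?_
  rw [fderiv_fun_const_smul (hdw i)]
  rfl

end Koszul


/-! ### Scalar forms in charts and their smoothness. -/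

section FormsChart

variable {E : Type u} [NormedAddCommGroup E] [NormedSpace ℝ E]
  {M : Type u} [TopologicalSpace M] [ChartedSpace E M] [IsManifold 𝓘(ℝ, E) ∞ M]

theorem formRep_apply {p : ℕ} (α : Form E M p) {x₀ x : M}
    (hx : x ∈ (extChartAt 𝓘(ℝ, E) x₀).source) (u : Fin p → E) :
    formRep α x₀ (extChartAt 𝓘(ℝ, E) x₀ x) u =
      α x fun j => tangentCoordChange 𝓘(ℝ, E) x₀ x x (u j) := by
  simp only [formRep, (extChartAt 𝓘(ℝ, E) x₀).left_inv hx]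
  rfl

theorem tangentCoordChange_surjective {x₀ x : M} (hx : x ∈ (extChartAt 𝓘(ℝ, E) x₀).source) (v : E) :
    tangentCoordChange 𝓘(ℝ, E) x₀ x x (tangentCoordChange 𝓘(ℝ, E) x x₀ x v) = v := by
  rw [tangentCoordChange_comp ⟨⟨mem_extChartAt_source _, hx⟩, mem_extChartAt_source _⟩,
    tangentCoordChange_self (mem_extChartAt_source _)]

theorem formRep_self {p : ℕ} (α : Form E M p) (x : M) :
    formRep α x (extChartAt 𝓘(ℝ, E) x x) = α x := by
  ext u
  rw [formRep_apply α (mem_extChartAt_source x)]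
  congr 1
  funext j
  exact tangentCoordChange_self (mem_extChartAt_source x)

end FormsChart

section FormsSmooth

variable {E : Type u} [NormedAddCommGroup E] [NormedSpace ℝ E] [FiniteDimensional ℝ E]

/-- A form on a finite-dimensional space is smooth if its values on constant vectors are. -/
theorem contDiffAt_form_of_apply {p : ℕ} {g : E → E [⋀^Fin p]→L[ℝ] ℝ} {z : E}
    (h : ∀ u, ContDiffAt ℝ ∞ (fun y => g y u) z) : ContDiffAt ℝ ∞ g z := by
  set b := Module.finBasis ℝ E
  -- Values on tuples of basis vectors embed the space of forms linearly in a finite power of `ℝ`; a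
  -- linear left inverse recovers `g` from finitely many smooth functions.
  set L : (E [⋀^Fin p]→L[ℝ] ℝ) →ₗ[ℝ] ((Fin p → Fin (Module.finrank ℝ E)) → ℝ) :=
    { toFun := fun a m => a fun j => b (m j)
      map_add' := fun _ _ => rfl
      map_smul' := fun _ _ => rfl } with hL
  have hinj : Function.Injective L := by
    intro a a' haa
    have : a.toAlternatingMap.toMultilinearMap = a'.toAlternatingMap.toMultilinearMap :=
      Module.Basis.ext_multilinear (fun _ => b) fun m => congrFun haa m
    ext v
    exact DFunLike.congr_fun this v
  obtain ⟨R, hR⟩ := LinearMap.exists_leftInverse_of_injective L (LinearMap.ker_eq_bot.2 hinj)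
  have e : g = fun y => R.toContinuousLinearMap (L (g y)) := by
    funext y
    exact (DFunLike.congr_fun hR (g y)).symm
  rw [e]
  exact R.toContinuousLinearMap.contDiff.contDiffAt.comp z
    (contDiffAt_pi.2 fun m => h fun j => b (m j))

/-- On fixed vectors the pullback is linear in `g` and multilinear in `p` copies of `A`, hence
smooth in both. -/
theorem contDiffAt_compContinuousLinearMap {p : ℕ} {g : E → E [⋀^Fin p]→L[ℝ] ℝ} {A : E → E →L[ℝ] E}
    {z : E} (hg : ContDiffAt ℝ ∞ g z) (hA : ContDiffAt ℝ ∞ A z) :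
    ContDiffAt ℝ ∞ (fun y => (g y).compContinuousLinearMap (A y)) z := by
  refine contDiffAt_form_of_apply fun u => ?_
  have h1 : ContDiffAt ℝ ∞ (fun y => (g y).toContinuousMultilinearMap) z :=
    (ContinuousAlternatingMap.toContinuousMultilinearMapLI
      (𝕜 := ℝ) (E := E) (F := ℝ) (ι := Fin p)).contDiff.contDiffAt.comp z hg
  have h2 : ContDiffAt ℝ ∞ (fun y =>
      ContinuousMultilinearMap.compContinuousLinearMapContinuousMultilinear ℝ
        (fun _ : Fin p => E) (fun _ : Fin p => E) ℝ (fun _ => A y)) z :=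
    (ContinuousMultilinearMap.contDiff _).contDiffAt.comp z (contDiffAt_pi.2 fun _ => hA)
  exact (ContinuousMultilinearMap.apply ℝ (fun _ : Fin p => E) ℝ u).contDiff.contDiffAt.comp z
    (h2.clm_apply h1)

variable {M : Type u} [TopologicalSpace M] [ChartedSpace E M] [IsManifold 𝓘(ℝ, E) ∞ M]

/-- `IsSmoothForm` tests each point only in its own preferred chart; with this independence of the
chart a single chart serves for a whole neighbourhood. -/
theorem contDiffAt_formRep_change {p : ℕ} {α : Form E M p} {x₁ x₂ y : M}
    (h1 : y ∈ (extChartAt 𝓘(ℝ, E) x₁).source) (h2 : y ∈ (extChartAt 𝓘(ℝ, E) x₂).source)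
    (h : ContDiffAt ℝ ∞ (formRep α x₁) (extChartAt 𝓘(ℝ, E) x₁ y)) :
    ContDiffAt ℝ ∞ (formRep α x₂) (extChartAt 𝓘(ℝ, E) x₂ y) := by
  have hσ := contDiffAt_transition (E := E) h1 h2
  refine (contDiffAt_compContinuousLinearMap (ContDiffAt.comp (g := formRep α x₁) _ ?_ hσ)
    (hσ.fderiv_right (m := ∞) le_rfl)).congr_of_eventuallyEq (formRep_change α h1 h2)
  rwa [Function.comp_apply, (extChartAt 𝓘(ℝ, E) x₂).left_inv h2]

theorem IsSmoothForm.contDiffAt_formRep {p : ℕ} {α : Form E M p} {W : Opens M}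
    (hα : IsSmoothForm α W) {x₀ y : M} (hy : y ∈ W) (h : y ∈ (extChartAt 𝓘(ℝ, E) x₀).source) :
    ContDiffAt ℝ ∞ (formRep α x₀) (extChartAt 𝓘(ℝ, E) x₀ y) :=
  contDiffAt_formRep_change (mem_extChartAt_source y) h (hα y hy)

/-- The form on the domain of the preferred chart at `x₀` with given coordinate expression. -/
noncomputable def pullForm {p : ℕ} (x₀ : M) (g : E → E [⋀^Fin p]→L[ℝ] ℝ) : Form E M p := fun y =>
  (g (extChartAt 𝓘(ℝ, E) x₀ y)).compContinuousLinearMap (tangentCoordChange 𝓘(ℝ, E) y x₀ y)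

theorem formRep_pullForm {p : ℕ} {x₀ y : M} (g : E → E [⋀^Fin p]→L[ℝ] ℝ)
    (hy : y ∈ (extChartAt 𝓘(ℝ, E) x₀).source) :
    formRep (pullForm x₀ g) x₀ =ᶠ[𝓝 (extChartAt 𝓘(ℝ, E) x₀ y)] g := by
  filter_upwards [eventually_target hy] with z hz
  have hs := (extChartAt 𝓘(ℝ, E) x₀).map_target hz
  ext v
  simp only [formRep, pullForm, ContinuousAlternatingMap.compContinuousLinearMap_apply,
    (extChartAt 𝓘(ℝ, E) x₀).right_inv hz]
  refine congrArg _ (funext fun i => ?_)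
  simp only [Function.comp_apply]
  rw [tangentCoordChange_comp ⟨⟨hs, mem_extChartAt_source _⟩, hs⟩, tangentCoordChange_self hs]

theorem isSmoothForm_pullForm {p : ℕ} {x₀ : M} {g : E → E [⋀^Fin p]→L[ℝ] ℝ} {W : Opens M}
    (hW : ∀ y ∈ W, y ∈ (extChartAt 𝓘(ℝ, E) x₀).source)
    (hg : ∀ y ∈ W, ContDiffAt ℝ ∞ g (extChartAt 𝓘(ℝ, E) x₀ y)) :
    IsSmoothForm (pullForm x₀ g) W := fun y hy =>
  contDiffAt_formRep_change (hW y hy) (mem_extChartAt_source y)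
    ((hg y hy).congr_of_eventuallyEq (formRep_pullForm g (hW y hy)))

end FormsSmooth

/-! ### The forms `α ⊗ j(s)`, and forms with values in jets read in a fixed chart. -/

section Tensor

variable {E : Type u} [NormedAddCommGroup E] [NormedSpace ℝ E]
  {M : Type u} [TopologicalSpace M] [ChartedSpace E M] [IsManifold 𝓘(ℝ, E) ∞ M]
  {F : Type u} [NormedAddCommGroup F] [NormedSpace ℝ F]
  {V : M → Type u} [TopologicalSpace (TotalSpace F V)]
  [∀ x, AddCommGroup (V x)] [∀ x, Module ℝ (V x)] [∀ x, TopologicalSpace (V x)]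
  [FiberBundle F V] [VectorBundle ℝ F V] [ContMDiffVectorBundle ∞ F V 𝓘(ℝ, E)]
  {p : ℕ} {W U : Opens M}

noncomputable instance : AddCommGroup (JetForms E F V p U) := Submodule.addCommGroup _

open Classical in
noncomputable def tensorVal (α : Form E M p) (s : SmoothSections E F V W) : JetField E M F p :=
  fun x r => if x ∈ W then (α x).smulRight (jetAt E F V s.1 x r) else 0

theorem tensorVal_apply (α : Form E M p) (s : SmoothSections E F V W) {x : M} (hx : x ∈ W) (r : ℕ) :
    tensorVal α s x r = (α x).smulRight (jetAt E F V s.1 x r) := if_pos hx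

noncomputable def tensorExpr {α : Form E M p} (hα : IsSmoothForm α W) (s : SmoothSections E F V W)
    (k : ℕ) : LocalExpr V (tensorVal α s) k W where
  ι := Unit
  fin := inferInstance
  form _ := α
  sec _ := s
  smooth _ := hα
  eq x hx r _ := by simp [tensorVal, hx]

/-- The form `α ⊗ j(s)`. -/
noncomputable def tensor {α : Form E M p} (hα : IsSmoothForm α W) (s : SmoothSections E F V W) :
    JetForms E F V p W :=
  ⟨tensorVal α s, fun _ hx k => ⟨W, le_rfl, hx, ⟨tensorExpr hα s k⟩⟩,
    fun _ hx => funext fun _ => if_neg hx⟩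

theorem nabla_tensor {α : Form E M p} (hα : IsSmoothForm α W) (s : SmoothSections E F V W) :
    nabla E F V p W (tensor hα s) = tensor hα.extD s := by
  ext1
  funext x r
  by_cases hx : x ∈ W
  · refine (nablaVal_eq (tensor hα s) le_rfl (tensorExpr hα s (r + 1)) hx le_rfl).trans ?_
    refine Eq.trans ?_ (tensorVal_apply (extD α) s hx r).symm
    exact Fintype.sum_unique (ι := Unit) _
  · exact (dif_neg hx).trans (if_neg hx).symm

theorem coe_jetForms_sum {ι : Type*} (t : Finset ι) (θ : ι → JetForms E F V p U) (x : M) (r : ℕ) :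
    (∑ i ∈ t, θ i).1 x r = ∑ i ∈ t, (θ i).1 x r := by
  rw [AddSubmonoidClass.coe_finsetSum, Finset.sum_apply, Finset.sum_apply]

/-- The form with values in jets defined by a local expression. -/
noncomputable def LocalExpr.toForm {η : JetField E M F p} {k : ℕ} (e : LocalExpr V η k W) :
    JetForms E F V p W := ∑ i, tensor (e.smooth i) (e.sec i)

theorem LocalExpr.toForm_apply {η : JetField E M F p} {k : ℕ} (e : LocalExpr V η k W) {x : M}
    (hx : x ∈ W) {r : ℕ} (hr : r ≤ k) : e.toForm.1 x r = η x r := by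
  rw [LocalExpr.toForm, coe_jetForms_sum, e.eq x hx r hr]
  exact Finset.sum_congr rfl fun i _ => tensorVal_apply _ _ hx r

/-- No bound on `r` is needed: `e.toForm` is given by its expression to every order, whereas `η` is
only up to order `k`. -/
theorem LocalExpr.nabla_toForm_apply {η : JetField E M F p} {k : ℕ} (e : LocalExpr V η k W) {x : M}
    (hx : x ∈ W) (r : ℕ) : (JetComplex.nabla E F V p W e.toForm).1 x r = e.dval x r := by
  rw [LocalExpr.toForm, map_sum, coe_jetForms_sum]
  refine Finset.sum_congr rfl fun i _ => ?_
  rw [nabla_tensor]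
  exact tensorVal_apply _ _ hx r

/-- The product of a section and a smooth function. -/
noncomputable def mulSec {f : M → ℝ} (hf : ContMDiffOn 𝓘(ℝ, E) 𝓘(ℝ, ℝ) ∞ f W)
    (s : SmoothSections E F V W) : SmoothSections E F V W :=
  ⟨fun x => f x • s.1 x, hf.smul_section s.2.1, fun x hx => by
    simp only [s.2.2 x hx, smul_zero]⟩

theorem coordRep_mulSec {f : M → ℝ} (hf : ContMDiffOn 𝓘(ℝ, E) 𝓘(ℝ, ℝ) ∞ f W)
    (s : SmoothSections E F V W) {x₀ y : M} (hy : y ∈ coordDomain E F V x₀) :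
    coordRep E F V (mulSec hf s).1 x₀ =ᶠ[𝓝 (extChartAt 𝓘(ℝ, E) x₀ y)]
      fun z => f ((extChartAt 𝓘(ℝ, E) x₀).symm z) • coordRep E F V s.1 x₀ z := by
  filter_upwards [(tendsto_chart_symm hy.1).eventually
    ((isOpen_coordDomain E F V x₀).mem_nhds hy)] with z hz
  exact ((trivializationAt F V x₀).linear ℝ hz.2).map_smul _ _

variable (W) in
/-- On the vectors with coordinates `u` in the preferred chart at `x₀`, the Taylor coefficients of
`θ` at `x` of order less than `k` are those of a section of `V` over `W` whose coordinate expression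
is `g` near `x`. -/
def Rep (V : M → Type u) [TopologicalSpace (TotalSpace F V)]
    [∀ x, AddCommGroup (V x)] [∀ x, Module ℝ (V x)] [∀ x, TopologicalSpace (V x)]
    [FiberBundle F V] [VectorBundle ℝ F V]
    (θ : JetField E M F p) (x₀ x : M) (u : Fin p → E) (g : E → F) (k : ℕ) : Prop :=
  ∃ S : SmoothSections E F V W,
    (∀ r < k, θ x r (fun j => tangentCoordChange 𝓘(ℝ, E) x₀ x x (u j)) = jetAt E F V S.1 x r) ∧
      coordRep E F V S.1 x₀ =ᶠ[𝓝 (extChartAt 𝓘(ℝ, E) x₀ x)] g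

variable {θ θ' : JetField E M F p} {x₀ x : M} {u : Fin p → E} {g g' : E → F} {k : ℕ}

theorem Rep.congr_left (h : Rep W V θ x₀ x u g k) (e : ∀ r < k, θ' x r = θ x r) :
    Rep W V θ' x₀ x u g k := by
  obtain ⟨S, h1, h2⟩ := h
  exact ⟨S, fun r hr => by rw [e r hr, h1 r hr], h2⟩

theorem Rep.congr_right (h : Rep W V θ x₀ x u g k)
    (e : g =ᶠ[𝓝 (extChartAt 𝓘(ℝ, E) x₀ x)] g') : Rep W V θ x₀ x u g' k := by
  obtain ⟨S, h1, h2⟩ := h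
  exact ⟨S, h1, h2.trans e⟩

theorem Rep.add (hW : x ∈ W) (hx : x ∈ coordDomain E F V x₀) (h : Rep W V θ x₀ x u g k)
    (h' : Rep W V θ' x₀ x u g' k) : Rep W V (θ + θ') x₀ x u (fun w => g w + g' w) k := by
  obtain ⟨S, h1, h2⟩ := h
  obtain ⟨S', h1', h2'⟩ := h'
  refine ⟨S + S', fun r hr => ?_, (coordRep_add hx).trans (h2.add h2')⟩
  rw [jetAt_add E F V S S' hW, ← h1 r hr, ← h1' r hr]
  rfl

theorem Rep.smul (hW : x ∈ W) (hx : x ∈ coordDomain E F V x₀) (c : ℝ) (h : Rep W V θ x₀ x u g k) :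
    Rep W V (c • θ) x₀ x u (fun w => c • g w) k := by
  obtain ⟨S, h1, h2⟩ := h
  refine ⟨c • S, fun r hr => ?_, (coordRep_smul c hx).trans (h2.const_smul c)⟩
  rw [jetAt_smul E F V c S hW, ← h1 r hr]
  rfl

theorem Rep.sub (hW : x ∈ W) (hx : x ∈ coordDomain E F V x₀) (h : Rep W V θ x₀ x u g k)
    (h' : Rep W V θ' x₀ x u g' k) : Rep W V (θ - θ') x₀ x u (fun w => g w - g' w) k := by
  have h1 := h.add hW hx (h'.smul hW hx (-1))
  refine (h1.congr_left fun r _ => ?_).congr_right (Eventually.of_forall fun w => ?_)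
  · change θ x r - θ' x r = θ x r + (-1 : ℝ) • θ' x r
    rw [neg_one_smul ℝ (M := E [⋀^Fin p]→L[ℝ] (E [×r]→L[ℝ] F)), sub_eq_add_neg]
  · simp [sub_eq_add_neg]

theorem Rep.sum (hW : x ∈ W) (hx : x ∈ coordDomain E F V x₀) {ι : Type*} (t : Finset ι)
    {θ : ι → JetForms E F V p U} {g : ι → E → F} (h : ∀ i, Rep W V (θ i).1 x₀ x u (g i) k) :
    Rep W V (∑ i ∈ t, θ i).1 x₀ x u (fun w => ∑ i ∈ t, g i w) k := by
  classical
  induction t using Finset.induction_on with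
  | empty =>
    refine ⟨0, fun r _ => ?_, ?_⟩
    · have := jetAt_smul E F V 0 (0 : SmoothSections E F V W) hW r
      rw [zero_smul, zero_smul] at this
      rw [this]
      rfl
    · have := coordRep_smul (E := E) (F := F) 0 (s := (0 : (x : M) → V x)) hx
      simp only [zero_smul] at this
      simp only [Finset.sum_empty]
      exact this
  | insert a t ha ih =>
    simp only [Finset.sum_insert ha]
    exact (h a).add hW hx ih

/-- At the given base point the coefficient of the form is a real number, so a constant multiple of
`s` has the required jet. The coefficient depends on `x`, not on the Taylor variable `w`. -/
theorem Rep.tensor {α : Form E M p} (hα : IsSmoothForm α W) (s : SmoothSections E F V W)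
    (hW : x ∈ W) (hx : x ∈ coordDomain E F V x₀) :
    Rep W V (tensor hα s).1 x₀ x u
      (fun w => formRep α x₀ (extChartAt 𝓘(ℝ, E) x₀ x) u • coordRep E F V s.1 x₀ w) k := by
  refine ⟨formRep α x₀ (extChartAt 𝓘(ℝ, E) x₀ x) u • s, fun r _ => ?_, coordRep_smul _ hx⟩
  rw [jetAt_smul E F V _ s hW, formRep_apply α hx.1]
  exact DFunLike.congr_fun (tensorVal_apply α s hW r) _

/-- The Taylor coefficients of `θ` at `x` refer to the chart at `x`, those of `g` to the chart at
`x₀`. They are jets of one section, and its order of vanishing is independent of coordinates by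
`Flat.change`; for this reason `Rep` demands an actual section. -/
theorem Rep.flatBelow_iff (hW : x ∈ W) (hx : x ∈ coordDomain E F V x₀)
    (h : Rep W V θ x₀ x u g k) {k' : ℕ} (hk : k' ≤ k) :
    FlatBelow k' g (extChartAt 𝓘(ℝ, E) x₀ x) ↔
      ∀ r < k', θ x r (fun j => tangentCoordChange 𝓘(ℝ, E) x₀ x x (u j)) = 0 := by
  obtain ⟨S, h1, h2⟩ := h
  have hS := contMDiffAt_sec S hW
  rcases k' with _ | k'
  · exact ⟨fun _ r hr => by omega, fun _ => flatBelow_zero _ _⟩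
  constructor
  · intro hg r hr
    rw [h1 r (by omega)]
    exact Flat.change hx (mem_coordDomain E F V x) hS (flatBelow_succ.1 (hg.congr h2)) r (by omega)
  · intro hg
    refine FlatBelow.congr (flatBelow_succ.2 (Flat.change (mem_coordDomain E F V x) hx hS
      fun r hr => ?_)) h2.symm
    exact (h1 r (by omega)).symm.trans (hg r (by omega))

end Tensor


/-! ### Local primitives to leading order, and horizontal jets. -/

section LocalPrimitive

variable {E : Type u} [NormedAddCommGroup E] [NormedSpace ℝ E] [FiniteDimensional ℝ E]
  {M : Type u} [TopologicalSpace M] [ChartedSpace E M] [IsManifold 𝓘(ℝ, E) ∞ M]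
  {F : Type u} [NormedAddCommGroup F] [NormedSpace ℝ F]
  {V : M → Type u} [TopologicalSpace (TotalSpace F V)]
  [∀ x, AddCommGroup (V x)] [∀ x, Module ℝ (V x)] [∀ x, TopologicalSpace (V x)]
  [FiberBundle F V] [VectorBundle ℝ F V] [ContMDiffVectorBundle ∞ F V 𝓘(ℝ, E)]
  {p q : ℕ} {W U : Opens M}

/-- The coordinate change of tangent vectors is surjective, so the vectors with coordinates `u` in
the chart at `x₀` exhaust the tangent space at `x`. -/
theorem Rep.eq_zero {θ : JetField E M F p} {x₀ x : M} {k : ℕ} (hW : x ∈ W)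
    (hx : x ∈ coordDomain E F V x₀) (g : (Fin p → E) → E → F)
    (h : ∀ u, Rep W V θ x₀ x u (g u) k)
    (hg : ∀ u, FlatBelow k (g u) (extChartAt 𝓘(ℝ, E) x₀ x)) : ∀ r < k, θ x r = 0 := by
  intro r hr
  ext1 v
  have := ((h fun j => tangentCoordChange 𝓘(ℝ, E) x x₀ x (v j)).flatBelow_iff hW hx le_rfl).1
    (hg _) r hr
  simp only [tangentCoordChange_surjective hx.1] at this
  exact this

theorem contMDiffOn_coord (l : E →L[ℝ] ℝ) {x₀ : M}
    (hW : ∀ y ∈ W, y ∈ (extChartAt 𝓘(ℝ, E) x₀).source) :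
    ContMDiffOn 𝓘(ℝ, E) 𝓘(ℝ, ℝ) ∞ (fun y => l (extChartAt 𝓘(ℝ, E) x₀ y)) W :=
  l.contMDiff.comp_contMDiffOn (contMDiffOn_extChartAt.mono fun y hy => by
    simpa using hW y hy)

section Koszul

variable {η : JetField E M F (p + 1)} (e : LocalExpr V η q W) {x₀ : M}
  (hW : ∀ y ∈ W, y ∈ coordDomain E F V x₀)

include hW

theorem isSmoothForm_contract {α : Form E M (p + 1)} (hα : IsSmoothForm α W) (v : E) :
    IsSmoothForm (pullForm x₀ (contract v (formRep α x₀))) W :=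
  isSmoothForm_pullForm (fun y hy => (hW y hy).1) fun y hy =>
    contDiffAt_contract v (hα.contDiffAt_formRep hy (hW y hy).1)

theorem isSmoothForm_coord_contract {α : Form E M (p + 1)} (hα : IsSmoothForm α W) (l : E →L[ℝ] ℝ)
    (v : E) : IsSmoothForm (pullForm x₀ fun y => l y • contract v (formRep α x₀) y) W :=
  isSmoothForm_pullForm (fun y hy => (hW y hy).1) fun y hy =>
    l.contDiff.contDiffAt.smul (contDiffAt_contract v (hα.contDiffAt_formRep hy (hW y hy).1))

/-- The Koszul contraction, in the preferred chart at `x₀`, of a form with values in jets. -/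
noncomputable def koszulForm : JetForms E F V p W :=
  ∑ i, ∑ k, (tensor (isSmoothForm_contract hW (e.smooth i) (Module.finBasis ℝ E k))
      (mulSec (contMDiffOn_coord (coordCLM (Module.finBasis ℝ E) k) fun y hy => (hW y hy).1)
        (e.sec i)) -
    tensor (isSmoothForm_coord_contract hW (e.smooth i) (coordCLM (Module.finBasis ℝ E) k)
      (Module.finBasis ℝ E k)) (e.sec i))

theorem coordRep_mulSec_coord (l : E →L[ℝ] ℝ) (s : SmoothSections E F V W) {x : M} (hx : x ∈ W) :
    coordRep E F V (mulSec (contMDiffOn_coord l fun y hy => (hW y hy).1) s).1 x₀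
      =ᶠ[𝓝 (extChartAt 𝓘(ℝ, E) x₀ x)] fun z => l z • coordRep E F V s.1 x₀ z := by
  filter_upwards [coordRep_mulSec (contMDiffOn_coord l fun y hy => (hW y hy).1) s (hW x hx),
    eventually_target (hW x hx).1] with z hz ht
  rw [hz, (extChartAt 𝓘(ℝ, E) x₀).right_inv ht]

/-- Multiplying the section by a coordinate gives `x_k(w)`, in the Taylor variable; multiplying the
form by it gives `x_k(z)`, at the base point. The difference of the two tensors realizes the factor
`x_k(w) - x_k(z)` of the Koszul contraction. -/
theorem rep_koszulForm {x : M} (hx : x ∈ W) (u : Fin p → E) (m : ℕ) :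
    Rep W V (koszulForm e hW).1 x₀ x u (fun w => ∑ i, ∑ k,
      (contract (Module.finBasis ℝ E k) (formRep (e.form i) x₀) (extChartAt 𝓘(ℝ, E) x₀ x) u •
          coordCLM (Module.finBasis ℝ E) k w • coordRep E F V (e.sec i).1 x₀ w -
        (coordCLM (Module.finBasis ℝ E) k (extChartAt 𝓘(ℝ, E) x₀ x) •
          contract (Module.finBasis ℝ E k) (formRep (e.form i) x₀) (extChartAt 𝓘(ℝ, E) x₀ x) u) •
          coordRep E F V (e.sec i).1 x₀ w)) m := by
  have hd := hW x hx
  refine Rep.sum hx hd _ fun i => Rep.sum hx hd _ fun k => Rep.sub hx hd ?_ ?_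
  · refine (Rep.tensor _ _ hx hd).congr_right ?_
    filter_upwards [coordRep_mulSec_coord hW (coordCLM (Module.finBasis ℝ E) k) (e.sec i) hx]
      with w hw
    rw [hw, (formRep_pullForm _ hd.1).eq_of_nhds]
  · refine (Rep.tensor _ _ hx hd).congr_right (Eventually.of_forall fun w => ?_)
    rw [(formRep_pullForm _ hd.1).eq_of_nhds]
    rfl

/-- `∇` differentiates the scalar forms only: the coordinate inside the jet is left alone, and the
one in the coefficient of the form is differentiated with it. -/
theorem rep_nabla_koszulForm {x : M} (hx : x ∈ W) (u : Fin (p + 1) → E) (m : ℕ) :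
    Rep W V (nabla E F V p W (koszulForm e hW)).1 x₀ x u (fun w => ∑ i, ∑ k,
      (extDeriv (contract (Module.finBasis ℝ E k) (formRep (e.form i) x₀))
          (extChartAt 𝓘(ℝ, E) x₀ x) u •
          coordCLM (Module.finBasis ℝ E) k w • coordRep E F V (e.sec i).1 x₀ w -
        extDeriv (fun y => coordCLM (Module.finBasis ℝ E) k y •
            contract (Module.finBasis ℝ E k) (formRep (e.form i) x₀) y)
          (extChartAt 𝓘(ℝ, E) x₀ x) u • coordRep E F V (e.sec i).1 x₀ w)) m := by
  have hd := hW x hx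
  have hex : ∀ {g : E → E [⋀^Fin p]→L[ℝ] ℝ}, IsSmoothForm (pullForm x₀ g) W →
      formRep (extD (pullForm x₀ g)) x₀ (extChartAt 𝓘(ℝ, E) x₀ x) =
        extDeriv g (extChartAt 𝓘(ℝ, E) x₀ x) := fun hg => by
    rw [(formRep_extD hg hx hd.1).eq_of_nhds, (formRep_pullForm _ hd.1).extDeriv_eq]
  unfold koszulForm
  simp only [map_sum]
  refine Rep.sum hx hd _ fun i => Rep.sum hx hd _ fun k => ?_
  rw [map_sub, nabla_tensor, nabla_tensor]
  refine Rep.sub hx hd ?_ ?_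
  · refine (Rep.tensor _ _ hx hd).congr_right ?_
    filter_upwards [coordRep_mulSec_coord hW (coordCLM (Module.finBasis ℝ E) k) (e.sec i) hx]
      with w hw
    rw [hw, hex (isSmoothForm_contract hW (e.smooth i) _)]
  · refine (Rep.tensor _ _ hx hd).congr_right (Eventually.of_forall fun w => ?_)
    rw [hex (isSmoothForm_coord_contract hW (e.smooth i) _ _)]

end Koszul

theorem LocalExpr.rep_toForm {η : JetField E M F p} {k : ℕ} (e : LocalExpr V η k W) {x₀ x : M}
    (hx : x ∈ W) (hd : x ∈ coordDomain E F V x₀) (u : Fin p → E) (m : ℕ) :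
    Rep W V e.toForm.1 x₀ x u (fun w => ∑ i, formRep (e.form i) x₀ (extChartAt 𝓘(ℝ, E) x₀ x) u •
      coordRep E F V (e.sec i).1 x₀ w) m :=
  Rep.sum hx hd _ fun _ => Rep.tensor _ _ hx hd

theorem LocalExpr.rep {η : JetField E M F p} {k : ℕ} (e : LocalExpr V η k W) {x₀ x : M}
    (hx : x ∈ W) (hd : x ∈ coordDomain E F V x₀) (u : Fin p → E) :
    Rep W V η x₀ x u (fun w => ∑ i, formRep (e.form i) x₀ (extChartAt 𝓘(ℝ, E) x₀ x) u •
      coordRep E F V (e.sec i).1 x₀ w) (k + 1) :=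
  (e.rep_toForm hx hd u (k + 1)).congr_left fun _ hr =>
    (e.toForm_apply hx (Nat.lt_succ_iff.1 hr)).symm

/-- One order is lost compared with `LocalExpr.rep`, because order `r` of `∇η` is read off from an
expression of `η` up to order `r + 1`. -/
theorem LocalExpr.rep_nabla {η : JetForms E F V p U} {k : ℕ} (hWU : W ≤ U)
    (e : LocalExpr V η.1 k W) {x₀ x : M}
    (hx : x ∈ W) (hd : x ∈ coordDomain E F V x₀) (u : Fin (p + 1) → E) :
    Rep W V (JetComplex.nabla E F V p U η).1 x₀ x u (fun w =>
      ∑ i, extDeriv (formRep (e.form i) x₀) (extChartAt 𝓘(ℝ, E) x₀ x) u •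
        coordRep E F V (e.sec i).1 x₀ w) k := by
  have h : Rep W V (JetComplex.nabla E F V p W e.toForm).1 x₀ x u (fun w =>
      ∑ i, extDeriv (formRep (e.form i) x₀) (extChartAt 𝓘(ℝ, E) x₀ x) u •
        coordRep E F V (e.sec i).1 x₀ w) k := by
    unfold LocalExpr.toForm
    simp only [map_sum, nabla_tensor]
    refine Rep.sum hx hd _ fun i => (Rep.tensor _ _ hx hd).congr_right
      (Eventually.of_forall fun w => ?_)
    rw [(formRep_extD (e.smooth i) hx hd.1).eq_of_nhds]
  refine h.congr_left fun r hr => ?_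
  rw [e.nabla_toForm_apply hx r]
  exact nablaVal_eq η hWU e hx hr

variable {η : JetForms E F V (p + 1) U}

/-- The sums in coordinates of an expression of a form that vanishes below order `q`. -/
theorem LocalExpr.eventually_flatBelow {η : JetField E M F p} {k : ℕ} (e : LocalExpr V η k W)
    {x₀ x : M} (hx : x ∈ W) (hd : x ∈ coordDomain E F V x₀) (hq : ∀ y ∈ W, ∀ r < q, η y r = 0)
    (hk : q ≤ k + 1) : ∀ᶠ z in 𝓝 (extChartAt 𝓘(ℝ, E) x₀ x), ∀ u, FlatBelow q (fun w =>
      ∑ i, formRep (e.form i) x₀ z u • coordRep E F V (e.sec i).1 x₀ w) z := by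
  filter_upwards [(tendsto_chart_symm hd.1).eventually (W.isOpen.mem_nhds hx),
    (tendsto_chart_symm hd.1).eventually ((isOpen_coordDomain E F V x₀).mem_nhds hd),
    eventually_target hd.1] with z h1 h2 h3 u
  have := ((e.rep h1 h2 u).flatBelow_iff h1 h2 hk).2 fun r hr => by
    rw [hq _ h1 r hr]; rfl
  rwa [(extChartAt 𝓘(ℝ, E) x₀).right_inv h3] at this

/-- The primitive is the Koszul contraction in the chart at `x₀`, divided by the constant of the
homotopy formula. That it vanishes to one order more than `η` is what makes the later gluing and
summation possible. -/
theorem exists_local_primitive (hq : ∀ x ∈ U, ∀ r < q, η.1 x r = 0)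
    (hη : nabla E F V (p + 1) U η = 0) {x₀ : M} (hx₀ : x₀ ∈ U) :
    ∃ W ≤ U, x₀ ∈ W ∧ ∃ ζ : JetForms E F V p W, (∀ x ∈ W, ∀ r < q + 1, ζ.1 x r = 0) ∧
      ∀ x ∈ W, ∀ r < q + 1, (nabla E F V p W ζ).1 x r = η.1 x r := by
  obtain ⟨W₀, hW₀, hxW₀, ⟨e₀⟩⟩ := η.2.1 x₀ hx₀ q
  set W : Opens M := W₀ ⊓ ⟨_, isOpen_coordDomain E F V x₀⟩
  have hWU : W ≤ U := inf_le_left.trans hW₀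
  have e : LocalExpr V η.1 q W := e₀.mono le_rfl inf_le_left
  have hW : ∀ y ∈ W, y ∈ coordDomain E F V x₀ := fun y hy => hy.2
  -- Form degree plus Taylor degree; it is positive because `η` has degree `p + 1 ≥ 1`, even when `q
  -- = 0`.
  set c : ℝ := (p : ℝ) + 1 + q with hc
  have hc0 : c ≠ 0 := by positivity
  have hflat : ∀ x ∈ W, ∀ᶠ z in 𝓝 (extChartAt 𝓘(ℝ, E) x₀ x), ∀ u, FlatBelow q (fun w =>
      ∑ i, formRep (e.form i) x₀ z u • coordRep E F V (e.sec i).1 x₀ w) z := fun x hx =>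
    e.eventually_flatBelow hx (hW x hx) (fun y hy => hq y (hWU hy)) (by omega)
  have hf : ∀ x ∈ W, ∀ i, ContDiffAt ℝ ∞ (coordRep E F V (e.sec i).1 x₀)
      (extChartAt 𝓘(ℝ, E) x₀ x) := fun x hx i =>
    contDiffAt_coordRep (hW x hx) (contMDiffAt_sec (e.sec i) hx)
  have ha : ∀ x ∈ W, ∀ i, ContDiffAt ℝ ∞ (formRep (e.form i) x₀)
      (extChartAt 𝓘(ℝ, E) x₀ x) := fun x hx i => (e.smooth i).contDiffAt_formRep hx (hW x hx).1
  refine ⟨W, hWU, ⟨hxW₀, mem_coordDomain E F V x₀⟩, (-c⁻¹) • koszulForm e hW, ?_, ?_⟩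
  · intro x hx r hr
    have h0 : (koszulForm e hW).1 x r = 0 :=
      Rep.eq_zero hx (hW x hx) _ (fun u => rep_koszulForm e hW hx u (q + 1))
        (fun u => flatBelow_koszul _ (hf x hx) (hflat x hx).self_of_nhds u) r hr
    change (-c⁻¹) • (koszulForm e hW).1 x r = 0
    rw [h0]
    exact smul_zero (A := E [⋀^Fin p]→L[ℝ] (E [×r]→L[ℝ] F)) (-c⁻¹)
  · intro x hx r hr
    -- An expression of `η` up to order `q` determines `∇η` only below order `q`, and the homotopy
    -- formula asks for closedness just there.
    have hd : ∀ u, FlatBelow q (fun w => ∑ i, extDeriv (formRep (e.form i) x₀)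
        (extChartAt 𝓘(ℝ, E) x₀ x) u • coordRep E F V (e.sec i).1 x₀ w)
        (extChartAt 𝓘(ℝ, E) x₀ x) := fun u =>
      ((e.rep_nabla hWU hx (hW x hx) u).flatBelow_iff hx (hW x hx) le_rfl).2 fun _ _ => by
        rw [hη]; rfl
    have h0 : ((nabla E F V p W (koszulForm e hW)).1 + c • η.1) x r = 0 :=
      Rep.eq_zero hx (hW x hx) _ (fun u => (rep_nabla_koszulForm e hW hx u (q + 1)).add hx (hW x hx)
        ((e.rep hx (hW x hx) u).smul hx (hW x hx) c))
        (fun u => flatBelow_koszul_homotopy _ (ha x hx) (hf x hx) (hflat x hx) hd u) r hr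
    rw [map_smul]
    change (-c⁻¹) • (nabla E F V p W (koszulForm e hW)).1 x r = η.1 x r
    rw [eq_neg_of_add_eq_zero_left (show (nabla E F V p W (koszulForm e hW)).1 x r +
      c • η.1 x r = 0 from h0)]
    ext v w
    simp [hc0]

/-- Horizontality expresses the first derivatives, in the Taylor variable, of a jet through
derivatives of its coefficients along the base. Where the orders up to `q` vanish on all of `U`,
this forces order `q + 1` to vanish. -/
theorem vanish_succ_of_horizontal {η : JetForms E F V 0 U} (hq : ∀ x ∈ U, ∀ r < q + 1, η.1 x r = 0)
    (hη : nabla E F V 0 U η = 0) : ∀ x ∈ U, ∀ r < q + 2, η.1 x r = 0 := by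
  intro x hxU
  obtain ⟨W, hWU, hx, ⟨e⟩⟩ := η.2.1 x hxU (q + 1)
  have hdm := mem_coordDomain E F V x
  have ha : ∀ i, ContDiffAt ℝ ∞ (formRep (e.form i) x) (extChartAt 𝓘(ℝ, E) x x) := fun i =>
    e.smooth i x hx
  refine Rep.eq_zero hx hdm _ (fun u => e.rep hx hdm u) fun u => ?_
  have hd : ∀ i, DifferentiableAt ℝ (formRep (e.form i) x) (extChartAt 𝓘(ℝ, E) x x) := fun i =>
    (ha i).differentiableAt (by simp)
  refine flatBelow_of_horizontal (a := fun i z => formRep (e.form i) x z u)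
    (fun i => (hd i).continuousAlternatingMap_apply_const u)
    (fun i => contDiffAt_coordRep hdm (contMDiffAt_sec (e.sec i) hx))
    ((e.eventually_flatBelow hx hdm (fun y hy => hq y (hWU hy)) (by omega)).mono
      fun z hz => hz u) fun v => ?_
  have := ((e.rep_nabla hWU hx hdm fun _ => v).flatBelow_iff hx hdm le_rfl).2 fun _ _ => by
    rw [hη]; rfl
  refine this.congr (Eventually.of_forall fun w => Finset.sum_congr rfl fun i _ => ?_)
  -- In degree `0` the exterior derivative has a single term, the directional derivative, evaluated
  -- on the unique empty tuple.
  rw [extDeriv_apply (hd i)]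
  simp only [Fin.sum_univ_succ, Finset.univ_eq_empty, Finset.sum_empty, add_zero, Fin.val_zero,
    pow_zero, one_smul]
  congr 4
  funext z
  congr 1
  exact Subsingleton.elim _ _

end LocalPrimitive


/-! ### Locality of `∇`, gluing by partitions of unity, and exactness in positive degree. -/

section Gluing

variable {E : Type u} [NormedAddCommGroup E] [NormedSpace ℝ E]
  {M : Type u} [TopologicalSpace M] [ChartedSpace E M] [IsManifold 𝓘(ℝ, E) ∞ M]
  {F : Type u} [NormedAddCommGroup F] [NormedSpace ℝ F]
  {V : M → Type u} [TopologicalSpace (TotalSpace F V)]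
  [∀ x, AddCommGroup (V x)] [∀ x, Module ℝ (V x)] [∀ x, TopologicalSpace (V x)]
  [FiberBundle F V] [VectorBundle ℝ F V] [ContMDiffVectorBundle ∞ F V 𝓘(ℝ, E)]
  {p q : ℕ} {W U : Opens M}

/-- A local expression of a family is one of every family that agrees with it to the given order. -/
def LocalExpr.congr {η η' : JetField E M F p} {k : ℕ} (e : LocalExpr V η k W)
    (h : ∀ y ∈ W, ∀ r ≤ k, η' y r = η y r) : LocalExpr V η' k W :=
  { e with eq := fun x hx r hr => (h x hx r hr).trans (e.eq x hx r hr) }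

/-- Families that agree near `x` to order `k` share an expression there, with the same forms and
sections and hence the same `dval`. Both smoothness and `∇` are therefore local to finite order. -/
theorem exists_localExpr_of_eventuallyEq {η : JetField E M F p} (θ : JetForms E F V p W) {x : M}
    (hx : x ∈ W) (hU : x ∈ U) {k : ℕ} (h : ∀ᶠ y in 𝓝 x, ∀ r ≤ k, η y r = θ.1 y r) :
    ∃ W' ≤ U, W' ≤ W ∧ x ∈ W' ∧ ∃ e' : LocalExpr V η k W', ∃ e : LocalExpr V θ.1 k W',
      ∀ y r, e'.dval y r = e.dval y r := by
  obtain ⟨W₁, hW₁, hxW₁, ⟨e⟩⟩ := θ.2.1 x hx k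
  obtain ⟨O, hO, hOo, hxO⟩ := mem_nhds_iff.1 h
  have hle : W₁ ⊓ ⟨O, hOo⟩ ⊓ U ≤ W₁ := inf_le_left.trans inf_le_left
  exact ⟨W₁ ⊓ ⟨O, hOo⟩ ⊓ U, inf_le_right, hle.trans hW₁, ⟨⟨hxW₁, hxO⟩, hU⟩,
    (e.mono le_rfl hle).congr fun y hy => hO hy.1.2, e.mono le_rfl hle, fun _ _ => rfl⟩

/-- A family that agrees locally and to each finite order with smooth forms with values in jets is
one. -/
theorem mem_jetForms_of_local {ξ : JetField E M F p}
    (h : ∀ x ∈ U, ∀ k : ℕ, ∃ (W : Opens M) (θ : JetForms E F V p W), x ∈ W ∧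
      ∀ᶠ y in 𝓝 x, ∀ r ≤ k, ξ y r = θ.1 y r)
    (h0 : ∀ x ∉ U, ξ x = 0) : ξ ∈ JetForms E F V p U := by
  refine ⟨fun x hx k => ?_, h0⟩
  obtain ⟨W, θ, hxW, hθ⟩ := h x hx k
  obtain ⟨W', hW', -, hxW', e', -⟩ := exists_localExpr_of_eventuallyEq θ hxW hx hθ
  exact ⟨W', hW', hxW', ⟨e'⟩⟩

theorem nabla_congr_of_eventuallyEq {η : JetForms E F V p U} {θ : JetForms E F V p W} {x : M}
    (hxU : x ∈ U) (hxW : x ∈ W) {r : ℕ} (h : ∀ᶠ y in 𝓝 x, ∀ m ≤ r + 1, η.1 y m = θ.1 y m) :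
    (nabla E F V p U η).1 x r = (nabla E F V p W θ).1 x r := by
  obtain ⟨W', hU', hW', hx, e', e, he⟩ := exists_localExpr_of_eventuallyEq θ hxW hxU h
  exact (nablaVal_eq η hU' e' hx le_rfl).trans ((he x r).trans
    (nablaVal_eq θ hW' e hx le_rfl).symm)

theorem contDiffAt_chart_symm {f : M → ℝ} (hf : ContMDiffOn 𝓘(ℝ, E) 𝓘(ℝ, ℝ) ∞ f W) {x : M}
    (hx : x ∈ W) : ContDiffAt ℝ ∞ (fun z => f ((extChartAt 𝓘(ℝ, E) x).symm z))
      (extChartAt 𝓘(ℝ, E) x x) :=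
  contDiffAt_of_contMDiffAt (mem_extChartAt_source x) (hf.contMDiffAt (W.isOpen.mem_nhds hx))

theorem IsSmoothForm.fun_smul {f : M → ℝ} (hf : ContMDiffOn 𝓘(ℝ, E) 𝓘(ℝ, ℝ) ∞ f W)
    {α : Form E M p} (hα : IsSmoothForm α W) : IsSmoothForm (fun y => f y • α y) W :=
  fun x hx => (contDiffAt_chart_symm hf hx).smul (hα x hx)

/-- The product of a local expression and a smooth function. -/
noncomputable def LocalExpr.funSMul {η : JetField E M F p} {k : ℕ} (e : LocalExpr V η k W)
    {f : M → ℝ} (hf : ContMDiffOn 𝓘(ℝ, E) 𝓘(ℝ, ℝ) ∞ f W) :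
    LocalExpr V (fun x r => f x • η x r) k W where
  ι := e.ι
  fin := e.fin
  form i := fun y => f y • e.form i y
  sec := e.sec
  smooth i := (e.smooth i).fun_smul hf
  eq x hx r hr := by
    rw [e.eq x hx r hr, Finset.smul_sum]
    refine Finset.sum_congr rfl fun i _ => ?_
    ext v w
    simp [smul_smul]

/-- The Leibniz rule at a point where the family vanishes. -/
theorem LocalExpr.dval_funSMul {η : JetField E M F p} {k : ℕ} (e : LocalExpr V η k W)
    {f : M → ℝ} (hf : ContMDiffOn 𝓘(ℝ, E) 𝓘(ℝ, ℝ) ∞ f W) {x : M} (hx : x ∈ W) {r : ℕ}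
    (hr : r ≤ k) (h0 : η x r = 0) : (e.funSMul hf).dval x r = f x • e.dval x r := by
  set z := extChartAt 𝓘(ℝ, E) x x with hz
  set l := fun z => f ((extChartAt 𝓘(ℝ, E) x).symm z) with hl
  have hlz : l z = f x := by rw [hl, hz]; simp
  have hx' : ∀ i, extD (fun y => f y • e.form i y) x = f x • extD (e.form i) x +
      ContinuousAlternatingMap.alternatizeUncurryFin ((fderiv ℝ l z).smulRight (e.form i x)) := by
    intro i
    have := extDeriv_fun_smul_form (l := l) (z := z)
      ((contDiffAt_chart_symm hf hx).differentiableAt (by simp))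
      ((e.smooth i x hx).differentiableAt (by simp))
    rw [hlz, formRep_self] at this
    exact this
  have hsum : ∀ v, ∑ i, e.form i x v • jetAt E F V (e.sec i).1 x r = 0 := fun v => by
    have := DFunLike.congr_fun (e.eq x hx r hr) v
    rw [h0, ContinuousAlternatingMap.sum_apply] at this
    exact this.symm
  ext1 v
  unfold dval
  rw [ContinuousAlternatingMap.smul_apply, ContinuousAlternatingMap.sum_apply,
    ContinuousAlternatingMap.sum_apply, Finset.smul_sum]
  change ∑ i, extD (fun y => f y • e.form i y) x v • jetAt E F V (e.sec i).1 x r =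
    ∑ i, f x • extD (e.form i) x v • jetAt E F V (e.sec i).1 x r
  simp only [hx', ContinuousAlternatingMap.add_apply, ContinuousAlternatingMap.smul_apply, add_smul,
    smul_assoc, Finset.sum_add_distrib, add_eq_left]
  -- What remains is the order `r` part of `df ∧ η` at `x`; every term of the alternating sum
  -- contains a value of `η x r`, which `hsum` makes zero.
  simp only [ContinuousAlternatingMap.alternatizeUncurryFin_apply,
    ContinuousLinearMap.smulRight_apply, ContinuousAlternatingMap.smul_apply, Finset.sum_smul]
  rw [Finset.sum_comm]
  refine Finset.sum_eq_zero fun j _ => ?_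
  simp only [smul_assoc]
  rw [← Finset.smul_sum, ← Finset.smul_sum, hsum, smul_zero, smul_zero]

/-- The product of a smooth function and a form with values in jets over `W`, extended by zero. -/
noncomputable def extendSMul {f : M → ℝ} (hf : ContMDiffOn 𝓘(ℝ, E) 𝓘(ℝ, ℝ) ∞ f U) (hWU : W ≤ U)
    (hs : ∀ x ∈ U, x ∉ W → ∀ᶠ y in 𝓝 x, f y = 0) (ζ : JetForms E F V p W) :
    JetForms E F V p U :=
  ⟨fun x r => f x • ζ.1 x r, by
    refine ⟨fun x hx k => ?_, fun x hx => ?_⟩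
    · by_cases hxW : x ∈ W
      · obtain ⟨W', hW', hxW', ⟨e⟩⟩ := ζ.2.1 x hxW k
        exact ⟨W', hW'.trans hWU, hxW', ⟨e.funSMul (hf.mono fun y hy => hWU (hW' hy))⟩⟩
      · obtain ⟨W', hW', -, hxW', e', -⟩ := exists_localExpr_of_eventuallyEq (V := V) (k := k)
          (η := fun x r => f x • ζ.1 x r) (0 : JetForms E F V p U) hx hx (by
            filter_upwards [hs x hx hxW] with y hy r _
            rw [hy]
            exact zero_smul ℝ (A := E [⋀^Fin p]→L[ℝ] (E [×r]→L[ℝ] F)) _)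
        exact ⟨W', hW', hxW', ⟨e'⟩⟩
    · funext r
      change f x • ζ.1 x r = 0
      rw [ζ.2.2 x fun h => hx (hWU h)]
      exact smul_zero (A := E [⋀^Fin p]→L[ℝ] (E [×r]→L[ℝ] F)) (f x)⟩

/-- On `W` the term `df ∧ ζ` of the Leibniz rule is zero at order `r` by `h0`; off `W` the function
vanishes near `x`, and both sides are zero. -/
theorem nabla_extendSMul {f : M → ℝ} (hf : ContMDiffOn 𝓘(ℝ, E) 𝓘(ℝ, ℝ) ∞ f U) (hWU : W ≤ U)
    (hs : ∀ x ∈ U, x ∉ W → ∀ᶠ y in 𝓝 x, f y = 0) (ζ : JetForms E F V p W) {x : M} (hx : x ∈ U)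
    {r : ℕ} (h0 : ζ.1 x r = 0) :
    (nabla E F V p U (extendSMul hf hWU hs ζ)).1 x r = f x • (nabla E F V p W ζ).1 x r := by
  by_cases hxW : x ∈ W
  · obtain ⟨W', hW', hxW', ⟨e⟩⟩ := ζ.2.1 x hxW (r + 1)
    have hf' : ContMDiffOn 𝓘(ℝ, E) 𝓘(ℝ, ℝ) ∞ f W' := hf.mono fun y hy => hWU (hW' hy)
    refine (nablaVal_eq (extendSMul hf hWU hs ζ) (hW'.trans hWU) (e.funSMul hf') hxW'
      le_rfl).trans ((e.dval_funSMul hf' hxW' (Nat.le_succ r) h0).trans ?_)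
    exact congrArg _ (nablaVal_eq ζ hW' e hxW' le_rfl).symm
  · rw [nabla_congr_of_eventuallyEq (θ := (0 : JetForms E F V p U)) hx hx, map_zero,
      (hs x hx hxW).self_of_nhds]
    · exact (zero_smul ℝ (A := E [⋀^Fin (p + 1)]→L[ℝ] (E [×r]→L[ℝ] F)) _).symm
    · filter_upwards [hs x hx hxW] with y hy m _
      change f y • ζ.1 y m = _
      rw [hy]
      exact zero_smul ℝ (A := E [⋀^Fin p]→L[ℝ] (E [×m]→L[ℝ] F)) _

/-- Sums of locally finite families of forms with values in jets. -/
theorem exists_sum_of_locallyFinite {ι : Type*} (θ : ι → JetForms E F V p U) (t : M → Finset ι)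
    (h : ∀ x ∈ U, ∀ᶠ y in 𝓝 x, ∀ i ∉ t x, (θ i).1 y = 0) : ∃ ξ : JetForms E F V p U,
      ∀ x ∈ U, ∀ r, ξ.1 x r = ∑ i ∈ t x, (θ i).1 x r ∧
        (nabla E F V p U ξ).1 x r = ∑ i ∈ t x, (nabla E F V p U (θ i)).1 x r := by
  have hsum : ∀ x ∈ U, ∀ᶠ y in 𝓝 x, ∀ r, ∑ᶠ i, (θ i).1 y r = (∑ i ∈ t x, θ i).1 y r := by
    intro x hx
    filter_upwards [h x hx] with y hy r
    rw [coe_jetForms_sum]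
    refine finsum_eq_sum_of_support_subset _ fun i hi => ?_
    by_contra hit
    exact hi (show (θ i).1 y r = 0 by rw [hy i hit]; rfl)
  set ξ : JetForms E F V p U := ⟨fun x r => ∑ᶠ i, (θ i).1 x r, mem_jetForms_of_local
    (fun x hx k => ⟨U, ∑ i ∈ t x, θ i, hx, (hsum x hx).mono fun y hy r _ => hy r⟩)
    fun x hx => funext fun r => finsum_eq_zero_of_forall_eq_zero fun i => by
      rw [(θ i).2.2 x hx]; rfl⟩ with hξ
  refine ⟨ξ, fun x hx r => ⟨?_, ?_⟩⟩
  · rw [← coe_jetForms_sum]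
    exact (hsum x hx).self_of_nhds r
  · rw [nabla_congr_of_eventuallyEq (η := ξ) (θ := ∑ i ∈ t x, θ i) hx hx
      ((hsum x hx).mono fun y hy r _ => hy r), map_sum, coe_jetForms_sum]

/-- Partitions of unity on an open subset. -/
theorem exists_partition [FiniteDimensional ℝ E] [T2Space M] [SecondCountableTopology M]
    (W : U → Opens M) (hW : ∀ c : U, (c : M) ∈ W c) :
    ∃ (f : U → M → ℝ) (t : M → Finset U), (∀ c, ContMDiffOn 𝓘(ℝ, E) 𝓘(ℝ, ℝ) ∞ (f c) U) ∧
      (∀ c, ∀ x ∈ U, x ∉ W c → ∀ᶠ y in 𝓝 x, f c y = 0) ∧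
      (∀ x ∈ U, ∀ᶠ y in 𝓝 x, ∀ c ∉ t x, f c y = 0) ∧ ∀ x ∈ U, ∑ c ∈ t x, f c x = 1 := by
  classical
  have : LocallyCompactSpace U := Manifold.locallyCompact_of_finiteDimensional 𝓘(ℝ, E)
  -- The partition is taken on the manifold `U`, indexed by its points. Its extension by zero to `M`
  -- need not be smooth across the boundary of `U`, hence the smoothness only on `U`.
  obtain ⟨ρ, hρ⟩ := SmoothPartitionOfUnity.exists_isSubordinate 𝓘(ℝ, E) (M := U) isClosed_univ
    (fun c : U => (Subtype.val ⁻¹' (W c : Set M) : Set U))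
    (fun c => (W c).isOpen.preimage continuous_subtype_val)
    (fun c _ => mem_iUnion.2 ⟨c, hW c⟩)
  set f : U → M → ℝ := fun c y => if h : y ∈ U then ρ c ⟨y, h⟩ else 0 with hf
  have hfρ : ∀ c (y : U), f c y = ρ c y := fun c y => dif_pos y.2
  have hev : ∀ {x : M} (hx : x ∈ U) {P : M → Prop}, (∀ᶠ y : U in 𝓝 (⟨x, hx⟩ : U), P y) →
      ∀ᶠ y in 𝓝 x, P y := fun {x} hx {P} h => by
    have := (U.isOpenEmbedding'.map_nhds_eq ⟨x, hx⟩)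
    rw [show 𝓝 x = Filter.map Subtype.val (𝓝 (⟨x, hx⟩ : U)) from this.symm]
    exact h
  have hex : ∀ x : U, ∃ t : Finset U, (∀ᶠ y in 𝓝 x, ∀ c ∉ t, ρ c y = 0) := by
    intro x
    obtain ⟨I, hI⟩ := ρ.toPartitionOfUnity.exists_finset_nhds x
    refine ⟨I, hI.mono fun y hy c hc => ?_⟩
    by_contra h0
    exact hc (hy.2 h0)
  choose t ht using hex
  refine ⟨f, fun x => if h : x ∈ U then t ⟨x, h⟩ else ∅, fun c => ?_, fun c x hx hxW => ?_,
    fun x hx => ?_, fun x hx => ?_⟩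
  · intro x hx
    have : ContMDiffAt 𝓘(ℝ, E) 𝓘(ℝ, ℝ) ∞ (fun y : U => f c y) ⟨x, hx⟩ := by
      simp only [hfρ]
      exact (ρ c).contMDiff.contMDiffAt
    exact (contMDiffAt_subtype_iff.1 this).contMDiffWithinAt
  · refine hev hx ?_
    have : (⟨x, hx⟩ : U) ∉ tsupport (ρ c) := fun h => hxW (hρ c h)
    filter_upwards [notMem_tsupport_iff_eventuallyEq.1 this] with y hy
    rw [hfρ, hy]
    rfl
  · refine hev hx ?_
    filter_upwards [ht ⟨x, hx⟩] with y hy c hc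
    rw [hfρ]
    exact hy c (by rwa [dif_pos hx] at hc)
  · simp only [dif_pos hx]
    rw [← ρ.sum_eq_one (mem_univ (⟨x, hx⟩ : U))]
    rw [finsum_eq_sum_of_support_subset (s := t ⟨x, hx⟩)]
    · exact Finset.sum_congr rfl fun c _ => hfρ c ⟨x, hx⟩
    · intro c hc
      by_contra hct
      exact hc ((ht ⟨x, hx⟩).self_of_nhds c hct)

/-! ### Exactness of the jet-valued de Rham complex in positive degree. -/

section Primitive

variable [FiniteDimensional ℝ E] [T2Space M] [SecondCountableTopology M]

/-- A closed form of positive degree that vanishes below order `q` has a primitive to order `q`. -/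
theorem exists_primitive_to_order {η : JetForms E F V (p + 1) U}
    (hq : ∀ x ∈ U, ∀ r < q, η.1 x r = 0) (hη : nabla E F V (p + 1) U η = 0) :
    ∃ ξ : JetForms E F V p U, (∀ x ∈ U, ∀ r < q + 1, ξ.1 x r = 0) ∧
      ∀ x ∈ U, ∀ r < q + 1, (nabla E F V p U ξ).1 x r = η.1 x r := by
  choose W hWU hxW ζ hζ0 hζ using fun c : U => exists_local_primitive hq hη c.2
  obtain ⟨f, t, hf, hfs, hft, hf1⟩ := exists_partition (E := E) W hxW
  have hζ0' : ∀ c x, ∀ r < q + 1, (ζ c).1 x r = 0 := fun c x r hr => by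
    by_cases hx : x ∈ W c
    · exact hζ0 c x hx r hr
    · rw [(ζ c).2.2 x hx]; rfl
  obtain ⟨ξ, hξ⟩ := exists_sum_of_locallyFinite
    (fun c => extendSMul (hf c) (hWU c) (hfs c) (ζ c)) t fun x hx => by
      filter_upwards [hft x hx] with y hy c hc
      funext r
      change f c y • (ζ c).1 y r = 0
      rw [hy c hc]
      exact zero_smul ℝ (A := E [⋀^Fin p]→L[ℝ] (E [×r]→L[ℝ] F)) _
  refine ⟨ξ, fun x hx r hr => ?_, fun x hx r hr => ?_⟩
  · rw [(hξ x hx r).1]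
    refine Finset.sum_eq_zero fun c _ => ?_
    change f c x • (ζ c).1 x r = 0
    rw [hζ0' c x r hr]
    exact smul_zero (A := E [⋀^Fin p]→L[ℝ] (E [×r]→L[ℝ] F)) (f c x)
  · rw [(hξ x hx r).2]
    -- The terms `d(f c) ∧ ζ c` vanish at order `r < q + 1` because `ζ c` does, so the derivatives
    -- add up to `(∑ f c) η = η`.
    have : ∀ c, (nabla E F V p U (extendSMul (hf c) (hWU c) (hfs c) (ζ c))).1 x r =
        f c x • η.1 x r := fun c => by
      rw [nabla_extendSMul _ _ _ _ hx (hζ0' c x r hr)]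
      by_cases hxc : x ∈ W c
      · rw [hζ c x hxc r hr]
      · rw [(hfs c x hx hxc).self_of_nhds]
        exact (zero_smul ℝ (A := E [⋀^Fin (p + 1)]→L[ℝ] (E [×r]→L[ℝ] F)) _).trans
          (zero_smul ℝ (A := E [⋀^Fin (p + 1)]→L[ℝ] (E [×r]→L[ℝ] F)) _).symm
    simp only [this]
    rw [← Finset.sum_smul, hf1 x hx]
    exact one_smul ℝ (_ : E [⋀^Fin (p + 1)]→L[ℝ] (E [×r]→L[ℝ] F))

variable (E F V p U) in
/-- The closed forms with values in jets that vanish below order `q`. -/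
def ClosedBelow (q : ℕ) : Type u :=
  {η : JetForms E F V p U // (∀ x ∈ U, ∀ r < q, η.1 x r = 0) ∧ nabla E F V p U η = 0}

noncomputable def ClosedBelow.prim {q : ℕ} (η : ClosedBelow E F V (p + 1) U q) :
    JetForms E F V p U := (exists_primitive_to_order η.2.1 η.2.2).choose

theorem ClosedBelow.prim_eq_zero {q : ℕ} (η : ClosedBelow E F V (p + 1) U q) {x : M} {r : ℕ}
    (hr : r < q + 1) : η.prim.1 x r = 0 := by
  by_cases hx : x ∈ U
  · exact (exists_primitive_to_order η.2.1 η.2.2).choose_spec.1 x hx r hr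
  · rw [η.prim.2.2 x hx]; rfl

/-- The primitive reproduces `η` below order `q + 1`, and `∇ ∘ ∇ = 0` keeps the remainder closed. -/
noncomputable def ClosedBelow.next {q : ℕ} (η : ClosedBelow E F V (p + 1) U q) :
    ClosedBelow E F V (p + 1) U (q + 1) :=
  ⟨η.1 - nabla E F V p U η.prim, fun x hx r hr => by
    change η.1.1 x r - (nabla E F V p U η.prim).1 x r = 0
    rw [(exists_primitive_to_order η.2.1 η.2.2).choose_spec.2 x hx r hr |>.symm]
    exact sub_self (_ : E [⋀^Fin (p + 1)]→L[ℝ] (E [×r]→L[ℝ] F)), by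
    rw [map_sub, η.2.2, nabla_nabla, sub_zero]⟩

noncomputable def ClosedBelow.iter (η : ClosedBelow E F V (p + 1) U 0) :
    (q : ℕ) → ClosedBelow E F V (p + 1) U q
  | 0 => η
  | q + 1 => (iter η q).next

theorem ClosedBelow.iter_eq (η : ClosedBelow E F V (p + 1) U 0) (q : ℕ) :
    (η.iter q).1 = η.1 - nabla E F V p U (∑ j ∈ Finset.range q, (η.iter j).prim) := by
  induction q with
  | zero => simp [iter]
  | succ q ih =>
    rw [Finset.sum_range_succ, map_add, ← sub_sub, ← ih]
    rfl

/-- Closed forms of positive degree with values in jets are exact. -/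
theorem exists_primitive (η : JetForms E F V (p + 1) U) (hη : nabla E F V (p + 1) U η = 0) :
    ∃ ξ : JetForms E F V p U, nabla E F V p U ξ = η := by
  set η₀ : ClosedBelow E F V (p + 1) U 0 := ⟨η, fun _ _ r hr => by omega, hη⟩
  -- The `j`-th primitive vanishes below order `j + 1`, so at order `r` only the terms with `j < r`
  -- contribute.
  have hstab : ∀ (k : ℕ) (y : M), ∀ r ≤ k, ∑ j ∈ Finset.range r, (η₀.iter j).prim.1 y r =
      (∑ j ∈ Finset.range k, (η₀.iter j).prim).1 y r := fun k y r hr => by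
    rw [coe_jetForms_sum]
    refine Finset.sum_subset (Finset.range_subset_range.2 hr) fun j _ hj => ?_
    exact (η₀.iter j).prim_eq_zero (by simpa [Nat.lt_succ_iff] using hj)
  -- The formal sum of all the primitives, cut off at each order `r` after its last nonzero term.
  -- Smoothness is tested at finite orders, where it agrees with a finite sum.
  set ξ : JetForms E F V p U := ⟨fun x r => ∑ j ∈ Finset.range r, (η₀.iter j).prim.1 x r,
    mem_jetForms_of_local (fun x hx k => ⟨U, _, hx, Eventually.of_forall (hstab k)⟩)
      fun x hx => funext fun r => Finset.sum_eq_zero fun j _ => by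
        rw [(η₀.iter j).prim.2.2 x hx]; rfl⟩
  refine ⟨ξ, Subtype.ext (funext fun x => funext fun r => ?_)⟩
  by_cases hx : x ∈ U
  -- Order `r` of `∇ξ` depends on the orders of `ξ` up to `r + 1`, where `ξ` is the sum of `r + 1`
  -- primitives; the remainder after `r + 1` steps vanishes at order `r`.
  · rw [nabla_congr_of_eventuallyEq (η := ξ) hx hx (Eventually.of_forall (hstab (r + 1)))]
    have h1 := (η₀.iter (r + 1)).2.1 x hx r (Nat.lt_succ_self r)
    rw [η₀.iter_eq] at h1
    exact (sub_eq_zero.1 h1).symm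
  · rw [(nabla E F V p U ξ).2.2 x hx, η.2.2 x hx]

end Primitive

end Gluing


/-! ### Horizontal forms of degree zero are jets of sections. -/

section Horizontal

variable {E : Type u} [NormedAddCommGroup E] [NormedSpace ℝ E]
  {M : Type u} [TopologicalSpace M] [ChartedSpace E M] [IsManifold 𝓘(ℝ, E) ∞ M]
  {F : Type u} [NormedAddCommGroup F] [NormedSpace ℝ F]
  {V : M → Type u} [TopologicalSpace (TotalSpace F V)]
  [∀ x, AddCommGroup (V x)] [∀ x, Module ℝ (V x)] [∀ x, TopologicalSpace (V x)]
  [FiberBundle F V] [VectorBundle ℝ F V] [ContMDiffVectorBundle ∞ F V 𝓘(ℝ, E)]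
  {p : ℕ} {W U : Opens M}

/-- The fibre at `x` in the preferred trivialization there. -/
noncomputable def fibreEquiv (V : M → Type u) [TopologicalSpace (TotalSpace F V)]
    [∀ x, AddCommGroup (V x)] [∀ x, Module ℝ (V x)] [∀ x, TopologicalSpace (V x)]
    [FiberBundle F V] [VectorBundle ℝ F V] (x : M) : V x ≃ₗ[ℝ] F :=
  (trivializationAt F V x).linearEquivAt ℝ x (mem_baseSet_trivializationAt F V x)

theorem jetAt_zero_apply (s : (x : M) → V x) (x : M) (w : Fin 0 → E) :
    jetAt E F V s x 0 w = fibreEquiv V x (s x) := by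
  rw [jetAt, iteratedFDeriv_zero_apply, coordRep,
    (extChartAt 𝓘(ℝ, E) x).left_inv (mem_extChartAt_source x)]
  rfl

theorem jet_apply_zero (s : SmoothSections E F V U) {x : M} (hx : x ∈ U) (v w : Fin 0 → E) :
    (jet E F V U s).1 x 0 v w = fibreEquiv V x (s.1 x) := by
  have : (jet E F V U s).1 x 0 = (oneForm E M x).smulRight (jetAt E F V s.1 x 0) := if_pos hx
  rw [this]
  change ((1 : ℝ) • jetAt E F V s.1 x 0) w = _
  rw [one_smul, jetAt_zero_apply]

/-- The Taylor coefficient of order zero is the value of the section in the trivialization at the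
point. -/
theorem jet_injective : Function.Injective (jet E F V U) := by
  refine (injective_iff_map_eq_zero _).2 fun s hs => Subtype.ext (funext fun x => ?_)
  by_cases hx : x ∈ U
  · have := jet_apply_zero s hx ![] ![]
    rw [hs] at this
    exact (LinearEquiv.map_eq_zero_iff _).1 this.symm
  · exact s.2.2 x hx

theorem contMDiffOn_form_zero {α : Form E M 0} (hα : IsSmoothForm α W) :
    ContMDiffOn 𝓘(ℝ, E) 𝓘(ℝ, ℝ) ∞ (fun y => α y ![]) W := by
  intro x hx
  refine ContMDiffAt.contMDiffWithinAt ?_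
  rw [contMDiffAt_iff_source_of_mem_source (x := x) (by simp)]
  have h : ContDiffAt ℝ ∞ (fun z => formRep α x z ![]) (extChartAt 𝓘(ℝ, E) x x) :=
    (ContinuousLinearMap.contDiff (ContinuousAlternatingMap.apply ℝ E ℝ ![])).contDiffAt.comp _
      (hα x hx)
  have e : (fun z => formRep α x z ![]) =
      (fun y => α y ![]) ∘ (extChartAt 𝓘(ℝ, E) x).symm := by
    funext z
    exact congrArg (α ((extChartAt 𝓘(ℝ, E) x).symm z)) (Subsingleton.elim _ _)
  rw [e, ← contMDiffAt_iff_contDiffAt] at h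
  simpa [contMDiffWithinAt_univ] using h

/-- Every form of degree `0` with values in jets has a smooth underlying section. -/
theorem exists_section_zero (η : JetForms E F V 0 U) :
    ∃ s : SmoothSections E F V U, ∀ x ∈ U, (jet E F V U s).1 x 0 = η.1 x 0 := by
  set s : (x : M) → V x := fun x => (fibreEquiv V x).symm (η.1 x 0 ![] ![]) with hs
  have hmem : s ∈ SmoothSections E F V U := by
    refine ⟨fun x hx => ?_, fun x hx => ?_⟩
    · obtain ⟨W, -, hxW, ⟨e⟩⟩ := η.2.1 x hx 0
      -- Scalar forms of degree `0` are functions, so near `x` the candidate is the combination of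
      -- the smooth sections of an expression with smooth functions as coefficients.
      set S : SmoothSections E F V W := ∑ i, mulSec (contMDiffOn_form_zero (e.smooth i)) (e.sec i)
      refine ((contMDiffAt_sec S hxW).congr_of_eventuallyEq ?_).contMDiffWithinAt
      filter_upwards [W.isOpen.mem_nhds hxW] with y hy
      congr 1
      have h1 : S.1 y = ∑ i, e.form i y ![] • (e.sec i).1 y := by
        rw [AddSubmonoidClass.coe_finsetSum, Finset.sum_apply]
        rfl
      rw [h1, hs, LinearEquiv.symm_apply_eq, map_sum, e.eq y hy 0 le_rfl,
        ContinuousAlternatingMap.sum_apply]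
      change (∑ i, e.form i y ![] • jetAt E F V (e.sec i).1 y 0) ![] = _
      rw [_root_.sum_apply]
      refine Finset.sum_congr rfl fun i _ => ?_
      rw [map_smul, _root_.smul_apply, jetAt_zero_apply]
    · simp only [hs, η.2.2 x hx]
      exact map_zero _
  refine ⟨⟨s, hmem⟩, fun x hx => ?_⟩
  ext v w
  rw [jet_apply_zero _ hx]
  simp only [hs, LinearEquiv.apply_symm_apply]
  rw [Subsingleton.elim v ![], Subsingleton.elim w ![]]

/-- The horizontal forms of degree `0` with values in jets are the jets of sections. -/
theorem exists_section [FiniteDimensional ℝ E] (η : JetForms E F V 0 U)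
    (hη : nabla E F V 0 U η = 0) : ∃ s : SmoothSections E F V U, jet E F V U s = η := by
  obtain ⟨s, hs⟩ := exists_section_zero η
  refine ⟨s, (sub_eq_zero.1 ?_).symm⟩
  have hc : nabla E F V 0 U (η - jet E F V U s) = 0 := by
    rw [map_sub, hη, nabla_jet, sub_zero]
  -- Order zero vanishes by the choice of `s`; each further order follows from horizontality.
  have key : ∀ q : ℕ, ∀ x ∈ U, ∀ r < q + 1, (η - jet E F V U s).1 x r = 0 := by
    intro q
    induction q with
    | zero =>
      intro x hx r hr
      obtain rfl : r = 0 := by omega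
      change η.1 x 0 - (jet E F V U s).1 x 0 = 0
      rw [hs x hx]
      exact sub_self (_ : E [⋀^Fin 0]→L[ℝ] (E [×0]→L[ℝ] F))
    | succ q ih => exact vanish_succ_of_horizontal ih hc
  refine Subtype.ext (funext fun x => ?_)
  by_cases hx : x ∈ U
  · exact funext fun r => key r x hx r (Nat.lt_succ_self r)
  · exact (η - jet E F V U s).2.2 x hx

/-- More than `dim E` vectors are linearly dependent. This bounds `p` and lets the descending
staircase start, whatever the range of `i`. -/
theorem jetForms_eq_zero [FiniteDimensional ℝ E] (hp : Module.finrank ℝ E < p)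
    (η : JetForms E F V p U) : η = 0 := by
  refine Subtype.ext (funext fun x => funext fun r => ?_)
  ext1 v
  refine (η.1 x r).toAlternatingMap.map_linearDependent v fun h => ?_
  have := h.fintype_card_le_finrank
  rw [Fintype.card_fin] at this
  omega

end Horizontal

/-! ### Quasi-isomorphisms of complexes of modules in terms of elements. -/

section QuasiIso

open CategoryTheory

/-- A criterion for quasi-isomorphisms of short complexes of modules in terms of elements. -/
theorem shortComplex_quasiIso {R : Type*} [Ring R] {S₁ S₂ : ShortComplex (ModuleCat.{u} R)}
    (φ : S₁ ⟶ S₂)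
    (inj : ∀ x : S₁.X₂, S₁.g x = 0 → (∃ y : S₂.X₁, S₂.f y = φ.τ₂ x) → ∃ x₁, S₁.f x₁ = x)
    (surj : ∀ y : S₂.X₂, S₂.g y = 0 → ∃ x : S₁.X₂, S₁.g x = 0 ∧ ∃ y₁, y = φ.τ₂ x + S₂.f y₁) :
    ShortComplex.QuasiIso φ := by
  let γ : ShortComplex.LeftHomologyMapData φ S₁.moduleCatLeftHomologyData
    S₂.moduleCatLeftHomologyData := default
  rw [γ.quasiIso_iff]
  have hi : ∀ x : LinearMap.ker S₁.g.hom,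
      Subtype.val (p := fun y => y ∈ LinearMap.ker S₂.g.hom) (γ.φK x) = φ.τ₂ x.1 := fun x => by
    have h := LinearMap.congr_fun (congrArg ModuleCat.Hom.hom γ.commi) x
    exact h
  have hπ : ∀ x : LinearMap.ker S₁.g.hom,
      γ.φH ((LinearMap.range S₁.moduleCatToCycles).mkQ x) =
        (LinearMap.range S₂.moduleCatToCycles).mkQ (γ.φK x) := fun x =>
    ConcreteCategory.congr_hom γ.commπ x
  have h1 : Mono γ.φH := by
    rw [ModuleCat.mono_iff_injective]
    refine (injective_iff_map_eq_zero _).2 fun a ha => ?_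
    obtain ⟨x, rfl⟩ := (LinearMap.range S₁.moduleCatToCycles).mkQ_surjective a
    have h2 := (Submodule.Quotient.mk_eq_zero _).1 ((hπ x).symm.trans ha)
    obtain ⟨y, hy⟩ := h2
    obtain ⟨x₁, hx₁⟩ := inj x.1 x.2 ⟨y, (congrArg Subtype.val hy).trans (hi x)⟩
    exact (Submodule.Quotient.mk_eq_zero _).2 ⟨x₁, Subtype.ext hx₁⟩
  have h2 : Epi γ.φH := by
    rw [ModuleCat.epi_iff_surjective]
    intro b
    obtain ⟨y, rfl⟩ := (LinearMap.range S₂.moduleCatToCycles).mkQ_surjective b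
    obtain ⟨x, hx, y₁, hy⟩ := surj y.1 y.2
    refine ⟨(LinearMap.range S₁.moduleCatToCycles).mkQ ⟨x, hx⟩, (hπ ⟨x, hx⟩).trans ?_⟩
    -- The difference of the two cycles is the image of `x` minus `y`, hence the sign of the
    -- witness.
    refine ((Submodule.Quotient.eq _).2 ⟨-y₁, Subtype.ext ?_⟩)
    have h3 := hi ⟨x, hx⟩
    change S₂.f (-y₁) = Subtype.val (p := fun y => y ∈ LinearMap.ker S₂.g.hom) (γ.φK ⟨x, hx⟩) - y.1
    rw [h3, hy, map_neg]
    simp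
  exact isIso_of_mono_of_epi _

end QuasiIso

/-! ### The staircase argument in the total complex. -/

section Staircase

variable {E : Type u} [NormedAddCommGroup E] [NormedSpace ℝ E] [FiniteDimensional ℝ E]
  {M : Type u} [TopologicalSpace M] [T2Space M] [SecondCountableTopology M]
  [ChartedSpace E M] [IsManifold 𝓘(ℝ, E) ∞ M]
  {F : ℤ → Type u} [∀ i, NormedAddCommGroup (F i)] [∀ i, NormedSpace ℝ (F i)]
  {V : ℤ → M → Type u} [∀ i, TopologicalSpace (TotalSpace (F i) (V i))]
  [∀ i x, AddCommGroup (V i x)] [∀ i x, Module ℝ (V i x)] [∀ i x, TopologicalSpace (V i x)]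
  [∀ i, FiberBundle (F i) (V i)] [∀ i, VectorBundle ℝ (F i) (V i)]
  [∀ i, ContMDiffVectorBundle ∞ (F i) (V i) 𝓘(ℝ, E)]
  (C : DifferentialComplex E F V) (U : Opens M)

namespace DifferentialComplex

variable {U} in
theorem exists_tot_of_comp {n : ℤ} (p : ℕ) (i : ℤ) (h : (p : ℤ) + i = n)
    (ξ : JetTerm E F V U p i) : ∃ y : TotJetForms E F V U n, comp E F V U p i h y = ξ ∧
      ∀ p' i' h', p' ≠ p → comp E F V U p' i' h' y = 0 := by
  classical
  refine ⟨Pi.single (M := fun q : {q : ℕ × ℤ // (q.1 : ℤ) + q.2 = n} =>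
    JetTerm E F V U q.1.1 q.1.2) ⟨(p, i), h⟩ ξ, Pi.single_eq_same _ _, fun p' i' h' hp => ?_⟩
  exact Pi.single_eq_of_ne (M := fun q : {q : ℕ × ℤ // (q.1 : ℤ) + q.2 = n} =>
    JetTerm E F V U q.1.1 q.1.2) (i := ⟨(p, i), h⟩) (i' := ⟨(p', i'), h'⟩)
    (fun e => hp (congrArg (fun q => q.1.1) e)) ξ

/-- An element whose differential has only a component with `p = 0` is cohomologous to one that has
only such a component. -/
theorem exists_sub_concentrated (n : ℤ) (x : TotJetForms E F V U (n + 1))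
    (hx : ∀ p i h, comp E F V U (p + 1) i h (C.totD U (n + 1) x) = 0) :
    ∃ y : TotJetForms E F V U n, ∀ p i h, comp E F V U (p + 1) i h (x - C.totD U n y) = 0 := by
  -- Descending induction: `N` bounds the form degrees `p` that occur in `x`, and the condition on
  -- `totD x` is unchanged when a coboundary is subtracted.
  have key : ∀ (N : ℕ) (x : TotJetForms E F V U (n + 1)),
      (∀ p i h, comp E F V U (p + 1) i h (C.totD U (n + 1) x) = 0) →
      (∀ p i h, N ≤ p → comp E F V U (p + 1) i h x = 0) →
      ∃ y : TotJetForms E F V U n, ∀ p i h, comp E F V U (p + 1) i h (x - C.totD U n y) = 0 := by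
    intro N
    induction N with
    | zero =>
      intro x _ h0
      exact ⟨0, fun p i h => by rw [map_zero, sub_zero, h0 p i h (Nat.zero_le p)]⟩
    | succ N ih =>
      intro x hx h0
      have hN : ((N + 1 : ℕ) : ℤ) + (n - N) = n + 1 := by push_cast; ring
      have hN' : (N : ℤ) + (n - N) = n := by ring
      -- In form degree `N + 2` the differential has the parts `∇ x_{N+1}` and `± J(d) x_{N+2}`. The
      -- second is zero by the bound, so the top component `x_{N+1}` is `∇`-closed.
      have h1 := hx (N + 1) (n - N) (by push_cast; ring)
      rw [totD_succ, h0 (N + 1) _ _ le_rfl, map_zero, smul_zero, add_zero] at h1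
      obtain ⟨ξ, hξ⟩ : ∃ ξ : JetTerm E F V U N (n - N),
          nablaTerm E F V U N (n - N) ξ = comp E F V U (N + 1) (n - N) hN x :=
        exists_primitive _ h1
      obtain ⟨y₁, hy₁, hy₁'⟩ := exists_tot_of_comp N (n - N) hN' ξ
      obtain ⟨y₂, hy₂⟩ := ih (x - C.totD U n y₁)
        (fun p i h => by rw [map_sub, C.totD_totD, sub_zero, hx])
        -- As `y₁` lives in form degree `N`, its coboundary lives in degrees `N` and `N + 1`: it
        -- cancels the top component and leaves those above it zero.
        (fun p i h hp => by
          rw [map_sub, totD_succ, hy₁' (p + 1) _ _ (by omega), map_zero, smul_zero, add_zero]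
          rcases hp.eq_or_lt with rfl | hlt
          · obtain rfl : i = n - N := by push_cast at h; omega
            rw [hy₁, hξ, sub_self]
          · rw [hy₁' p _ _ (by omega), map_zero, sub_zero, h0 p i h hlt])
      exact ⟨y₁ + y₂, fun p i h => by rw [map_add, ← sub_sub, hy₂]⟩
  exact key (Module.finrank ℝ E) x hx fun p i h hp => jetForms_eq_zero (by omega) _

/-- A concentrated element whose differential is concentrated is the jet of a section. -/
theorem exists_jetTot_eq (n : ℤ) (x : TotJetForms E F V U n)
    (hx : ∀ p i h, comp E F V U (p + 1) i h x = 0)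
    (hdx : ∀ p i h, comp E F V U (p + 1) i h (C.totD U n x) = 0) :
    ∃ s : SmoothSections E (F n) (V n) U, jetTot E F V U n s = x := by
  have h0 : ((0 : ℕ) : ℤ) + n = n := by simp
  -- The component of form degree `1` of `totD x` is `∇ x_0`, since `x_1 = 0`; so `x_0` is
  -- horizontal.
  have h1 := hdx 0 n (by push_cast; ring)
  rw [totD_succ, hx, map_zero, smul_zero, add_zero] at h1
  obtain ⟨s, hs⟩ : ∃ s : SmoothSections E (F n) (V n) U,
      jetTerm E F V U n s = comp E F V U 0 n h0 x := exists_section _ h1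
  refine ⟨s, tot_ext U fun p i h => ?_⟩
  rcases p with _ | p
  · obtain rfl : i = n := by simpa using h
    rw [jetTot_same, hs]
  · rw [jetTot_succ, hx]

theorem jetTot_injective (n : ℤ) : Function.Injective (jetTot E F V U n) := by
  intro s t hst
  have h0 : ((0 : ℕ) : ℤ) + n = n := by simp
  have := congrArg (comp E F V U 0 n h0) hst
  rw [jetTot_same, jetTot_same] at this
  exact jet_injective this

/-- Surjectivity on cohomology. A cocycle is corrected by a coboundary to the jet of a section, and
that section is a cocycle because the jet map commutes with the differentials and is injective. -/
theorem exists_section_add_totD (n : ℤ) (x : TotJetForms E F V U (n + 1))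
    (hx : C.totD U (n + 1) x = 0) : ∃ s : SmoothSections E (F (n + 1)) (V (n + 1)) U,
      (C.d (n + 1) (n + 1 + 1) rfl).app U s = 0 ∧
      ∃ y : TotJetForms E F V U n, x = jetTot E F V U (n + 1) s + C.totD U n y := by
  obtain ⟨y, hy⟩ := C.exists_sub_concentrated U n x fun p i h => by rw [hx, map_zero]
  have hd : C.totD U (n + 1) (x - C.totD U n y) = 0 := by
    rw [map_sub, hx, C.totD_totD, sub_zero]
  obtain ⟨s, hs⟩ := C.exists_jetTot_eq U (n + 1) _ hy fun p i h => by rw [hd, map_zero]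
  refine ⟨s, jetTot_injective U _ ?_, y, by rw [hs, sub_add_cancel]⟩
  rw [← C.totD_jetTot, hs, hd, map_zero]

/-- Injectivity on cohomology. Here `y` is not a cocycle, but its differential is a jet and so lies
in `p = 0`; this is the case for which `exists_sub_concentrated` asks less than closedness. -/
theorem exists_section_of_jetTot_eq (n : ℤ) (s : SmoothSections E (F (n + 1 + 1)) (V (n + 1 + 1)) U)
    (y : TotJetForms E F V U (n + 1)) (hy : C.totD U (n + 1) y = jetTot E F V U (n + 1 + 1) s) :
    ∃ t : SmoothSections E (F (n + 1)) (V (n + 1)) U,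
      (C.d (n + 1) (n + 1 + 1) rfl).app U t = s := by
  obtain ⟨z, hz⟩ := C.exists_sub_concentrated U n y fun p i h => by rw [hy, jetTot_succ]
  have hd : C.totD U (n + 1) (y - C.totD U n z) = jetTot E F V U (n + 1 + 1) s := by
    rw [map_sub, hy, C.totD_totD, sub_zero]
  obtain ⟨t, ht⟩ := C.exists_jetTot_eq U (n + 1) _ hz fun p i h => by rw [hd, jetTot_succ]
  exact ⟨t, jetTot_injective U _ (by rw [← C.totD_jetTot, ht, hd])⟩

open CategoryTheory

theorem quasiIso_jetMap : QuasiIso (C.jetMap U) := by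
  refine ⟨fun m => ?_⟩
  -- With `m = n + 1 + 1` both `m` and the preceding degree are successors, so the two lemmas on
  -- representatives apply without transport between degrees.
  obtain ⟨n, rfl⟩ : ∃ n : ℤ, m = n + 1 + 1 := ⟨m - 2, by ring⟩
  rw [quasiIsoAt_iff' _ (n + 1) (n + 1 + 1) (n + 1 + 1 + 1) (by simp) (by simp)]
  have hK : ∀ k, (C.sections U).d k (k + 1) = ModuleCat.ofHom ((C.d k (k + 1) rfl).app U) :=
    CochainComplex.of_d
      (fun n => ModuleCat.of ℝ (SmoothSections E (F n) (V n) U))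
      (fun n => ModuleCat.ofHom ((C.d n (n + 1) rfl).app U))
  have hL : ∀ k, (C.deRhamJet U).d k (k + 1) = ModuleCat.ofHom (C.totD U k) :=
    CochainComplex.of_d
      (fun n => ModuleCat.of ℝ (TotJetForms E F V U n)) (fun n => ModuleCat.ofHom (C.totD U n))
  refine shortComplex_quasiIso _ ?_ ?_
  · rintro s - ⟨y, hy⟩
    obtain ⟨t, ht⟩ := C.exists_section_of_jetTot_eq U n s y
      ((ConcreteCategory.congr_hom (hL (n + 1)) y).symm.trans hy)
    exact ⟨t, (ConcreteCategory.congr_hom (hK (n + 1)) t).trans ht⟩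
  · intro x hx
    obtain ⟨s, hs, y, hy⟩ := C.exists_section_add_totD U (n + 1) x
      ((ConcreteCategory.congr_hom (hL (n + 1 + 1)) x).symm.trans hx)
    refine ⟨s, (ConcreteCategory.congr_hom (hK (n + 1 + 1)) s).trans hs, y, hy.trans ?_⟩
    exact congrArg _ (ConcreteCategory.congr_hom (hL (n + 1)) y).symm

end DifferentialComplex

end Staircase

end JetComplex

theorem mainTheorem12
    -- a smooth manifold `M` (finite-dimensional, Hausdorff, second countable, without boundary)
    {E : Type u} [NormedAddCommGroup E] [NormedSpace ℝ E] [FiniteDimensional ℝ E]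
    {M : Type u} [TopologicalSpace M] [T2Space M] [SecondCountableTopology M]
    [ChartedSpace E M] [IsManifold 𝓘(ℝ, E) ∞ M]
    -- smooth vector bundles `V i` of finite rank, with model fibres `F i`, for all integers `i`
    {F : ℤ → Type u} [∀ i, NormedAddCommGroup (F i)] [∀ i, NormedSpace ℝ (F i)]
    [∀ i, FiniteDimensional ℝ (F i)]
    {V : ℤ → M → Type u} [∀ i, TopologicalSpace (TotalSpace (F i) (V i))]
    [∀ i x, AddCommGroup (V i x)] [∀ i x, Module ℝ (V i x)] [∀ i x, TopologicalSpace (V i x)]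
    [∀ i, FiberBundle (F i) (V i)] [∀ i, VectorBundle ℝ (F i) (V i)]
    [∀ i, ContMDiffVectorBundle ∞ (F i) (V i) 𝓘(ℝ, E)]
    -- a differential complex on the sheaves of smooth sections of the `V i`
    (C : JetComplex.DifferentialComplex E F V) (U : Opens M) :
    QuasiIso (C.jetMap U) :=
  C.quasiIso_jetMap U
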